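/- Consider the problem $\min_{Ax=b} f(x)$ with $f(x)=c^{\top}x+\|Mx\|_2^2+\|Nx\|_p^p$, where $A\in\mathbb R^{d\times n}$, $M\in\mathbb R^{m_1\times n}$, $N\in\mathbb R^{m_2\times n}$, $b\in\mathbb R^d$, $c\in\mathbb R^n$, $n\ge 1$, $d\le n\le \min\{m_1,m_2\}$, $c\perp \ker M\cap\ker N\cap\ker A$, and put $m=\max\{m_1,m_2\}$. There are an algorithm and an absolute constant $C$ such that, for all such data, all real $p\ge 2$ and $\varepsilon>0$, and every $x^{(0)}$ with $Ax^{(0)}=b$, the problem has an optimizer $x^\star$ and the algorithm, started from $x^{(0)}$, halts and returns $\tilde x$ with $A\tilde x=b$ and $f(\tilde x)\le f(x^\star)+\varepsilon$, using at most $$C\,p\,m^{\frac{p-2}{3p-2}}\Bigl(1+\log^{+}\frac{f(x^{(0)})-f(x^\star)}{\varepsilon}\Bigr),\qquad \log^+ t=\max\{0,\log t\}\ \ (\log^+0=0),$$ calls to a linear system solver, and at most that number of executed operations in total (the calls included). Here an algorithm is one fixed finite program, the same for all inputs, with branching and while-loops, in exact real arithmetic, over registers that hold vectors of $\mathbb R,\mathbb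 R^n,\mathbb R^d,\mathbb R^{m_1},\mathbb R^{m_2}$ and of direct sums of these. Its input is $p,\varepsilon,n,d,m_1,m_2,x^{(0)},b,c$. Its elementary operations are rational constants, coordinatewise $+,-,\times,/$ (with $t/0=0$), $|s|^t$, maximum and comparison, copying a scalar to all coordinates, inner products, forming and splitting pairs, tests $s<t$ of scalars, products of a vector with a matrix, and calls to the solver. The matrices are given by fixed expressions built from $A$, $M$, $N$, zero matrices, diagonal matrices and columns of register vectors by sums, products, multiples by register scalars, transposes and $2\times 2$ blocks. A linear system solver is any function that returns a solution $z$ of a square system $Kz=r$ whenever one exists (its answer is arbitrary otherwise); the guarantee holds for every such solver. -/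

import Mathlib

open scoped Matrix

namespace LpRegression

/-! ### The optimization problem -/

/-- The sizes of an instance: `n` variables, `d` linear constraints, `m₁` and `m₂` rows of the
matrices in the quadratic and in the `p`-norm term. -/
structure Dims where
  n : ℕ
  d : ℕ
  m₁ : ℕ
  m₂ : ℕ

/-- `m = max {m₁, m₂}`. -/
def Dims.m (D : Dims) : ℕ := max D.m₁ D.m₂

/-- The data of the problem `min_{A x = b} ⟨c, x⟩ + ‖M x‖₂² + ‖N x‖_p^p`. -/
structure Problem (D : Dims) where
  A : Matrix (Fin D.d) (Fin D.n) ℝ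
  M : Matrix (Fin D.m₁) (Fin D.n) ℝ
  N : Matrix (Fin D.m₂) (Fin D.n) ℝ
  b : Fin D.d → ℝ
  c : Fin D.n → ℝ

namespace Problem

variable {D : Dims}

/-- `f(x) = ⟨c, x⟩ + ‖M x‖₂² + ‖N x‖_p^p`. -/
noncomputable def objective (Q : Problem D) (p : ℝ) (x : Fin D.n → ℝ) : ℝ :=
  Q.c ⬝ᵥ x + ∑ i, (Q.M *ᵥ x) i ^ 2 + ∑ i, |(Q.N *ᵥ x) i| ^ p

/-- `x` satisfies the linear constraints `A x = b`. -/
def Feasible (Q : Problem D) (x : Fin D.n → ℝ) : Prop := Q.A *ᵥ x = Q.b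

/-- `c ⊥ ker M ∩ ker N ∩ ker A`. -/
def LinearTermOrthogonal (Q : Problem D) : Prop :=
  ∀ v : Fin D.n → ℝ, Q.M *ᵥ v = 0 → Q.N *ᵥ v = 0 → Q.A *ᵥ v = 0 → Q.c ⬝ᵥ v = 0

/-- `x` minimizes the objective over the feasible points. -/
def IsOptimizer (Q : Problem D) (p : ℝ) (x : Fin D.n → ℝ) : Prop :=
  Q.Feasible x ∧ ∀ y, Q.Feasible y → Q.objective p x ≤ Q.objective p y

end Problem

/-! ### The model of computation

An algorithm is a finite program over registers that hold real vectors, in exact arithmetic.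
Vectors are manipulated by coordinatewise operations, inner products and products with matrices
that are composed of `A`, `M`, `N` and of register contents. Linear systems in such matrices are
handed to a linear system solver. Both the calls to the solver and all executed operations
are counted. -/

/-- The names of the vector spaces `ℝ`, `ℝⁿ`, `ℝᵈ`, `ℝ^{m₁}`, `ℝ^{m₂}` and their direct sums. -/
inductive Space where
  | scalar
  | var
  | con
  | rowM
  | rowN
  | sum (s t : Space)
  deriving DecidableEq

/-- The coordinates of the vectors in a space. -/
def Space.Idx (D : Dims) : Space → Type
  | .scalar => Unit
  | .var => Fin D.n
  | .con => Fin D.d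
  | .rowM => Fin D.m₁
  | .rowN => Fin D.m₂
  | .sum s t => s.Idx D ⊕ t.Idx D

instance Space.fintypeIdx (D : Dims) : (s : Space) → Fintype (s.Idx D)
  | .scalar => inferInstanceAs (Fintype Unit)
  | .var => inferInstanceAs (Fintype (Fin D.n))
  | .con => inferInstanceAs (Fintype (Fin D.d))
  | .rowM => inferInstanceAs (Fintype (Fin D.m₁))
  | .rowN => inferInstanceAs (Fintype (Fin D.m₂))
  | .sum s t =>
    haveI := Space.fintypeIdx D s
    haveI := Space.fintypeIdx D t
    inferInstanceAs (Fintype (s.Idx D ⊕ t.Idx D))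

instance Space.decidableEqIdx (D : Dims) : (s : Space) → DecidableEq (s.Idx D)
  | .scalar => inferInstanceAs (DecidableEq Unit)
  | .var => inferInstanceAs (DecidableEq (Fin D.n))
  | .con => inferInstanceAs (DecidableEq (Fin D.d))
  | .rowM => inferInstanceAs (DecidableEq (Fin D.m₁))
  | .rowN => inferInstanceAs (DecidableEq (Fin D.m₂))
  | .sum s t =>
    haveI := Space.decidableEqIdx D s
    haveI := Space.decidableEqIdx D t
    inferInstanceAs (DecidableEq (s.Idx D ⊕ t.Idx D))

/-- The contents of all registers: `σ s i` is the `i`-th register for vectors in the space `s`. -/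
def State (D : Dims) : Type := (s : Space) → ℕ → s.Idx D → ℝ

/-- The content of the `i`-th scalar register. -/
def State.scal {D : Dims} (σ : State D) (i : ℕ) : ℝ := σ .scalar i ()

/-- Overwrite the `i`-th register of the space `s` by `v`. -/
def State.set {D : Dims} (σ : State D) (s : Space) (i : ℕ) (v : s.Idx D → ℝ) : State D :=
  Function.update σ s (Function.update (σ s) i v)

/-- Expressions for matrices with rows indexed by the first space and columns by the second. -/
inductive MatExpr : Space → Space → Type where
  | A : MatExpr .con .var
  | M : MatExpr .rowM .var
  | N : MatExpr .rowN .var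
  | zero (s t : Space) : MatExpr s t
  /-- the diagonal matrix of the `i`-th register of the space `s` -/
  | diag (s : Space) (i : ℕ) : MatExpr s s
  /-- the `i`-th register of the space `s` as a matrix with one column -/
  | col (s : Space) (i : ℕ) : MatExpr s .scalar
  /-- the multiple by the `i`-th scalar register -/
  | smul {s t : Space} (i : ℕ) (K : MatExpr s t) : MatExpr s t
  | plus {s t : Space} (K L : MatExpr s t) : MatExpr s t
  | mul {s t u : Space} (K : MatExpr s t) (L : MatExpr t u) : MatExpr s u
  | transpose {s t : Space} (K : MatExpr s t) : MatExpr t s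
  | blocks {s s' t t' : Space} (K₁₁ : MatExpr s t) (K₁₂ : MatExpr s t')
      (K₂₁ : MatExpr s' t) (K₂₂ : MatExpr s' t') : MatExpr (.sum s s') (.sum t t')

/-- The matrix that an expression denotes. -/
def MatExpr.eval {D : Dims} (Q : Problem D) (σ : State D) :
    {s t : Space} → MatExpr s t → Matrix (s.Idx D) (t.Idx D) ℝ
  | _, _, .A => Q.A
  | _, _, .M => Q.M
  | _, _, .N => Q.N
  | _, _, .zero _ _ => 0
  | _, _, .diag s i => Matrix.diagonal (σ s i)
  | _, _, .col s i => Matrix.of fun k _ => σ s i k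
  | _, _, .smul i K => σ.scal i • K.eval Q σ
  | _, _, .plus K L => K.eval Q σ + L.eval Q σ
  | _, _, .mul K L => K.eval Q σ * L.eval Q σ
  | _, _, .transpose K => (K.eval Q σ)ᵀ
  | _, _, .blocks K₁₁ K₁₂ K₂₁ K₂₂ =>
    Matrix.fromBlocks (K₁₁.eval Q σ) (K₁₂.eval Q σ) (K₂₁.eval Q σ) (K₂₂.eval Q σ)

/-- A linear system solver: whenever the square system `K z = r` has a solution, it returns one.
On inconsistent systems its answer is arbitrary. -/
structure LinearSystemSolver where
  solve : {ι : Type} → [Fintype ι] → Matrix ι ι ℝ → (ι → ℝ) → (ι → ℝ)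
  solve_spec : ∀ {ι : Type} [Fintype ι] (K : Matrix ι ι ℝ) (r : ι → ℝ),
    (∃ z, K *ᵥ z = r) → K *ᵥ solve K r = r

/-- The coordinatewise operations. -/
inductive Op where
  | plus
  | minus
  | times
  | divide
  /-- `|x| ^ y` -/
  | abspow
  | max
  /-- `1` if `x ≤ y`, and `0` otherwise -/
  | le

open Classical in
/-- The operation on real numbers that an operation symbol denotes. -/
noncomputable def Op.eval : Op → ℝ → ℝ → ℝ
  | .plus, x, y => x + y
  | .minus, x, y => x - y
  | .times, x, y => x * y
  | .divide, x, y => x / y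
  | .abspow, x, y => |x| ^ y
  | .max, x, y => Max.max x y
  | .le, x, y => if x ≤ y then 1 else 0

/-- The instructions; the first register number is always that of the result. -/
inductive Instr where
  /-- a rational constant in a scalar register -/
  | const (i : ℕ) (q : ℚ)
  /-- the vector all of whose coordinates are the scalar register `j` -/
  | fill (s : Space) (i j : ℕ)
  | op (o : Op) (s : Space) (i j k : ℕ)
  /-- the inner product, in a scalar register -/
  | inner (s : Space) (i j k : ℕ)
  | pair (s t : Space) (i j k : ℕ)
  | fst (s t : Space) (i j : ℕ)
  | snd (s t : Space) (i j : ℕ)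
  /-- the matrix-vector product -/
  | apply {s t : Space} (K : MatExpr s t) (i j : ℕ)
  /-- a call to the linear system solver with the matrix `K` and the right-hand side in
  register `j` -/
  | solve {s : Space} (K : MatExpr s s) (i j : ℕ)

/-- The effect of an instruction on the registers. -/
noncomputable def Instr.run {D : Dims} (S : LinearSystemSolver) (Q : Problem D) (σ : State D) :
    Instr → State D
  | .const i q => σ.set .scalar i fun _ => (q : ℝ)
  | .fill s i j => σ.set s i fun _ => σ.scal j
  | .op o s i j k => σ.set s i fun e => o.eval (σ s j e) (σ s k e)
  | .inner s i j k => σ.set .scalar i fun _ => σ s j ⬝ᵥ σ s k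
  | .pair s t i j k => σ.set (.sum s t) i (Sum.elim (σ s j) (σ t k))
  | .fst s t i j => σ.set s i fun e => σ (.sum s t) j (Sum.inl e)
  | .snd s t i j => σ.set t i fun e => σ (.sum s t) j (Sum.inr e)
  | .apply (s := s) (t := t) K i j => σ.set s i (K.eval Q σ *ᵥ σ t j)
  | .solve (s := s) K i j => σ.set s i (S.solve (K.eval Q σ) (σ s j))

/-- The number of calls to the linear system solver in one instruction. -/
def Instr.calls : Instr → ℕ
  | .solve _ _ _ => 1
  | _ => 0

/-- Programs. The tests compare the scalar registers `i` and `j`: `σ i < σ j`. -/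
inductive Program where
  | skip
  | instr (I : Instr)
  | seq (P P' : Program)
  | ite (i j : ℕ) (P P' : Program)
  | while (i j : ℕ) (P : Program)

/-- `Exec S Q P σ τ c k`: the program `P`, started in the state `σ` on the data `Q` with the
linear system solver `S`, halts in the state `τ` after `c` calls to the solver and `k` executed
steps (instructions and tests, including the calls). -/
inductive Exec {D : Dims} (S : LinearSystemSolver) (Q : Problem D) :
    Program → State D → State D → ℕ → ℕ → Prop where
  | skip (σ : State D) : Exec S Q .skip σ σ 0 0
  | instr (I : Instr) (σ : State D) : Exec S Q (.instr I) σ (I.run S Q σ) I.calls 1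
  | seq {P P' : Program} {σ τ υ : State D} {c c' k k' : ℕ} :
      Exec S Q P σ τ c k → Exec S Q P' τ υ c' k' →
      Exec S Q (.seq P P') σ υ (c + c') (k + k')
  | ite_true {i j : ℕ} {P P' : Program} {σ τ : State D} {c k : ℕ} :
      σ.scal i < σ.scal j → Exec S Q P σ τ c k → Exec S Q (.ite i j P P') σ τ c (k + 1)
  | ite_false {i j : ℕ} {P P' : Program} {σ τ : State D} {c k : ℕ} :
      ¬ σ.scal i < σ.scal j → Exec S Q P' σ τ c k → Exec S Q (.ite i j P P') σ τ c (k + 1)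
  | while_true {i j : ℕ} {P : Program} {σ τ υ : State D} {c c' k k' : ℕ} :
      σ.scal i < σ.scal j → Exec S Q P σ τ c k → Exec S Q (.while i j P) τ υ c' k' →
      Exec S Q (.while i j P) σ υ (c + c') (k + k' + 1)
  | while_false {i j : ℕ} {P : Program} {σ : State D} :
      ¬ σ.scal i < σ.scal j → Exec S Q (.while i j P) σ σ 0 1

/-- The input registers: the scalars `p, ε, n, d, m₁, m₂`, the starting point and the linear term
in `ℝⁿ`, and the right-hand side of the constraints in `ℝᵈ`. All other registers are zero. -/
noncomputable def inputState {D : Dims} (Q : Problem D) (p ε : ℝ) (x₀ : Fin D.n → ℝ) : State D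
  | .scalar => fun i _ =>
    if i = 0 then p else if i = 1 then ε else if i = 2 then (D.n : ℝ)
    else if i = 3 then (D.d : ℝ) else if i = 4 then (D.m₁ : ℝ)
    else if i = 5 then (D.m₂ : ℝ) else 0
  | .var => fun i => if i = 0 then x₀ else if i = 1 then Q.c else fun _ => 0
  | .con => fun i => if i = 0 then Q.b else fun _ => 0
  | _ => fun _ _ => 0

/-- The output of a halted program: register `0` of `ℝⁿ`. -/
def State.output {D : Dims} (σ : State D) : Fin D.n → ℝ := σ .var 0

/-- On the input `Q, p, ε, x₀` and with the solver `S`, the program halts with output `x` after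
`calls` calls to the solver and `steps` executed steps. -/
def Program.Computes {D : Dims} (P : Program) (S : LinearSystemSolver) (Q : Problem D)
    (p ε : ℝ) (x₀ x : Fin D.n → ℝ) (calls steps : ℕ) : Prop :=
  ∃ τ : State D, Exec S Q P (inputState Q p ε x₀) τ calls steps ∧ τ.output = x

/-- `p · m^{(p-2)/(3p-2)} · (1 + log⁺ ((f(x₀) - f(x⋆)) / ε))`. -/
noncomputable def rate {D : Dims} (Q : Problem D) (p ε : ℝ) (x₀ xs : Fin D.n → ℝ) : ℝ :=
  p * (D.m : ℝ) ^ ((p - 2) / (3 * p - 2)) *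
    (1 + max 0 (Real.log ((Q.objective p x₀ - Q.objective p xs) / ε)))

end LpRegression

/-! The method is an accelerated proximal point scheme, organised in epochs. Write `m` for the
number of rows of `N` and `τ = m ^ ((p-2)/(3p-2))`. An epoch has a target decrease `δ` and consists
of about `5 T` iterations, `T = 2000 p τ`, each with at most two solver calls. It brings a gap of at
most `δ` down to at most `δ / 2`, and lowers the value by at least `δ / 2` if the gap is at least
`δ` (`Objective.EpochReach.progress`). Starting from `δ = ε`, the target is doubled until an epoch
fails to achieve its decrease and is then halved down to `ε`. This takes `O(1 + log⁺(gap / ε))`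
epochs (`reach_main`).

Inside an epoch the scale `ρ` is fixed by `ρ ^ p * τ = δ`, and the proximal term has the weight `lam
p ρ`, which dominates the curvature of `|t| ^ p` for `|t|` up to about `ρ`. At larger `|t|` the
curvature is stable under small relative changes. So on moves of length `ρ / (100 p)` the proximal
objective is nearly quadratic. A Newton direction with energy above `ρ ^ p`, shortened to energy `ρ
^ p`, lowers the proximal objective by at least `ρ ^ p / 4`. If the energy is smaller, the full step
gives a point `z` whose gradient error is small enough for acceleration (`prox_newton_le`,
`residual_le`).

The proximal center is the extrapolation `y = x + θ (v - x)`. The next `v` minimizes a model of the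
objective at `z` that contains the curvature `curv`, plus a multiple of `‖N (w - v)‖²` with the
constant weight `2 lam / T²`. `accelerated_step` bounds the change of a potential made of the gap,
the distance of `v` from a comparison point `u`, and `curv` between `x` and `v`. The parameter `θ`
needs no search: up to a smooth maximum it is the largest number `≤ 1 / T` for which no coordinate
of `N x` leaves the region of comparable curvature. If `θ = 1 / T`, the potential falls by at least
`θ δ / 2 = δ / (2 T)`. If `θ < 1 / T`, some coordinate is at its limit, and then the step has a gain
of at least `ρ ^ p / (32 p)`, again more than a fixed multiple of `δ / (2 T)` (`gain_tight`). The
Newton steps before an accelerated step are paid by the gain of that step as well, since their total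
decrease is at most `49 p` times the gain (`newton_accept`). The potential starts below `2 δ`, so as
long as the gap stays above `δ / 2` all iterations up to the last accelerated step number at most `3
T`, and the remaining Newton steps are few (`newton_count_le`).

The power of `m` is dictated by the initial distance. Clarkson's inequality bounds `‖N (x₀ - xs)‖_p
^ p` by `2 ^ p` times the gap, and passing to the 2-norm costs `m ^ (1 - 2/p)`. The distance term
must start below `δ`, which requires `m ^ (1 - 2/p) ≲ τ ^ (3 - 2/p)` (`weight_mul_le`).

Both kinds of steps are weighted least squares problems along `ker A`. Their optimality systems are
symmetric and consistent by the orthogonality of `c`, and every solution of them serves, so an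
arbitrary solver can be used. -/

namespace LpRegression

/-! ### Scalar inequalities for `|t| ^ p` -/

/-- The derivative of `|t| ^ p`. -/
noncomputable def dpow (p t : ℝ) : ℝ := p * |t| ^ (p - 2) * t

/-- The second derivative of `|t| ^ p`. -/
noncomputable def ddpow (p t : ℝ) : ℝ := p * (p - 1) * |t| ^ (p - 2)

/-- The Bregman divergence of `|t| ^ p`. -/
noncomputable def breg (p w z : ℝ) : ℝ := |w| ^ p - |z| ^ p - dpow p z * (w - z)

/-- Bernoulli's inequality for `a / b`, multiplied by `b ^ q`. -/
theorem rpow_tangent {q a b : ℝ} (hq : 1 ≤ q) (ha : 0 ≤ a) (hb : 0 ≤ b) :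
    b ^ q + q * b ^ (q - 1) * (a - b) ≤ a ^ q := by
  rcases hb.eq_or_lt with rfl | hb
  · rcases hq.eq_or_lt with rfl | hq
    · simp
    · rw [Real.zero_rpow (by linarith), Real.zero_rpow (by linarith)]
      simpa using Real.rpow_nonneg ha q
  · have h := one_add_mul_self_le_rpow_one_add (s := (a - b) / b)
      (by rw [le_div_iff₀ hb]; linarith) hq
    have h1 : 1 + (a - b) / b = a / b := by field_simp; ring
    rw [h1, Real.div_rpow ha hb.le, le_div_iff₀ (Real.rpow_pos_of_pos hb q)] at h
    have h2 : b ^ q = b ^ (q - 1) * b := by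
      rw [← Real.rpow_add_one hb.ne']; ring_nf
    calc b ^ q + q * b ^ (q - 1) * (a - b)
        = (1 + q * ((a - b) / b)) * b ^ q := by rw [h2]; field_simp
      _ ≤ a ^ q := h

theorem abs_rpow_eq_sq_rpow (p t : ℝ) : |t| ^ p = (t ^ 2) ^ (p / 2) := by
  rw [← sq_abs t, ← Real.rpow_natCast |t| 2, ← Real.rpow_mul (abs_nonneg t)]
  congr 1
  push_cast
  ring

/-- Regard `|t| ^ p` as `(t²) ^ (p/2)`: the tangent inequality in the variable `t²` leaves exactly
`w² - z² - 2 z (w - z) = (w - z)²`. -/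
theorem breg_lower {p : ℝ} (hp : 2 ≤ p) (w z : ℝ) :
    p / 2 * |z| ^ (p - 2) * (w - z) ^ 2 ≤ breg p w z := by
  have h := rpow_tangent (q := p / 2) (by linarith) (sq_nonneg w) (sq_nonneg z)
  have h2 : (z ^ 2) ^ (p / 2 - 1) = |z| ^ (p - 2) := by
    rw [abs_rpow_eq_sq_rpow]; congr 1; ring
  rw [← abs_rpow_eq_sq_rpow, ← abs_rpow_eq_sq_rpow, h2] at h
  unfold breg dpow
  nlinarith [h]

theorem breg_nonneg {p : ℝ} (hp : 2 ≤ p) (w z : ℝ) : 0 ≤ breg p w z :=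
  le_trans (by have := Real.rpow_nonneg (abs_nonneg z) (p - 2); positivity) (breg_lower hp w z)

theorem breg_self (p z : ℝ) : breg p z z = 0 := by simp [breg]

theorem breg_add_breg (p w z : ℝ) :
    breg p w z + breg p z w = (dpow p w - dpow p z) * (w - z) := by
  unfold breg; ring

theorem dpow_neg (p t : ℝ) : dpow p (-t) = -dpow p t := by simp [dpow]

theorem ddpow_neg (p t : ℝ) : ddpow p (-t) = ddpow p t := by simp [ddpow]

theorem breg_neg (p w z : ℝ) : breg p (-w) (-z) = breg p w z := by
  simp only [breg, abs_neg, dpow_neg]; ring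

theorem ddpow_nonneg {p : ℝ} (hp : 2 ≤ p) (t : ℝ) : 0 ≤ ddpow p t := by
  have := Real.rpow_nonneg (abs_nonneg t) (p - 2)
  have : 0 ≤ p - 1 := by linarith
  unfold ddpow; positivity

theorem abs_dpow {p : ℝ} (hp : 2 ≤ p) (t : ℝ) : |dpow p t| = p * |t| ^ (p - 2) * |t| := by
  have := Real.rpow_nonneg (abs_nonneg t) (p - 2)
  rw [dpow, abs_mul, abs_of_nonneg (by positivity)]

theorem dpow_of_nonneg {p t : ℝ} (hp : 2 ≤ p) (ht : 0 ≤ t) : dpow p t = p * t ^ (p - 1) := by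
  rw [dpow, abs_of_nonneg ht, mul_assoc]
  congr 1
  rcases ht.eq_or_lt with rfl | ht
  · rw [Real.zero_rpow (x := p - 1) (by linarith)]; simp
  · rw [← Real.rpow_add_one ht.ne']; ring_nf

theorem dpow_sub_le {p a b : ℝ} (hp : 2 ≤ p) (hb : 0 ≤ b) (hab : b ≤ a) :
    dpow p a - dpow p b ≤ p ^ 2 * a ^ (p - 2) * (a - b) := by
  have h := rpow_tangent (q := p - 1) (by linarith) hb (hb.trans hab)
  rw [dpow_of_nonneg hp hb, dpow_of_nonneg hp (hb.trans hab)]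
  have e : p - 1 - 1 = p - 2 := by ring
  rw [e] at h
  have h3 : 0 ≤ a ^ (p - 2) * (a - b) :=
    mul_nonneg (Real.rpow_nonneg (hb.trans hab) _) (by linarith)
  nlinarith

theorem dpow_mono {p a b : ℝ} (hp : 2 ≤ p) (hab : b ≤ a) : dpow p b ≤ dpow p a := by
  rcases hab.eq_or_lt with rfl | h
  · exact le_rfl
  · have := breg_add_breg p a b
    have h1 := breg_nonneg hp a b
    have h2 := breg_nonneg hp b a
    by_contra hc
    push Not at hc
    nlinarith

theorem abs_dpow_sub_le {p M a b : ℝ} (hp : 2 ≤ p) (ha : |a| ≤ M) (hb : |b| ≤ M) :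
    |dpow p a - dpow p b| ≤ p ^ 2 * M ^ (p - 2) * |a - b| := by
  wlog hab : b ≤ a generalizing a b
  · rw [abs_sub_comm, abs_sub_comm a b]; exact this hb ha (by linarith)
  rw [abs_of_nonneg (sub_nonneg.2 (dpow_mono hp hab)), abs_of_nonneg (sub_nonneg.2 hab)]
  have key : ∀ {a b : ℝ}, |a| ≤ M → 0 ≤ b → b ≤ a →
      dpow p a - dpow p b ≤ p ^ 2 * M ^ (p - 2) * (a - b) := by
    intro a b ha hb hab
    refine (dpow_sub_le hp hb hab).trans ?_
    have h0 : 0 ≤ a := hb.trans hab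
    have : a ^ (p - 2) ≤ M ^ (p - 2) :=
      Real.rpow_le_rpow h0 (by rwa [abs_of_nonneg h0] at ha) (by linarith)
    have h3 : 0 ≤ a - b := by linarith
    gcongr
  rcases le_total 0 b with h0 | h0
  · exact key ha h0 hab
  rcases le_total a 0 with h1 | h1
  · have := key (a := -b) (b := -a) (by rwa [abs_neg]) (by linarith) (by linarith)
    rw [dpow_neg, dpow_neg] at this
    linarith
  · have hM : 0 ≤ M := (abs_nonneg a).trans ha
    have e1 := key (a := a) (b := 0) ha le_rfl h1
    have e2 := key (a := -b) (b := 0) (by rwa [abs_neg]) le_rfl (by linarith)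
    rw [dpow_neg] at e2
    have e0 : dpow p 0 = 0 := by simp [dpow]
    rw [e0] at e1 e2
    linarith

/-- The two divergences of a pair add up to the product of the difference of derivatives with `w -
z`. Dropping the other one, which is nonnegative, avoids integration and costs only a factor of two.
-/
theorem breg_le {p M w z : ℝ} (hp : 2 ≤ p) (hw : |w| ≤ M) (hz : |z| ≤ M) :
    breg p w z ≤ p ^ 2 * M ^ (p - 2) * (w - z) ^ 2 := by
  have h1 := breg_add_breg p w z
  have h2 := breg_nonneg hp z w
  have h3 := abs_dpow_sub_le hp hw hz
  have h4 : (dpow p w - dpow p z) * (w - z) ≤ |dpow p w - dpow p z| * |w - z| := by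
    rw [← abs_mul]; exact le_abs_self _
  have h5 : |dpow p w - dpow p z| * |w - z| ≤ p ^ 2 * M ^ (p - 2) * |w - z| * |w - z| := by
    gcongr
  have h6 : |w - z| * |w - z| = (w - z) ^ 2 := by rw [← sq, sq_abs]
  rw [mul_assoc, h6] at h5
  linarith

/-- Co-coercivity of the derivative. The usual argument, a gradient step from `x` and nonnegativity
of the divergence there, is valid although the derivative is Lipschitz only on `[-M, M]`, because
the step does not overshoot `z`. -/
theorem dpow_sub_sq_le {p M x z : ℝ} (hp : 2 ≤ p) (hM : 0 < M) (hx : |x| ≤ M) (hz : |z| ≤ M) :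
    (dpow p x - dpow p z) ^ 2 ≤ 4 * (p ^ 2 * M ^ (p - 2)) * breg p x z := by
  set L := p ^ 2 * M ^ (p - 2) with hL
  have hLpos : 0 < L := by have := Real.rpow_pos_of_pos hM (p - 2); positivity
  set g := dpow p x - dpow p z with hg
  have hlip : |g| ≤ L * |x - z| := abs_dpow_sub_le hp hx hz
  -- The step length `1 / (2 L)` is optimal for the upper bound `L (w - x)²` of `breg_le`.
  set w := x - g / (2 * L) with hw
  have hwM : |w| ≤ M := by
    rw [abs_le] at hx hz ⊢
    rcases le_total z x with h | h
    · have hg0 : 0 ≤ g := sub_nonneg.2 (dpow_mono hp h)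
      rw [abs_of_nonneg hg0, abs_of_nonneg (by linarith)] at hlip
      have h1 : 0 ≤ g / (2 * L) := by positivity
      have h2 : g / (2 * L) ≤ x - z := by
        rw [div_le_iff₀ (by positivity)]; nlinarith
      constructor <;> linarith [hx.1, hx.2, hz.1, hz.2]
    · have hg0 : g ≤ 0 := sub_nonpos.2 (dpow_mono hp h)
      rw [abs_of_nonpos hg0, abs_of_nonpos (by linarith)] at hlip
      have h1 : g / (2 * L) ≤ 0 := div_nonpos_of_nonpos_of_nonneg hg0 (by positivity)
      have h2 : x - z ≤ g / (2 * L) := by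
        rw [le_div_iff₀ (by positivity)]; nlinarith
      constructor <;> linarith [hx.1, hx.2, hz.1, hz.2]
  have h1 := breg_nonneg hp w z
  have h2 : breg p w x ≤ L * (w - x) ^ 2 := breg_le hp hwM hx
  have h3 : w - x = -(g / (2 * L)) := by rw [hw]; ring
  have h4 : breg p x z = breg p w z - breg p w x - g * (w - x) := by
    simp only [breg, hg]; ring
  have h5 : g / (2 * L) * (2 * L) = g := div_mul_cancel₀ _ (by positivity)
  set k := g / (2 * L)
  rw [h3] at h2 h4
  have h6 : breg p x z ≥ g * k - L * k ^ 2 := by nlinarith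
  have h7 : g * k - L * k ^ 2 = L * k ^ 2 := by rw [← h5]; ring
  calc g ^ 2 = 4 * L * (L * k ^ 2) := by rw [← h5]; ring
    _ ≤ 4 * L * breg p x z := by gcongr; linarith

/-- The mean of `(a + b)²` and `(a - b)²` is `a² + b²`, so convexity of `s ^ (p/2)` bounds the right
side below by `2 (a² + b²) ^ (p/2)`. Superadditivity of this power does the rest. -/
theorem clarkson {p : ℝ} (hp : 2 ≤ p) (a b : ℝ) :
    2 * (|a| ^ p + |b| ^ p) ≤ |a + b| ^ p + |a - b| ^ p := by
  have hq : 1 ≤ p / 2 := by linarith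
  simp only [abs_rpow_eq_sq_rpow p]
  have h1 := rpow_tangent hq (sq_nonneg (a + b)) (b := a ^ 2 + b ^ 2) (by positivity)
  have h2 := rpow_tangent hq (sq_nonneg (a - b)) (b := a ^ 2 + b ^ 2) (by positivity)
  have h3 := Real.add_rpow_le_rpow_add (sq_nonneg a) (sq_nonneg b) hq
  nlinarith

theorem one_add_rpow_le_exp {a b : ℝ} (ha : -1 ≤ a) (hb : 0 ≤ b) :
    (1 + a) ^ b ≤ Real.exp (a * b) := by
  rw [Real.exp_mul]
  exact Real.rpow_le_rpow (by linarith) (by linarith [Real.add_one_le_exp a]) hb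

theorem exp_two_le : Real.exp 2 ≤ 8 := by
  have := Real.exp_one_lt_d9
  have h : Real.exp 2 = Real.exp 1 * Real.exp 1 := by rw [← Real.exp_add]; norm_num
  rw [h]; nlinarith [Real.exp_pos 1]

/-- This is why all relative enlargements are of order `1 / p`: they change the curvature by at most
the factor `e² ≤ 8`. -/
theorem rpow_growth {p ρ c : ℝ} (hp : 2 ≤ p) (hρ : 0 ≤ ρ) (hc : 0 ≤ c) (hc2 : c ≤ 2) :
    ((1 + c / p) * ρ) ^ (p - 2) ≤ 8 * ρ ^ (p - 2) := by
  have hp0 : 0 < p := by linarith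
  have h0 : 0 ≤ c / p := by positivity
  rw [Real.mul_rpow (by linarith) hρ]
  gcongr
  refine (one_add_rpow_le_exp (by linarith) (by linarith)).trans (le_trans ?_ exp_two_le)
  rw [Real.exp_le_exp, div_mul_eq_mul_div, div_le_iff₀ hp0]
  nlinarith

/-- The counterpart for reductions: the inverse of the base is `1 + 5 / (4p - 5)`, and `e ^ (5/4) ≤
4`. -/
theorem rpow_shrink {p : ℝ} (hp : 2 ≤ p) : 1 / 4 ≤ (1 - 5 / (4 * p)) ^ (p - 2) := by
  have h1 : 0 < 4 * p - 5 := by linarith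
  have hp0 : 0 < p := by linarith
  have e : 1 - 5 / (4 * p) = (1 + 5 / (4 * p - 5))⁻¹ := by
    have h2 : 4 * p - 5 + 5 ≠ 0 := by linarith
    field_simp
    ring
  rw [e, Real.inv_rpow (by positivity), one_div]
  apply inv_anti₀ (Real.rpow_pos_of_pos (by positivity) _)
  refine (one_add_rpow_le_exp (by have : 0 < 5 / (4 * p - 5) := by positivity
                                  linarith) (by linarith)).trans ?_
  have h3 : 5 / (4 * p - 5) * (p - 2) ≤ 5 / 4 := by
    rw [div_mul_eq_mul_div, div_le_iff₀ h1]; linarith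
  refine (Real.exp_le_exp.2 h3).trans ?_
  have h4 : Real.exp (5 / 4) ^ 4 ≤ 4 ^ 4 := by
    rw [← Real.exp_nat_mul]
    have : Real.exp ((4 : ℕ) * (5 / 4)) = Real.exp 1 ^ 5 := by
      rw [← Real.exp_nat_mul]; norm_num
    rw [this]
    have h5 := Real.exp_one_lt_d9
    calc Real.exp 1 ^ 5 ≤ (2.75 : ℝ) ^ 5 := by
          apply pow_le_pow_left₀ (Real.exp_pos 1).le; linarith
      _ ≤ 4 ^ 4 := by norm_num
  exact le_of_pow_le_pow_left₀ (by norm_num) (by norm_num) h4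

end LpRegression

/-! ### Accuracy of second order expansions of `|t| ^ p` -/

namespace LpRegression

/-- For `|s| ≥ ρ` the move is relative: with `x = s t` and `|t| ≤ 1 / (100 p)`, the number `(1 + t)
^ (p-1)` lies between Bernoulli's bound and the quadratic bound for the exponential. The error is
quadratic in `x`, which `residual_le` needs. -/
theorem newton_error_large {p ρ s x : ℝ} (hp : 2 ≤ p) (hρ : 0 < ρ) (hs : ρ ≤ |s|)
    (hx : |x| ≤ ρ / (100 * p)) :
    |dpow p (s + x) - dpow p s - ddpow p s * x| ≤ p / ρ * (ddpow p s * x ^ 2) := by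
  wlog h0 : 0 ≤ s generalizing s x
  · have := this (s := -s) (x := -x) (by rwa [abs_neg]) (by rwa [abs_neg]) (by linarith)
    rw [← neg_add, dpow_neg, dpow_neg, ddpow_neg, neg_sq, ← abs_neg] at this
    convert this using 2; ring
  rw [abs_of_nonneg h0] at hs
  have hs0 : 0 < s := hρ.trans_le hs
  have hp0 : 0 < p := by linarith
  obtain ⟨t, rfl⟩ : ∃ t, x = s * t := ⟨x / s, by field_simp⟩
  rw [abs_mul, abs_of_pos hs0] at hx
  have ht : |t| ≤ 1 / (100 * p) := by
    rw [le_div_iff₀ (by positivity)] at hx ⊢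
    by_contra hc
    push Not at hc
    nlinarith
  have hq : 1 ≤ p - 1 := by linarith
  have htp : |(p - 1) * t| ≤ 1 := by
    rw [abs_mul, abs_of_nonneg (by linarith)]
    rw [le_div_iff₀ (by positivity)] at ht
    nlinarith [abs_nonneg t]
  have ht1 : -1 ≤ t := by
    have : |t| ≤ 1 := ht.trans (by rw [div_le_one (by positivity)]; linarith)
    linarith [(abs_le.1 this).1]
  have lo := one_add_mul_self_le_rpow_one_add ht1 hq
  have up : (1 + t) ^ (p - 1) ≤ 1 + (p - 1) * t + ((p - 1) * t) ^ 2 := by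
    have h1 := one_add_rpow_le_exp ht1 (b := p - 1) (by linarith)
    have h2 := (abs_le.1 (Real.abs_exp_sub_one_sub_id_le htp)).2
    rw [mul_comm] at h1
    linarith
  have e1 : s + s * t = s * (1 + t) := by ring
  have e2 : s ^ (p - 1) = s ^ (p - 2) * s := by
    rw [← Real.rpow_add_one hs0.ne']; ring_nf
  have hS := Real.rpow_pos_of_pos hs0 (p - 2)
  rw [e1, dpow_of_nonneg hp (mul_nonneg h0 (by linarith)), dpow_of_nonneg hp h0,
    Real.mul_rpow h0 (by linarith), ddpow, abs_of_pos hs0, e2]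
  set S := s ^ (p - 2)
  set X := (1 + t) ^ (p - 1)
  have e3 : p * (S * s * X) - p * (S * s) - p * (p - 1) * S * (s * t)
      = p * S * s * (X - (1 + (p - 1) * t)) := by ring
  rw [e3, abs_of_nonneg (mul_nonneg (by positivity) (by linarith))]
  have e4 : p / ρ * (p * (p - 1) * S * (s * t) ^ 2)
      = p * S * s * ((s / ρ) * (p * (p - 1) * t ^ 2)) := by field_simp
  rw [e4]
  have h5 : 1 ≤ s / ρ := by rwa [one_le_div hρ]
  have h6 : 0 ≤ p * (p - 1) * t ^ 2 := by have : 0 ≤ p - 1 := by linarith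
                                          positivity
  gcongr
  nlinarith [mul_nonneg (by linarith : 0 ≤ p - 1) (sq_nonneg t)]

/-- For `|s| ≤ ρ` no cancellation is used: the increment of the derivative and its linearization are
both small compared with `lam p ρ * |x|`. -/
theorem newton_error_small {p ρ s x : ℝ} (hp : 2 ≤ p) (hρ : 0 < ρ) (hs : |s| ≤ ρ)
    (hx : |x| ≤ ρ / (100 * p)) :
    |dpow p (s + x) - dpow p s - ddpow p s * x| ≤ 9 * (p ^ 2 * ρ ^ (p - 2)) * |x| := by
  have hp0 : 0 < p := by linarith
  have hM : |s + x| ≤ (1 + 1 / p) * ρ := by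
    refine (abs_add_le s x).trans ?_
    have : ρ / (100 * p) ≤ ρ / p := by
      apply div_le_div_of_nonneg_left hρ.le hp0; linarith
    have e : (1 + 1 / p) * ρ = ρ + ρ / p := by ring
    linarith
  have hM2 : |s| ≤ (1 + 1 / p) * ρ := by
    have : 0 ≤ 1 / p * ρ := by positivity
    linarith
  have h1 := abs_dpow_sub_le hp hM hM2
  have h2 := rpow_growth hp hρ.le (c := 1) (by norm_num) (by norm_num)
  have h3 : ddpow p s ≤ p ^ 2 * ρ ^ (p - 2) := by
    unfold ddpow
    have : |s| ^ (p - 2) ≤ ρ ^ (p - 2) := Real.rpow_le_rpow (abs_nonneg _) hs (by linarith)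
    have h4 := Real.rpow_nonneg (abs_nonneg s) (p - 2)
    nlinarith
  have h4 : |ddpow p s * x| ≤ p ^ 2 * ρ ^ (p - 2) * |x| := by
    rw [abs_mul, abs_of_nonneg (ddpow_nonneg hp s)]; gcongr
  rw [add_sub_cancel_left] at h1
  have h5 : p ^ 2 * ((1 + 1 / p) * ρ) ^ (p - 2) * |x| ≤ p ^ 2 * (8 * ρ ^ (p - 2)) * |x| := by
    gcongr
  have h6 := abs_sub (dpow p (s + x) - dpow p s) (ddpow p s * x)
  nlinarith

/-- The regularization parameter that dominates the curvature of `|t| ^ p` on `[-ρ, ρ]`. -/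
noncomputable def lam (p ρ : ℝ) : ℝ := 10000 * (p ^ 2 * ρ ^ (p - 2))

theorem lam_pos {p ρ : ℝ} (hp : 2 ≤ p) (hρ : 0 < ρ) : 0 < lam p ρ := by
  have := Real.rpow_pos_of_pos hρ (p - 2)
  unfold lam; positivity

theorem lam_mul_sq {p ρ : ℝ} (hρ : 0 < ρ) :
    lam p ρ * ρ ^ 2 = 10000 * p ^ 2 * ρ ^ p := by
  have : ρ ^ p = ρ ^ (p - 2) * ρ ^ 2 := by
    rw [← Real.rpow_natCast ρ 2, ← Real.rpow_add hρ]; norm_num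
  rw [this, lam]; ring

/-- Adding `lam p ρ` to the second derivative makes the relative error at most one percent in both
regimes. -/
theorem newton_error {p ρ s x : ℝ} (hp : 2 ≤ p) (hρ : 0 < ρ) (hx : |x| ≤ ρ / (100 * p)) :
    |dpow p (s + x) - dpow p s - ddpow p s * x| ≤ 1 / 100 * ((ddpow p s + lam p ρ) * |x|) := by
  have hp0 : 0 < p := by linarith
  have hdd := ddpow_nonneg hp s
  have hl := lam_pos hp hρ
  rcases le_total ρ |s| with hs | hs
  · refine (newton_error_large hp hρ hs hx).trans ?_
    have h1 : p / ρ * |x| ≤ 1 / 100 := by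
      calc p / ρ * |x| ≤ p / ρ * (ρ / (100 * p)) := by gcongr
        _ = 1 / 100 := by field_simp
    have h2 : p / ρ * (ddpow p s * x ^ 2) = (p / ρ * |x|) * (ddpow p s * |x|) := by
      rw [← sq_abs]; ring
    rw [h2]
    gcongr
    linarith
  · refine (newton_error_small hp hρ hs hx).trans ?_
    have h3 := Real.rpow_pos_of_pos hρ (p - 2)
    have h4 : 9 * (p ^ 2 * ρ ^ (p - 2)) = 9 / 10000 * lam p ρ := by unfold lam; ring
    rw [h4]
    have : 0 ≤ ddpow p s * |x| := by positivity
    have : 0 ≤ lam p ρ * |x| := by positivity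
    nlinarith

/-- The mean value inequality on the segment from `0` to `x`, with the derivative bounded by
`newton_error`. -/
theorem breg_newton {p ρ s x : ℝ} (hp : 2 ≤ p) (hρ : 0 < ρ) (hx : |x| ≤ ρ / (100 * p)) :
    |breg p (s + x) s - 1 / 2 * (ddpow p s * x ^ 2)|
      ≤ 1 / 100 * ((ddpow p s + lam p ρ) * x ^ 2) := by
  set ψ : ℝ → ℝ := fun y => |s + y| ^ p - dpow p s * y - 1 / 2 * (ddpow p s * y ^ 2) with hψ
  have hd : ∀ y, HasDerivAt ψ (dpow p (s + y) - dpow p s - ddpow p s * y) y := by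
    intro y
    have h1 : HasDerivAt (fun y => |s + y| ^ p) (p * |s + y| ^ (p - 2) * (s + y)) y :=
      (hasDerivAt_abs_rpow (s + y) (p := p) (by linarith)).comp_const_add s y
    have h2 : HasDerivAt (fun y => dpow p s * y) (dpow p s * 1) y :=
      (hasDerivAt_id y).const_mul (dpow p s)
    have h3 : HasDerivAt (fun y => 1 / 2 * (ddpow p s * y ^ 2))
        (1 / 2 * (ddpow p s * ((2 : ℕ) * y ^ (2 - 1)))) y :=
      ((hasDerivAt_pow 2 y).const_mul (ddpow p s)).const_mul (1 / 2)
    refine ((h1.sub h2).sub h3).congr_deriv ?_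
    simp only [dpow]
    norm_num
    ring
  have hb := Convex.norm_image_sub_le_of_norm_hasDerivWithin_le (f := ψ) (s := Set.uIcc 0 x)
    (C := 1 / 100 * ((ddpow p s + lam p ρ) * |x|)) (fun y _ => (hd y).hasDerivWithinAt)
    (fun y hy => by
      have hyx : |y| ≤ |x| := by
        have := Set.abs_sub_left_of_mem_uIcc hy
        simpa using this
      rw [Real.norm_eq_abs]
      refine (newton_error hp hρ (hyx.trans hx)).trans ?_
      have := ddpow_nonneg hp s
      have := lam_pos hp hρ
      gcongr)
    (convex_uIcc 0 x) Set.left_mem_uIcc Set.right_mem_uIcc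
  have e1 : ψ x - ψ 0 = breg p (s + x) s - 1 / 2 * (ddpow p s * x ^ 2) := by
    simp only [hψ, breg]; ring_nf
  rw [e1, Real.norm_eq_abs, Real.norm_eq_abs, sub_zero] at hb
  refine hb.trans (le_of_eq ?_)
  rw [← sq_abs x]; ring

end LpRegression

/-! ### Coordinatewise effect of the extrapolation -/

namespace LpRegression

/-- The move from `x` to `y` does not leave the region where the curvature of `|t| ^ p` is
comparable to that at `x` or is dominated by `lam p ρ`. -/
def StableMove (p ρ x y : ℝ) : Prop :=
  (ρ < |x| ∧ |y - x| ≤ |x| / p) ∨ (|x| ≤ ρ ∧ |y| ≤ (1 + 1 / p) * ρ)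

/-- The move from `x` to `y` is nearly as large as a stable move can be. -/
def TightMove (p ρ x y : ℝ) : Prop :=
  (ρ < |x| ∧ |y - x| ≤ |x| / p ∧ 3 / 4 * (|x| / p) ≤ |y - x|) ∨
    (|x| ≤ ρ ∧ ρ ≤ |y| ∧ 3 / 4 * (ρ / p) ≤ |y - x|)

/-- If `z` is far outside of `[-r, r]`, then the divergence from a point `x` inside is linear. -/
theorem breg_lower_far {p r z x : ℝ} (hp : 2 ≤ p) (hr : 0 < r) (hz : (1 + 2 / p) * r ≤ |z|)
    (hx : |x| ≤ r) : 1 / 4 * (|dpow p z| * (r / p)) ≤ breg p x z := by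
  wlog h0 : 0 ≤ z generalizing z x
  · have := this (z := -z) (x := -x) (by rwa [abs_neg]) (by rwa [abs_neg]) (by linarith)
    rwa [dpow_neg, abs_neg, breg_neg] at this
  have hp0 : 0 < p := by linarith
  rw [abs_of_nonneg h0] at hz
  have hdz : 0 ≤ dpow p z := by rw [dpow_of_nonneg hp h0]; have := Real.rpow_nonneg h0 (p - 1)
                                positivity
  rw [abs_of_nonneg hdz]
  -- A point halfway between `r` and the bound on `z`: the derivative at `t₀` is at most `3/4` of
  -- that at `z`, and `x` is at least `r / p` away from `t₀`.
  set t₀ := (1 + 1 / p) * r with ht₀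
  have ht₀0 : 0 ≤ t₀ := by positivity
  have hx' := abs_le.1 hx
  have hgap : r / p ≤ t₀ - x := by
    have : t₀ = r + r / p := by rw [ht₀]; ring
    linarith
  -- monotonicity of the derivative
  have h1 := breg_nonneg hp x t₀
  have h2 := breg_nonneg hp t₀ z
  have h3 : breg p x z = breg p x t₀ + breg p t₀ z + (dpow p z - dpow p t₀) * (t₀ - x) := by
    unfold breg; ring
  have h4 : dpow p t₀ ≤ 3 / 4 * dpow p z := by
    rw [dpow_of_nonneg hp h0, dpow_of_nonneg hp ht₀0]
    have h5 : t₀ ≤ ((p + 1) / (p + 2)) * z := by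
      have : t₀ = ((p + 1) / (p + 2)) * ((1 + 2 / p) * r) := by rw [ht₀]; field_simp
      rw [this]; gcongr
    have h6 : t₀ ^ (p - 1) ≤ ((p + 1) / (p + 2)) ^ (p - 1) * z ^ (p - 1) := by
      rw [← Real.mul_rpow (by positivity) h0]
      exact Real.rpow_le_rpow ht₀0 h5 (by linarith)
    have h7 : ((p + 1) / (p + 2)) ^ (p - 1) ≤ 3 / 4 := by
      have e : (p + 1) / (p + 2) = (1 + 1 / (p + 1))⁻¹ := by field_simp; ring
      rw [e, Real.inv_rpow (by positivity)]
      have := one_add_mul_self_le_rpow_one_add (s := 1 / (p + 1)) (p := p - 1)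
        (by have : 0 < 1 / (p + 1) := by positivity
            linarith) (by linarith)
      have h8 : 4 / 3 ≤ 1 + (p - 1) * (1 / (p + 1)) := by
        have : 1 / 3 ≤ (p - 1) * (1 / (p + 1)) := by
          rw [mul_one_div, le_div_iff₀ (by positivity)]; linarith
        linarith
      rw [show (3 / 4 : ℝ) = (4 / 3)⁻¹ by norm_num]
      exact inv_anti₀ (by norm_num) (h8.trans this)
    have h9 := Real.rpow_nonneg h0 (p - 1)
    have h10 : ((p + 1) / (p + 2)) ^ (p - 1) * z ^ (p - 1) ≤ 3 / 4 * z ^ (p - 1) := by gcongr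
    nlinarith
  have hrp : 0 < r / p := by positivity
  have h11 : 1 / 4 * dpow p z * (r / p) ≤ (dpow p z - dpow p t₀) * (t₀ - x) := by
    apply mul_le_mul _ hgap hrp.le <;> linarith
  linarith

/-- Extrapolating from `x` to `y` must not create a large divergence to the new point `z`. If `|x| >
ρ`, the three point identity leaves a cross term, absorbed by co-coercivity for `z` near and by the
linear growth of the divergence for `z` far away. If `|x| ≤ ρ` and `z` is near, the proximal weight
dominates. For `z` far away a factor `p` is lost, but then the divergence from `x` is at least `ρ ^
p / 4`, which compensates for this in `newton_accept`. -/
theorem breg_stable {p ρ x y z : ℝ} (hp : 2 ≤ p) (hρ : 0 < ρ) (h : StableMove p ρ x y) :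
    breg p y z ≤ lam p ρ * (y - z) ^ 2 + 9 * breg p x z
        + 16 * (p ^ 2 * |x| ^ (p - 2)) * (y - x) ^ 2 ∨
      (breg p y z ≤ 16 * p * breg p x z ∧ ρ ^ p / 4 ≤ breg p x z) := by
  have hp0 : 0 < p := by linarith
  have hDx := breg_nonneg hp x z
  have hl := lam_pos hp hρ
  have hxp := Real.rpow_nonneg (abs_nonneg x) (p - 2)
  rcases h with ⟨hx, hyx⟩ | ⟨hx, hy⟩
  · left
    have hx0 : 0 < |x| := hρ.trans hx
    have hxM : |x| ≤ (1 + 2 / p) * |x| := by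
      have : 0 ≤ 2 / p * |x| := by positivity
      linarith
    have hyM : |y| ≤ (1 + 2 / p) * |x| := by
      have h1 : |y| ≤ |x| + |y - x| := by
        have := abs_add_le x (y - x)
        rwa [add_sub_cancel] at this
      have h2 : (1 + 2 / p) * |x| = |x| + 2 * (|x| / p) := by ring
      have h3 : 0 ≤ |x| / p := by positivity
      linarith
    have hg := rpow_growth hp (abs_nonneg x) (c := 2) (by norm_num) le_rfl
    have hL : p ^ 2 * ((1 + 2 / p) * |x|) ^ (p - 2) ≤ 8 * (p ^ 2 * |x| ^ (p - 2)) := by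
      have : p ^ 2 * ((1 + 2 / p) * |x|) ^ (p - 2) ≤ p ^ 2 * (8 * |x| ^ (p - 2)) := by gcongr
      linarith
    have hD := breg_le hp hyM hxM
    have e : breg p y z = breg p x z + breg p y x + (dpow p x - dpow p z) * (y - x) := by
      unfold breg; ring
    have hlz : 0 ≤ lam p ρ * (y - z) ^ 2 := by positivity
    have hM0 : 0 < (1 + 2 / p) * |x| := by positivity
    rcases le_total |z| ((1 + 2 / p) * |x|) with hz | hz
    · have hc := dpow_sub_sq_le hp hM0 hxM hz
      have hM1 := Real.rpow_pos_of_pos hM0 (p - 2)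
      set L := p ^ 2 * ((1 + 2 / p) * |x|) ^ (p - 2) with hLdef
      have hL0 : 0 < L := by positivity
      set g := dpow p x - dpow p z
      have h5 : g * (y - x) ≤ breg p x z + L * (y - x) ^ 2 := by
        have h6 : 0 ≤ (g - 2 * L * (y - x)) ^ 2 := sq_nonneg _
        have h7 : 4 * L * (g * (y - x)) ≤ 4 * L * (breg p x z + L * (y - x) ^ 2) := by
          nlinarith
        exact le_of_mul_le_mul_left h7 (by positivity)
      have h8 : L * (y - x) ^ 2 ≤ 8 * (p ^ 2 * |x| ^ (p - 2)) * (y - x) ^ 2 := by gcongr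
      nlinarith
    · have hf := breg_lower_far hp hx0 hz le_rfl
      have h5 : |dpow p x| ≤ |dpow p z| := by
        rw [abs_dpow hp, abs_dpow hp]
        have : |x| ≤ |z| := hxM.trans hz
        have := Real.rpow_le_rpow (abs_nonneg x) this (by linarith : 0 ≤ p - 2)
        gcongr
      have h6 : (dpow p x - dpow p z) * (y - x) ≤ 2 * |dpow p z| * (|x| / p) := by
        refine (le_abs_self _).trans ?_
        rw [abs_mul]
        have := abs_sub (dpow p x) (dpow p z)
        gcongr
        linarith
      have h8 : p ^ 2 * ((1 + 2 / p) * |x|) ^ (p - 2) * (y - x) ^ 2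
          ≤ 8 * (p ^ 2 * |x| ^ (p - 2)) * (y - x) ^ 2 := by gcongr
      have h9 : 0 ≤ p ^ 2 * |x| ^ (p - 2) * (y - x) ^ 2 := by positivity
      nlinarith
  · have hρp : ρ ^ p = ρ ^ (p - 2) * ρ ^ 2 := by
      rw [← Real.rpow_natCast ρ 2, ← Real.rpow_add hρ]; norm_num
    rcases le_total |z| ((1 + 2 / p) * ρ) with hz | hz
    · left
      have hy' : |y| ≤ (1 + 2 / p) * ρ := hy.trans (by gcongr; norm_num)
      have hD := breg_le hp hy' hz
      have hg := rpow_growth hp hρ.le (c := 2) (by norm_num) le_rfl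
      have h1 : p ^ 2 * ((1 + 2 / p) * ρ) ^ (p - 2) * (y - z) ^ 2
          ≤ lam p ρ * (y - z) ^ 2 := by
        have h3 := Real.rpow_nonneg hρ.le (p - 2)
        have h4 : p ^ 2 * ((1 + 2 / p) * ρ) ^ (p - 2) ≤ p ^ 2 * (8 * ρ ^ (p - 2)) := by gcongr
        have h5 : p ^ 2 * (8 * ρ ^ (p - 2)) ≤ lam p ρ := by
          have : 0 ≤ p ^ 2 * ρ ^ (p - 2) := by positivity
          unfold lam; linarith
        gcongr
        exact h4.trans h5
      have h2 : 0 ≤ 16 * (p ^ 2 * |x| ^ (p - 2)) * (y - x) ^ 2 := by positivity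
      linarith
    · right
      have hf := breg_lower_far hp hρ hz hx
      have hρz : ρ ≤ |z| := by
        have : 0 ≤ 2 / p * ρ := by positivity
        linarith
      have hz0 : 0 < |z| := hρ.trans_le hρz
      have hzp := Real.rpow_pos_of_pos hz0 (p - 2)
      rw [abs_dpow hp] at hf
      set Z := |z| ^ (p - 2) with hZ
      have hf' : 1 / 4 * (Z * |z| * ρ) ≤ breg p x z := by
        have : 1 / 4 * (p * Z * |z| * (ρ / p)) = 1 / 4 * (Z * |z| * ρ) := by field_simp
        linarith
      have hZρ : ρ ^ (p - 2) ≤ Z := Real.rpow_le_rpow hρ.le hρz (by linarith)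
      constructor
      · have hyz : |y| ≤ |z| := hy.trans ((by gcongr; norm_num : _ ≤ (1 + 2 / p) * ρ).trans hz)
        have hpow : |y| ^ p ≤ |z| ^ p := Real.rpow_le_rpow (abs_nonneg y) hyz hp0.le
        have h1 : breg p y z ≤ p * Z * |z| * (2 * |z|) := by
          have h2 : -(dpow p z * (y - z)) ≤ |dpow p z| * |y - z| := by
            rw [← abs_mul]; exact neg_le_abs _
          rw [abs_dpow hp] at h2
          have h3 : |y - z| ≤ 2 * |z| := by have := abs_sub y z; linarith
          have h4 : p * Z * |z| * |y - z| ≤ p * Z * |z| * (2 * |z|) := by gcongr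
          unfold breg
          linarith
        refine h1.trans ?_
        -- Up to `2 ρ` the linear bound `hf'` suffices. Beyond it, `|x - z| ≥ |z| / 2` and the
        -- quadratic lower bound takes over.
        rcases le_total |z| (2 * ρ) with hz2 | hz2
        · have h5 : p * Z * |z| * (2 * |z|) ≤ p * Z * |z| * (2 * (2 * ρ)) := by gcongr
          nlinarith
        · have h6 := breg_lower hp x z
          have h7 : |z| / 2 ≤ |x - z| := by
            have := abs_sub_abs_le_abs_sub z x
            rw [abs_sub_comm] at this
            linarith
          have h8 : (|z| / 2) ^ 2 ≤ (x - z) ^ 2 := by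
            rw [← sq_abs (x - z)]; gcongr
          have h9 : p / 2 * Z * (|z| / 2) ^ 2 ≤ p / 2 * Z * (x - z) ^ 2 := by gcongr
          have h10 : p * Z * |z| * (2 * |z|) = 16 * (p / 2 * Z * (|z| / 2) ^ 2) := by ring
          rw [h10]
          nlinarith
      · rw [hρp]
        have h11 : ρ ^ (p - 2) * (ρ * ρ) ≤ Z * (|z| * ρ) := by gcongr
        nlinarith

/-- If the extrapolation is limited by a coordinate, every new point `z` makes progress there:
either `z` is far from `y` and the proximal term is large, or `z` is near `y`, hence far from `x`
and of size about `ρ`, so that the divergence from `x` is large. -/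
theorem breg_tight {p ρ x y z : ℝ} (hp : 2 ≤ p) (hρ : 0 < ρ) (h : TightMove p ρ x y) :
    ρ ^ p / (32 * p) ≤ lam p ρ * (y - z) ^ 2 + breg p x z := by
  have hp0 : 0 < p := by linarith
  have hl := lam_pos hp hρ
  have hb := breg_nonneg hp x z
  have hu := Real.rpow_pos_of_pos hρ p
  have hsq : 0 ≤ lam p ρ * (y - z) ^ 2 := by positivity
  -- In the near case `|x - z| ≥ (3/4 - 1/4) ρ / p` and `|z| ≥ (1 - 1/p - 1/(4p)) ρ`, so the bound
  -- is `p/2 * (ρ ^ (p-2) / 4) * (ρ / (2p))² = ρ ^ p / (32 p)`.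
  rcases le_total (ρ / (4 * p)) |y - z| with hfar | hnear
  · have h1 : (ρ / (4 * p)) ^ 2 ≤ (y - z) ^ 2 := by rw [← sq_abs (y - z)]; gcongr
    have h2 : lam p ρ * (ρ / (4 * p)) ^ 2 ≤ lam p ρ * (y - z) ^ 2 := by gcongr
    have h3 : lam p ρ * (ρ / (4 * p)) ^ 2 = 625 * ρ ^ p := by
      rw [div_pow, ← mul_div_assoc, lam_mul_sq hρ]; field_simp; ring
    have h4 : ρ ^ p / (32 * p) ≤ ρ ^ p := div_le_self hu.le (by linarith)
    linarith
  · have hzx : ρ / (2 * p) ≤ |x - z| := by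
      have h1 : 3 / 4 * (ρ / p) ≤ |y - x| := by
        rcases h with ⟨hx, -, h2⟩ | ⟨-, -, h2⟩
        · refine le_trans ?_ h2
          gcongr
        · exact h2
      have h2 : |y - x| ≤ |y - z| + |x - z| := by
        have := abs_sub_le y z x
        rwa [abs_sub_comm z x] at this
      have e1 : ρ / (4 * p) = 1 / 4 * (ρ / p) := by field_simp
      have e2 : ρ / (2 * p) = 1 / 2 * (ρ / p) := by field_simp
      linarith
    have hz : (1 - 5 / (4 * p)) * ρ ≤ |z| := by
      have h1 : |y| ≤ |y - z| + |z| := by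
        have := abs_add_le (y - z) z
        rwa [sub_add_cancel] at this
      have e1 : ρ / (4 * p) = 1 / 4 * (ρ / p) := by field_simp
      have e2 : (1 - 5 / (4 * p)) * ρ = ρ - 5 / 4 * (ρ / p) := by field_simp
      have h0 : 0 < ρ / p := by positivity
      rcases h with ⟨hx, h2, -⟩ | ⟨-, h2, -⟩
      · have h3 : |x| ≤ |y| + |y - x| := by
          have := abs_sub_le x y 0
          rw [sub_zero, sub_zero, abs_sub_comm x y] at this
          linarith
        have h4 : (1 - 1 / p) * ρ ≤ (1 - 1 / p) * |x| := by
          have : 1 / p ≤ 1 := by rw [div_le_one hp0]; linarith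
          have : 0 ≤ 1 - 1 / p := by linarith
          gcongr
        have e3 : (1 - 1 / p) * |x| = |x| - |x| / p := by ring
        have e4 : (1 - 1 / p) * ρ = ρ - ρ / p := by ring
        linarith
      · linarith
    have h1 := breg_lower hp x z
    have hc : 0 ≤ (1 - 5 / (4 * p)) := by
      have : 5 / (4 * p) ≤ 1 := by rw [div_le_one (by positivity)]; linarith
      linarith
    have h2 : 1 / 4 * ρ ^ (p - 2) ≤ |z| ^ (p - 2) := by
      calc 1 / 4 * ρ ^ (p - 2) ≤ (1 - 5 / (4 * p)) ^ (p - 2) * ρ ^ (p - 2) := by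
            have := Real.rpow_nonneg hρ.le (p - 2)
            have := rpow_shrink hp
            gcongr
        _ = ((1 - 5 / (4 * p)) * ρ) ^ (p - 2) := (Real.mul_rpow hc hρ.le).symm
        _ ≤ |z| ^ (p - 2) := Real.rpow_le_rpow (by positivity) hz (by linarith)
    have h3 : (ρ / (2 * p)) ^ 2 ≤ (x - z) ^ 2 := by rw [← sq_abs (x - z)]; gcongr
    have hρp : ρ ^ p = ρ ^ (p - 2) * ρ ^ 2 := by
      rw [← Real.rpow_natCast ρ 2, ← Real.rpow_add hρ]; norm_num
    have h5 := Real.rpow_pos_of_pos hρ (p - 2)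
    have h4 : p / 2 * (1 / 4 * ρ ^ (p - 2)) * (ρ / (2 * p)) ^ 2
        ≤ p / 2 * |z| ^ (p - 2) * (x - z) ^ 2 := by gcongr
    have e : p / 2 * (1 / 4 * ρ ^ (p - 2)) * (ρ / (2 * p)) ^ 2 = ρ ^ p / (32 * p) := by
      rw [hρp]; field_simp; ring
    linarith

end LpRegression

namespace LpRegression

/-! ### The objective as a function on an abstract vector space -/

/-- The data of `c x + ‖M x‖₂² + ‖N x‖_p^p` on a vector space. -/
structure Objective (E ι κ : Type*) [AddCommGroup E] [Module ℝ E] where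
  c : E →ₗ[ℝ] ℝ
  M : E →ₗ[ℝ] (ι → ℝ)
  N : E →ₗ[ℝ] (κ → ℝ)
  p : ℝ

namespace Objective

variable {E ι κ : Type*} [AddCommGroup E] [Module ℝ E] [Fintype ι] [Fintype κ]

noncomputable def val (F : Objective E ι κ) (x : E) : ℝ :=
  F.c x + ∑ i, F.M x i ^ 2 + ∑ i, |F.N x i| ^ F.p

/-- The derivative at `z` in the direction `ξ`. -/
noncomputable def grad (F : Objective E ι κ) (z ξ : E) : ℝ :=
  F.c ξ + ∑ i, 2 * F.M z i * F.M ξ i + ∑ i, dpow F.p (F.N z i) * F.N ξ i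

/-- The Bregman divergence. -/
noncomputable def div (F : Objective E ι κ) (w z : E) : ℝ :=
  ∑ i, F.M (w - z) i ^ 2 + ∑ i, breg F.p (F.N w i) (F.N z i)

/-- A quadratic form that bounds the divergence from `z` from below. -/
noncomputable def curv (F : Objective E ι κ) (z w : E) : ℝ :=
  ∑ i, 2 * F.M w i ^ 2 + ∑ i, F.p * |F.N z i| ^ (F.p - 2) * F.N w i ^ 2

/-- The bilinear form of `curv`. -/
noncomputable def curvB (F : Objective E ι κ) (z w ξ : E) : ℝ :=
  ∑ i, 2 * F.M w i * F.M ξ i + ∑ i, F.p * |F.N z i| ^ (F.p - 2) * F.N w i * F.N ξ i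

/-- The objective with a proximal term. -/
noncomputable def prox (F : Objective E ι κ) (l : ℝ) (Y : κ → ℝ) (w : E) : ℝ :=
  F.val w + l / 2 * ∑ i, (F.N w i - Y i) ^ 2

variable (F : Objective E ι κ)

/-- An identity by the definition of the divergence. All convexity of the objective is used through
it and lower bounds for `div`. -/
theorem val_eq (w z : E) : F.val w = F.val z + F.grad z (w - z) + F.div w z := by
  simp only [val, grad, div, breg, map_sub, Pi.sub_apply]
  have h1 : ∑ i, F.M w i ^ 2 = ∑ i, F.M z i ^ 2 + ∑ i, 2 * F.M z i * (F.M w i - F.M z i)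
      + ∑ i, (F.M w i - F.M z i) ^ 2 := by
    rw [← Finset.sum_add_distrib, ← Finset.sum_add_distrib]
    exact Finset.sum_congr rfl fun i _ => by ring
  rw [h1]
  simp only [Finset.sum_sub_distrib]
  ring

theorem curv_nonneg (hp : 2 ≤ F.p) (z w : E) : 0 ≤ F.curv z w := by
  unfold curv
  have h : ∀ i, 0 ≤ |F.N z i| ^ (F.p - 2) := fun i => Real.rpow_nonneg (abs_nonneg _) _
  have hp0 : 0 ≤ F.p := by linarith
  exact add_nonneg (Finset.sum_nonneg fun i _ => by positivity)
    (Finset.sum_nonneg fun i _ => by have := h i; positivity)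

theorem div_nonneg (hp : 2 ≤ F.p) (w z : E) : 0 ≤ F.div w z :=
  add_nonneg (Finset.sum_nonneg fun i _ => by positivity)
    (Finset.sum_nonneg fun i _ => breg_nonneg hp _ _)

/-- The factor `p` instead of `p (p - 1)` in `curv` makes this lower bound hold globally, without
any restriction on `w`. -/
theorem half_curv_le_div (hp : 2 ≤ F.p) (w z : E) : 1 / 2 * F.curv z (w - z) ≤ F.div w z := by
  unfold curv div
  rw [mul_add, Finset.mul_sum, Finset.mul_sum]
  refine add_le_add (Finset.sum_le_sum fun i _ => by linarith) (Finset.sum_le_sum fun i _ => ?_)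
  have := breg_lower hp (F.N w i) (F.N z i)
  rw [map_sub, Pi.sub_apply]
  linarith

theorem curv_add (z a b : E) : F.curv z (a + b) = F.curv z a + 2 * F.curvB z a b + F.curv z b := by
  simp only [curv, curvB, map_add, Pi.add_apply, mul_add, Finset.mul_sum]
  have h1 : ∑ i, 2 * (F.M a i + F.M b i) ^ 2 = ∑ i, 2 * F.M a i ^ 2
      + ∑ i, 2 * (2 * F.M a i * F.M b i) + ∑ i, 2 * F.M b i ^ 2 := by
    rw [← Finset.sum_add_distrib, ← Finset.sum_add_distrib]
    exact Finset.sum_congr rfl fun i _ => by ring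
  have h2 : ∑ i, F.p * |F.N z i| ^ (F.p - 2) * (F.N a i + F.N b i) ^ 2
      = ∑ i, F.p * |F.N z i| ^ (F.p - 2) * F.N a i ^ 2
      + ∑ i, 2 * (F.p * |F.N z i| ^ (F.p - 2) * F.N a i * F.N b i)
      + ∑ i, F.p * |F.N z i| ^ (F.p - 2) * F.N b i ^ 2 := by
    rw [← Finset.sum_add_distrib, ← Finset.sum_add_distrib]
    exact Finset.sum_congr rfl fun i _ => by ring
  rw [h1, h2]; ring

/-- One step of the accelerated proximal method. -/
theorem accelerated_step (hp : 2 ≤ F.p) {V : Submodule ℝ E} {x v u z v' : E} {G e Y : κ → ℝ}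
    {l θ β b : ℝ} (hl : 0 < l) (hθ0 : 0 ≤ θ)
    (hθβ : 2 * l * θ ^ 2 ≤ β)
    (hxz : x - z ∈ V) (huz : u - z ∈ V) (huv : u - v' ∈ V)
    (hY : ∀ i, Y i = F.N x i + θ * (F.N v i - F.N x i))
    (hG : ∀ i, G i = l * (F.N z i - Y i) - e i)
    (hgrad : ∀ ξ ∈ V, F.grad z ξ = -∑ i, G i * F.N ξ i)
    (hv' : ∀ ξ ∈ V, θ * F.curvB z (v' - z) ξ + β * ∑ i, F.N (v' - v) i * F.N ξ i
      = θ * ∑ i, G i * F.N ξ i)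
    (hu : F.val u ≤ b) :
    F.val z - b + β / 2 * ∑ i, F.N (v' - u) i ^ 2 + θ / 2 * F.curv z (v' - z)
      ≤ F.val x - b + β / 2 * ∑ i, F.N (v - u) i ^ 2 - θ * (F.val x - b)
        - 1 / 4 * (l * ∑ i, (F.N z i - Y i) ^ 2) - (1 - θ) * F.div x z
        + 3 / 2 * ((∑ i, e i ^ 2) / l) := by
  have hx := F.val_eq x z
  have hu2 := F.val_eq u z
  have hu3 := F.half_curv_le_div hp u z
  rw [hgrad _ hxz] at hx
  rw [hgrad _ huz] at hu2
  have hopt := hv' _ huv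
  have hc := F.curv_add z (v' - z) (u - v')
  rw [sub_add_sub_cancel'] at hc
  have hc0 := F.curv_nonneg hp z (u - v')
  have hn : ∑ i, F.N (v - u) i ^ 2 = ∑ i, F.N (v' - v) i ^ 2
      + 2 * ∑ i, F.N (v' - v) i * F.N (u - v') i + ∑ i, F.N (v' - u) i ^ 2 := by
    rw [Finset.mul_sum, ← Finset.sum_add_distrib, ← Finset.sum_add_distrib]
    refine Finset.sum_congr rfl fun i _ => ?_
    simp only [map_sub, Pi.sub_apply]; ring
  -- What is left in each coordinate after the linear terms are combined. The assumption `2 l θ² ≤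
  -- β` lets the distance term absorb the move of `v` at the cost `G² / (4 l)`, and `G ≈ l (N z -
  -- Y)` makes the total negative.
  have hpt : ∀ i, -(G i * (F.N z i - Y i)) + θ * (G i * F.N (v' - v) i)
      - β / 2 * F.N (v' - v) i ^ 2
      ≤ -(1 / 4 * (l * (F.N z i - Y i) ^ 2)) + 3 / 2 * (e i ^ 2 / l) := by
    intro i
    have h1 : θ * (G i * F.N (v' - v) i) - β / 2 * F.N (v' - v) i ^ 2 ≤ G i ^ 2 / (4 * l) := by
      rw [le_div_iff₀ (by positivity)]
      set d := F.N (v' - v) i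
      have h2 : 0 ≤ (G i - 2 * l * θ * d) ^ 2 := sq_nonneg _
      have h3 : 0 ≤ (β - 2 * l * θ ^ 2) * (2 * l * d ^ 2) :=
        mul_nonneg (by linarith) (by positivity)
      nlinarith
    have h4 : -(G i * (F.N z i - Y i)) + G i ^ 2 / (4 * l)
        ≤ -(1 / 4 * (l * (F.N z i - Y i) ^ 2)) + 3 / 2 * (e i ^ 2 / l) := by
      rw [hG i]
      set Δ := F.N z i - Y i
      have e1 : (l * Δ - e i) ^ 2 / (4 * l) = l * Δ ^ 2 / 4 - e i * Δ / 2 + e i ^ 2 / l / 4 := by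
        field_simp; ring
      have q1 : 0 ≤ l * Δ ^ 2 := by positivity
      have q2 : 0 ≤ e i ^ 2 / l := by positivity
      have e2 : e i * Δ ≤ l * Δ ^ 2 + e i ^ 2 / l := by
        have : 0 ≤ (e i - l * Δ) ^ 2 / l := by positivity
        have e3 : (e i - l * Δ) ^ 2 / l = e i ^ 2 / l - 2 * (e i * Δ) + l * Δ ^ 2 := by
          field_simp; ring
        linarith
      rw [e1]
      nlinarith
    linarith
  have hsum := Finset.sum_le_sum fun i (_ : i ∈ Finset.univ) => hpt i
  simp only [Finset.sum_add_distrib, Finset.sum_sub_distrib, Finset.sum_neg_distrib,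
    ← Finset.mul_sum, ← Finset.sum_div] at hsum
  -- Since `Y` is the combination `(1 - θ) N x + θ N v`, the comparison of `z` with `x`, weighted by
  -- `1 - θ`, and with `u`, weighted by `θ`, yields `N z - Y` up to `u - v`.
  have hlin : ∑ i, G i * (F.N z i - Y i) = -((1 - θ) * ∑ i, G i * F.N (x - z) i
      + θ * ∑ i, G i * F.N (u - z) i) + θ * ∑ i, G i * F.N (u - v) i := by
    simp only [Finset.mul_sum]
    rw [← Finset.sum_add_distrib, ← Finset.sum_neg_distrib, ← Finset.sum_add_distrib]
    refine Finset.sum_congr rfl fun i _ => ?_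
    rw [hY i]
    simp only [map_sub, Pi.sub_apply]; ring
  have hlin2 : ∑ i, G i * F.N (u - v) i
      = ∑ i, G i * F.N (u - v') i + ∑ i, G i * F.N (v' - v) i := by
    rw [← Finset.sum_add_distrib]
    refine Finset.sum_congr rfl fun i _ => ?_
    simp only [map_sub, Pi.sub_apply]; ring
  have hθx : (1 - θ) * F.val x = (1 - θ) * (F.val z + -∑ i, G i * F.N (x - z) i + F.div x z) := by
    rw [← hx]
  have hθu : θ * (F.val z + -∑ i, G i * F.N (u - z) i + 1 / 2 * F.curv z (u - z)) ≤ θ * b := by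
    apply mul_le_mul_of_nonneg_left _ hθ0
    linarith
  have hθc : θ / 2 * F.curv z (u - z) = θ / 2 * (F.curv z (v' - z)
      + 2 * F.curvB z (v' - z) (u - v') + F.curv z (u - v')) := by rw [hc]
  have hθc0 : 0 ≤ θ / 2 * F.curv z (u - v') := by positivity
  rw [hn]
  nlinarith

end Objective

end LpRegression

/-! ### Newton steps for the proximal objective -/

namespace LpRegression
namespace Objective

variable {E ι κ : Type*} [AddCommGroup E] [Module ℝ E] [Fintype ι] [Fintype κ]
variable (F : Objective E ι κ)

/-- The squared length of `d` in the Hessian of the proximal objective at `s`. -/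
noncomputable def energy (l : ℝ) (s d : E) : ℝ :=
  ∑ i, 2 * F.M d i ^ 2 + ∑ i, (ddpow F.p (F.N s i) + l) * F.N d i ^ 2

/-- `d` is the Newton direction at `s` for the proximal objective along the subspace `V`. -/
def IsNewton (V : Submodule ℝ E) (l : ℝ) (Y : κ → ℝ) (s d : E) : Prop :=
  d ∈ V ∧ ∀ ξ ∈ V, ∑ i, 2 * F.M d i * F.M ξ i
      + ∑ i, (ddpow F.p (F.N s i) + l) * F.N d i * F.N ξ i
    = -(F.grad s ξ + l * ∑ i, (F.N s i - Y i) * F.N ξ i)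

theorem energy_nonneg (hp : 2 ≤ F.p) {l : ℝ} (hl : 0 ≤ l) (s d : E) : 0 ≤ F.energy l s d := by
  unfold energy
  exact add_nonneg (Finset.sum_nonneg fun i _ => by positivity)
    (Finset.sum_nonneg fun i _ => by have := ddpow_nonneg hp (F.N s i); positivity)

/-- The constant in `lam` is chosen so that `lam p ρ * (ρ / (100 p))² = ρ ^ p`. A direction of
energy at most `ρ ^ p` thus stays where `newton_error` applies. -/
theorem abs_le_of_energy_le (hp : 2 ≤ F.p) {ρ : ℝ} (hρ : 0 < ρ) {s d : E}
    (h : F.energy (lam F.p ρ) s d ≤ ρ ^ F.p) (i : κ) : |F.N d i| ≤ ρ / (100 * F.p) := by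
  have hl := lam_pos hp hρ
  have hp0 : 0 < F.p := by linarith
  have h1 : lam F.p ρ * F.N d i ^ 2 ≤ F.energy (lam F.p ρ) s d := by
    have hterm : ∀ j, 0 ≤ (ddpow F.p (F.N s j) + lam F.p ρ) * F.N d j ^ 2 := fun j => by
      have := ddpow_nonneg hp (F.N s j); positivity
    have h2 := Finset.single_le_sum (fun j _ => hterm j) (Finset.mem_univ i)
    have h3 : 0 ≤ ∑ i, 2 * F.M d i ^ 2 := Finset.sum_nonneg fun i _ => by positivity
    have h4 := ddpow_nonneg hp (F.N s i)
    have h5 : 0 ≤ ddpow F.p (F.N s i) * F.N d i ^ 2 := by positivity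
    unfold energy
    linarith
  apply abs_le_of_sq_le_sq _ (by positivity)
  have h6 : lam F.p ρ * (ρ / (100 * F.p)) ^ 2 = ρ ^ F.p := by
    rw [div_pow, ← mul_div_assoc, lam_mul_sq hρ]; field_simp; ring
  exact le_of_mul_le_mul_left (by linarith) hl

theorem energy_smul (l : ℝ) (s d : E) (t : ℝ) :
    F.energy l s (t • d) = t ^ 2 * F.energy l s d := by
  simp only [energy, map_smul, Pi.smul_apply, smul_eq_mul, mul_add, Finset.mul_sum]
  congr 1 <;> exact Finset.sum_congr rfl fun i _ => by ring

/-- The quadratic model gives `1/2` of the energy, and the expansion error adds one percent. -/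
theorem div_newton_le (hp : 2 ≤ F.p) {ρ : ℝ} (hρ : 0 < ρ) {s d : E}
    (h : F.energy (lam F.p ρ) s d ≤ ρ ^ F.p) :
    F.div (s + d) s + lam F.p ρ / 2 * ∑ i, F.N d i ^ 2 ≤ 51 / 100 * F.energy (lam F.p ρ) s d := by
  have h1 : ∀ i, breg F.p (F.N (s + d) i) (F.N s i) + lam F.p ρ / 2 * F.N d i ^ 2
      ≤ 51 / 100 * ((ddpow F.p (F.N s i) + lam F.p ρ) * F.N d i ^ 2) := by
    intro i
    have := (abs_le.1 (breg_newton hp hρ (s := F.N s i) (F.abs_le_of_energy_le hp hρ h i))).2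
    rw [map_add, Pi.add_apply]
    linarith
  have h2 := Finset.sum_le_sum fun i (_ : i ∈ Finset.univ) => h1 i
  rw [Finset.sum_add_distrib, ← Finset.mul_sum, ← Finset.mul_sum] at h2
  have h3 : 0 ≤ ∑ i, F.M d i ^ 2 := Finset.sum_nonneg fun i _ => by positivity
  simp only [div, energy, add_sub_cancel_left]
  rw [← Finset.mul_sum]
  linarith

/-- The decrease of the proximal objective along the Newton direction. -/
theorem prox_newton_le (hp : 2 ≤ F.p) {ρ t : ℝ} (hρ : 0 < ρ) {V : Submodule ℝ E} {Y : κ → ℝ}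
    {s d : E} (hd : F.IsNewton V (lam F.p ρ) Y s d)
    (h : t ^ 2 * F.energy (lam F.p ρ) s d ≤ ρ ^ F.p) :
    F.prox (lam F.p ρ) Y (s + t • d) ≤ F.prox (lam F.p ρ) Y s
      - (t - 51 / 100 * t ^ 2) * F.energy (lam F.p ρ) s d := by
  rw [← F.energy_smul] at h
  have h1 := F.div_newton_le hp hρ h
  rw [F.energy_smul] at h1
  have h2 := F.val_eq (s + t • d) s
  rw [add_sub_cancel_left] at h2
  have h3 := hd.2 d hd.1
  have h4 : F.grad s (t • d) = t * F.grad s d := by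
    simp only [grad, map_smul, Pi.smul_apply, smul_eq_mul, mul_add, Finset.mul_sum]
    congr 1
    · congr 1
      exact Finset.sum_congr rfl fun i _ => by ring
    · exact Finset.sum_congr rfl fun i _ => by ring
  have h5 : F.energy (lam F.p ρ) s d
      = -(F.grad s d + lam F.p ρ * ∑ i, (F.N s i - Y i) * F.N d i) := by
    rw [← h3, energy]
    congr 1 <;> exact Finset.sum_congr rfl fun i _ => by ring
  have h6 : ∑ i, (F.N (s + t • d) i - Y i) ^ 2 = ∑ i, (F.N s i - Y i) ^ 2
      + 2 * t * ∑ i, (F.N s i - Y i) * F.N d i + ∑ i, F.N (t • d) i ^ 2 := by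
    rw [Finset.mul_sum, ← Finset.sum_add_distrib, ← Finset.sum_add_distrib]
    refine Finset.sum_congr rfl fun i _ => ?_
    simp only [map_add, map_smul, Pi.add_apply, Pi.smul_apply, smul_eq_mul]; ring
  unfold prox
  rw [h2, h4, h6]
  have h7 : t * F.energy (lam F.p ρ) s d
      = -(t * F.grad s d + t * lam F.p ρ * ∑ i, (F.N s i - Y i) * F.N d i) := by
    rw [h5]; ring
  linarith

/-- The residual of a Newton step. -/
noncomputable def residual (s d : E) (i : κ) : ℝ :=
  dpow F.p (F.N (s + d) i) - dpow F.p (F.N s i) - ddpow F.p (F.N s i) * F.N d i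

/-- The Newton equation cancels the linear part of the change of the gradient. Only the residual of
the `p`-norm term survives, so up to it `s + d` is an exact proximal point. -/
theorem grad_newton {l : ℝ} {V : Submodule ℝ E} {Y : κ → ℝ} {s d : E}
    (hd : F.IsNewton V l Y s d) (ξ : E) (hξ : ξ ∈ V) :
    F.grad (s + d) ξ = -∑ i, (l * (F.N (s + d) i - Y i) - F.residual s d i) * F.N ξ i := by
  have h := hd.2 ξ hξ
  have h1 : F.grad (s + d) ξ = F.grad s ξ + ∑ i, 2 * F.M d i * F.M ξ i
      + ∑ i, (dpow F.p (F.N (s + d) i) - dpow F.p (F.N s i)) * F.N ξ i := by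
    simp only [grad, map_add, Pi.add_apply, mul_add, add_mul, sub_mul, Finset.sum_add_distrib,
      Finset.sum_sub_distrib]
    ring
  have h2 : ∑ i, (l * (F.N (s + d) i - Y i) - F.residual s d i) * F.N ξ i
      = l * ∑ i, (F.N s i - Y i) * F.N ξ i
        + ∑ i, (ddpow F.p (F.N s i) + l) * F.N d i * F.N ξ i
        - ∑ i, (dpow F.p (F.N (s + d) i) - dpow F.p (F.N s i)) * F.N ξ i := by
    rw [Finset.mul_sum, ← Finset.sum_add_distrib, ← Finset.sum_sub_distrib]
    refine Finset.sum_congr rfl fun i _ => ?_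
    simp only [residual, map_add, Pi.add_apply]
    ring
  rw [h1, h2]
  linarith

/-- Coordinates above `ρ` have an error at most `p / ρ` times their share of the energy. The sum is
at most `p / ρ` times the energy, and its square is controlled because the energy is at most `ρ ^ p`
and `(p / ρ)² ρ ^ p = lam / 10000`. Coordinates below `ρ` have an error that is a small multiple of
`lam * |N d|`. -/
theorem residual_le (hp : 2 ≤ F.p) {ρ : ℝ} (hρ : 0 < ρ) {s d : E}
    (h : F.energy (lam F.p ρ) s d ≤ ρ ^ F.p) :
    ∑ i, F.residual s d i ^ 2 ≤ 2 / 10000 * (lam F.p ρ * F.energy (lam F.p ρ) s d) := by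
  set l := lam F.p ρ with hldef
  set En := F.energy l s d with hE
  have hp0 : 0 < F.p := by linarith
  have hl := lam_pos hp hρ
  have hdd : ∀ i, 0 ≤ ddpow F.p (F.N s i) * F.N d i ^ 2 := fun i => by
    have := ddpow_nonneg hp (F.N s i); positivity
  set a : κ → ℝ := fun i => F.p / ρ * (ddpow F.p (F.N s i) * F.N d i ^ 2) with ha
  have ha0 : ∀ i, 0 ≤ a i := fun i => mul_nonneg (by positivity) (hdd i)
  have hpt : ∀ i, F.residual s d i ^ 2 ≤ a i ^ 2 + (9 / 10000 * l) ^ 2 * F.N d i ^ 2 := by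
    intro i
    have hx := F.abs_le_of_energy_le hp hρ h i
    have hr : F.residual s d i = dpow F.p (F.N s i + F.N d i) - dpow F.p (F.N s i)
        - ddpow F.p (F.N s i) * F.N d i := by simp [residual]
    rw [hr]
    rcases le_total ρ |F.N s i| with hs | hs
    · have h1 := newton_error_large hp hρ hs hx
      have h2 := sq_le_sq' (by linarith [(abs_le.1 h1).1, ha0 i]) (abs_le.1 h1).2
      have : 0 ≤ (9 / 10000 * l) ^ 2 * F.N d i ^ 2 := by positivity
      simp only [ha]
      linarith
    · have h1 := newton_error_small hp hρ hs hx
      have h3 : 9 * (F.p ^ 2 * ρ ^ (F.p - 2)) * |F.N d i| = 9 / 10000 * l * |F.N d i| := by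
        rw [hldef, lam]; ring
      rw [h3] at h1
      have h2 := sq_le_sq' (abs_le.1 h1).1 (abs_le.1 h1).2
      rw [mul_pow (9 / 10000 * l), sq_abs] at h2
      have : 0 ≤ a i ^ 2 := sq_nonneg _
      linarith
  have hM : 0 ≤ ∑ i, 2 * F.M d i ^ 2 := Finset.sum_nonneg fun i _ => by positivity
  have hsplit : En = ∑ i, 2 * F.M d i ^ 2 + ∑ i, ddpow F.p (F.N s i) * F.N d i ^ 2
      + l * ∑ i, F.N d i ^ 2 := by
    rw [hE, energy, Finset.mul_sum, add_assoc, ← Finset.sum_add_distrib]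
    congr 1
    exact Finset.sum_congr rfl fun i _ => by ring
  have hdsum : 0 ≤ ∑ i, ddpow F.p (F.N s i) * F.N d i ^ 2 := Finset.sum_nonneg fun i _ => hdd i
  have hnsum : 0 ≤ l * ∑ i, F.N d i ^ 2 :=
    mul_nonneg hl.le (Finset.sum_nonneg fun i _ => by positivity)
  have hE0 : 0 ≤ En := F.energy_nonneg hp hl.le s d
  -- No dimension enters here: for nonnegative terms the 2-norm is at most the 1-norm.
  have hsq : ∑ i, a i ^ 2 ≤ (∑ i, a i) ^ 2 := by
    rw [sq (∑ i, a i), Finset.sum_mul]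
    refine Finset.sum_le_sum fun i hi => ?_
    rw [sq]
    exact mul_le_mul_of_nonneg_left (Finset.single_le_sum (fun j _ => ha0 j) hi) (ha0 i)
  have hsum : ∑ i, a i ≤ F.p / ρ * En := by
    rw [ha, ← Finset.mul_sum]
    gcongr
    linarith
  have hsum0 : 0 ≤ ∑ i, a i := Finset.sum_nonneg fun i _ => ha0 i
  have h1 : (∑ i, a i) ^ 2 ≤ l / 10000 * En := by
    have h2 : (∑ i, a i) ^ 2 ≤ (F.p / ρ * En) ^ 2 := by gcongr
    have h3 : (F.p / ρ) ^ 2 * ρ ^ F.p = l / 10000 := by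
      have := lam_mul_sq (p := F.p) hρ
      rw [← hldef] at this
      field_simp
      linarith
    calc (∑ i, a i) ^ 2 ≤ (F.p / ρ) ^ 2 * En * En := by rw [mul_pow] at h2; linarith
      _ ≤ (F.p / ρ) ^ 2 * ρ ^ F.p * En := by gcongr
      _ = l / 10000 * En := by rw [h3]
  have h2 := Finset.sum_le_sum fun i (_ : i ∈ Finset.univ) => hpt i
  rw [Finset.sum_add_distrib, ← Finset.mul_sum] at h2
  have h3 : (9 / 10000 * l) ^ 2 * ∑ i, F.N d i ^ 2 ≤ 81 / 100000000 * (l * En) := by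
    have : l * (l * ∑ i, F.N d i ^ 2) ≤ l * En := by gcongr; linarith
    nlinarith
  have : 0 ≤ l * En := by positivity
  linarith

/-- The gap of the proximal objective at its center. -/
theorem prox_center_le {l : ℝ} (hl : 0 < l) {V : Submodule ℝ E} {y z : E} {e : κ → ℝ}
    (hyz : y - z ∈ V)
    (hgrad : ∀ ξ ∈ V, F.grad z ξ = -∑ i, (l * (F.N z i - F.N y i) - e i) * F.N ξ i) :
    F.prox l (F.N y) y - F.prox l (F.N y) z
      ≤ F.div y z + l * ∑ i, (F.N z i - F.N y i) ^ 2 + 1 / 2 * ((∑ i, e i ^ 2) / l) := by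
  have h := F.val_eq y z
  rw [hgrad _ hyz] at h
  have h1 : -∑ i, (l * (F.N z i - F.N y i) - e i) * F.N (y - z) i
      ≤ 3 / 2 * l * ∑ i, (F.N z i - F.N y i) ^ 2 + 1 / 2 * ((∑ i, e i ^ 2) / l) := by
    rw [Finset.sum_div, Finset.mul_sum, Finset.mul_sum, ← Finset.sum_neg_distrib,
      ← Finset.sum_add_distrib]
    refine Finset.sum_le_sum fun i _ => ?_
    rw [map_sub, Pi.sub_apply]
    set Δ := F.N z i - F.N y i with hΔ
    have e0 : F.N y i - F.N z i = -Δ := by rw [hΔ]; ring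
    rw [e0]
    have h2 : 0 ≤ (e i + l * Δ) ^ 2 / l := by positivity
    have h3 : (e i + l * Δ) ^ 2 / l = e i ^ 2 / l + 2 * (e i * Δ) + l * Δ ^ 2 := by
      field_simp; ring
    linarith
  unfold prox
  simp only [sub_self]
  norm_num
  linarith

end Objective
end LpRegression

/-! ### Gain of an accelerated step -/

namespace LpRegression
namespace Objective

variable {E ι κ : Type*} [AddCommGroup E] [Module ℝ E] [Fintype ι] [Fintype κ]
variable (F : Objective E ι κ)

/-- The progress of the step from the extrapolation `x + θ (v - x)` to `z`. -/
noncomputable def gain (l θ : ℝ) (x v z : E) : ℝ :=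
  l * ∑ i, F.N (x + θ • (v - x) - z) i ^ 2 + F.div x z + F.p * θ ^ 2 * F.curv x (v - x)

theorem gain_nonneg (hp : 2 ≤ F.p) {l : ℝ} (hl : 0 ≤ l) (θ : ℝ) (x v z : E) :
    0 ≤ F.gain l θ x v z := by
  have h1 := F.div_nonneg hp x z
  have h2 := F.curv_nonneg hp x (v - x)
  have h3 : 0 ≤ F.p := by linarith
  have h4 : 0 ≤ ∑ i, F.N (x + θ • (v - x) - z) i ^ 2 := Finset.sum_nonneg fun i _ => sq_nonneg _
  unfold gain
  positivity

/-- The sum of `breg_stable` over the coordinates. A single coordinate in the second case already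
makes the whole divergence from `x` at least `ρ ^ p / 4`, so the factor `p` may then be admitted
everywhere. -/
theorem div_stable (hp : 2 ≤ F.p) {ρ θ : ℝ} (hρ : 0 < ρ) {x v z : E}
    (h : ∀ i, StableMove F.p ρ (F.N x i) (F.N (x + θ • (v - x)) i)) :
    F.div (x + θ • (v - x)) z ≤ lam F.p ρ * ∑ i, F.N (x + θ • (v - x) - z) i ^ 2
        + 9 * F.div x z + 16 * (F.p * θ ^ 2 * F.curv x (v - x)) ∨
      (F.div (x + θ • (v - x)) z ≤ lam F.p ρ * ∑ i, F.N (x + θ • (v - x) - z) i ^ 2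
        + (9 + 16 * F.p) * F.div x z + 16 * (F.p * θ ^ 2 * F.curv x (v - x)) ∧
        ρ ^ F.p / 4 ≤ F.div x z) := by
  set y := x + θ • (v - x) with hy
  set l := lam F.p ρ
  have hp0 : 0 < F.p := by linarith
  have hl : 0 < l := lam_pos hp hρ
  have hM : ∑ i, F.M (y - z) i ^ 2 ≤ 2 * ∑ i, F.M (x - z) i ^ 2
      + F.p * θ ^ 2 * ∑ i, 2 * F.M (v - x) i ^ 2 := by
    rw [Finset.mul_sum, Finset.mul_sum, ← Finset.sum_add_distrib]
    refine Finset.sum_le_sum fun i _ => ?_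
    have e1 : F.M (y - z) i = F.M (x - z) i + θ * F.M (v - x) i := by
      rw [hy]; simp only [map_add, map_sub, map_smul, Pi.add_apply, Pi.sub_apply, Pi.smul_apply,
        smul_eq_mul]; ring
    rw [e1]
    have h1 : 0 ≤ (F.M (x - z) i - θ * F.M (v - x) i) ^ 2 := sq_nonneg _
    have h2 : 0 ≤ (F.p - 1) * (θ * F.M (v - x) i) ^ 2 := by
      have : 0 ≤ F.p - 1 := by linarith
      positivity
    nlinarith
  have hyx : ∀ i, F.N y i - F.N x i = θ * F.N (v - x) i := fun i => by
    rw [hy]; simp only [map_add, map_sub, map_smul, Pi.add_apply, Pi.sub_apply, Pi.smul_apply,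
        smul_eq_mul]; ring
  have hyz : ∀ i, F.N (y - z) i = F.N y i - F.N z i := fun i => by rw [map_sub, Pi.sub_apply]
  have hs : ∀ i, breg F.p (F.N y i) (F.N z i) ≤ l * F.N (y - z) i ^ 2
      + 9 * breg F.p (F.N x i) (F.N z i)
      + 16 * (F.p * θ ^ 2 * (F.p * |F.N x i| ^ (F.p - 2) * F.N (v - x) i ^ 2)) ∨
      (breg F.p (F.N y i) (F.N z i) ≤ 16 * F.p * breg F.p (F.N x i) (F.N z i) ∧
        ρ ^ F.p / 4 ≤ breg F.p (F.N x i) (F.N z i)) := by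
    intro i
    have := breg_stable hp hρ (z := F.N z i) (h i)
    rw [hyx i] at this
    rw [hyz i]
    rcases this with h1 | h1
    · left; linarith
    · right; exact h1
  have hb : ∀ i, 0 ≤ breg F.p (F.N x i) (F.N z i) := fun i => breg_nonneg hp _ _
  have hc : ∀ i, 0 ≤ F.p * θ ^ 2 * (F.p * |F.N x i| ^ (F.p - 2) * F.N (v - x) i ^ 2) := fun i => by
    have := Real.rpow_nonneg (abs_nonneg (F.N x i)) (F.p - 2)
    positivity
  have hxM : 0 ≤ ∑ i, F.M (x - z) i ^ 2 := Finset.sum_nonneg fun i _ => sq_nonneg _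
  have hvM : 0 ≤ F.p * θ ^ 2 * ∑ i, 2 * F.M (v - x) i ^ 2 :=
    mul_nonneg (by positivity) (Finset.sum_nonneg fun i _ => by positivity)
  by_cases hall : ∀ i, breg F.p (F.N y i) (F.N z i) ≤ l * F.N (y - z) i ^ 2
      + 9 * breg F.p (F.N x i) (F.N z i)
      + 16 * (F.p * θ ^ 2 * (F.p * |F.N x i| ^ (F.p - 2) * F.N (v - x) i ^ 2))
  · left
    have hsum := Finset.sum_le_sum fun i (_ : i ∈ Finset.univ) => hall i
    simp only [Finset.sum_add_distrib, ← Finset.mul_sum] at hsum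
    simp only [div, curv, mul_add]
    linarith
  · right
    push Not at hall
    obtain ⟨i₀, hi₀⟩ := hall
    have h0 := ((hs i₀).resolve_left (not_le.2 hi₀)).2
    have h1 : breg F.p (F.N x i₀) (F.N z i₀) ≤ ∑ i, breg F.p (F.N x i) (F.N z i) :=
      Finset.single_le_sum (fun j _ => hb j) (Finset.mem_univ i₀)
    refine ⟨?_, by unfold div; linarith⟩
    have hall : ∀ i, breg F.p (F.N y i) (F.N z i) ≤ l * F.N (y - z) i ^ 2
      + (9 + 16 * F.p) * breg F.p (F.N x i) (F.N z i)
      + 16 * (F.p * θ ^ 2 * (F.p * |F.N x i| ^ (F.p - 2) * F.N (v - x) i ^ 2)) := by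
      intro i
      have h2 : 0 ≤ l * F.N (y - z) i ^ 2 := by positivity
      have h3 : 0 ≤ F.p * breg F.p (F.N x i) (F.N z i) := mul_nonneg hp0.le (hb i)
      rcases hs i with h4 | ⟨h4, -⟩ <;> linarith [hb i, hc i]
    have hsum := Finset.sum_le_sum fun i (_ : i ∈ Finset.univ) => hall i
    simp only [Finset.sum_add_distrib, ← Finset.mul_sum] at hsum
    simp only [div, curv, mul_add]
    have : 0 ≤ F.p * ∑ i, F.M (x - z) i ^ 2 := by positivity
    linarith

theorem div_self (x : E) : F.div x x = 0 := by
  simp [div, breg_self]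

/-- The case `z = x`, where the second alternative is impossible because the divergence vanishes. -/
theorem div_extrapolation_le (hp : 2 ≤ F.p) {ρ θ : ℝ} (hρ : 0 < ρ) {x v : E}
    (h : ∀ i, StableMove F.p ρ (F.N x i) (F.N (x + θ • (v - x)) i)) :
    F.div (x + θ • (v - x)) x ≤ lam F.p ρ * (θ ^ 2 * ∑ i, F.N (v - x) i ^ 2)
      + 16 * (F.p * θ ^ 2 * F.curv x (v - x)) := by
  have h0 := Real.rpow_pos_of_pos hρ F.p
  have h1 := F.div_stable hp hρ (z := x) h
  rw [div_self, add_sub_cancel_left] at h1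
  simp only [map_smul, Pi.smul_apply, smul_eq_mul, mul_pow, ← Finset.mul_sum] at h1
  rcases h1 with h1 | ⟨-, h1⟩ <;> linarith

section Macro

variable {V : Submodule ℝ E} {ρ θ : ℝ} {x v s d : E}

/-- Bounds for an accepted Newton step. -/
theorem newton_accept (hp : 2 ≤ F.p) (hρ : 0 < ρ)
    (hstab : ∀ i, StableMove F.p ρ (F.N x i) (F.N (x + θ • (v - x)) i))
    (hd : F.IsNewton V (lam F.p ρ) (F.N (x + θ • (v - x))) s d)
    (hE : F.energy (lam F.p ρ) s d ≤ ρ ^ F.p) {a : ℝ} (ha : 0 ≤ a)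
    (hys : x + θ • (v - x) - s ∈ V)
    (hs : F.prox (lam F.p ρ) (F.N (x + θ • (v - x))) s
      ≤ F.prox (lam F.p ρ) (F.N (x + θ • (v - x))) (x + θ • (v - x)) - a) :
    a ≤ 49 * F.p * F.gain (lam F.p ρ) θ x v (s + d) ∧
    (∑ i, F.residual s d i ^ 2) / lam F.p ρ ≤ 3 / 100 * F.gain (lam F.p ρ) θ x v (s + d) := by
  set l := lam F.p ρ with hldef
  set y := x + θ • (v - x) with hy
  set z := s + d with hz
  set g := F.gain l θ x v z with hg
  set En := F.energy l s d with hEn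
  have hp0 : 0 < F.p := by linarith
  have hl : 0 < l := lam_pos hp hρ
  have hE0 : 0 ≤ En := F.energy_nonneg hp hl.le s d
  have hg0 : 0 ≤ g := F.gain_nonneg hp hl.le θ x v z
  have hres : (∑ i, F.residual s d i ^ 2) / l ≤ 2 / 10000 * En := by
    rw [div_le_iff₀ hl]
    have := F.residual_le hp hρ hE
    linarith
  have hdec := F.prox_newton_le hp hρ (t := 1) hd (by linarith)
  rw [one_smul] at hdec
  have hyz : y - z ∈ V := by
    have := V.sub_mem hys hd.1
    rwa [sub_sub] at this
  have hcen := F.prox_center_le hl hyz (fun ξ hξ => F.grad_newton hd ξ hξ)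
  have hsymm : ∑ i, (F.N z i - F.N y i) ^ 2 = ∑ i, F.N (y - z) i ^ 2 :=
    Finset.sum_congr rfl fun i _ => by rw [map_sub, Pi.sub_apply]; ring
  rw [hsymm] at hcen
  have hgain : g = l * ∑ i, F.N (y - z) i ^ 2 + F.div x z + F.p * θ ^ 2 * F.curv x (v - x) := rfl
  have hr0 : 0 ≤ l * ∑ i, F.N (y - z) i ^ 2 :=
    mul_nonneg hl.le (Finset.sum_nonneg fun i _ => sq_nonneg _)
  have hd0 := F.div_nonneg hp x z
  have hc0 : 0 ≤ F.p * θ ^ 2 * F.curv x (v - x) := mul_nonneg (by positivity) (F.curv_nonneg hp _ _)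
  have hpg : 2 * g ≤ F.p * g := by gcongr
  -- In the second case the factor `p` is affordable in the bound for `a`, but not for the residual.
  -- There the energy is bounded by `ρ ^ p`, hence by four times the divergence from `x`.
  rcases F.div_stable hp hρ (z := z) hstab with h1 | ⟨h1, h2⟩
  · constructor <;> linarith
  · have h3 : F.p * F.div x z ≤ F.p * g := by gcongr; linarith
    constructor <;> linarith

/-- The accelerated step in terms of the potential: besides `θ δ / 2`, an eighth of the gain is left
over. The gradient bound records that the new gradient is essentially `lam` times the proximal
displacement; it is needed to bound the objective at the next extrapolated point. -/
theorem macro_step (hp : 2 ≤ F.p) (hρ : 0 < ρ) {u v' : E} {β b g δ a : ℝ}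
    (hstab : ∀ i, StableMove F.p ρ (F.N x i) (F.N (x + θ • (v - x)) i))
    (hd : F.IsNewton V (lam F.p ρ) (F.N (x + θ • (v - x))) s d)
    (hE : F.energy (lam F.p ρ) s d ≤ ρ ^ F.p) (ha : 0 ≤ a)
    (hs : F.prox (lam F.p ρ) (F.N (x + θ • (v - x))) s
      ≤ F.prox (lam F.p ρ) (F.N (x + θ • (v - x))) (x + θ • (v - x)) - a)
    (hxs : x - s ∈ V) (hvs : v - s ∈ V) (hus : u - s ∈ V) (hvV : v' - s ∈ V)
    (hθ0 : 0 ≤ θ) (hθ : θ ≤ 1 / 2) (hθβ : 2 * lam F.p ρ * θ ^ 2 ≤ β)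
    (hv' : ∀ ξ ∈ V, θ * F.curvB (s + d) (v' - (s + d)) ξ + β * ∑ i, F.N (v' - v) i * F.N ξ i
      = θ * ∑ i, (lam F.p ρ * (F.N (s + d) i - F.N (x + θ • (v - x)) i) - F.residual s d i)
          * F.N ξ i)
    (hu : F.val u ≤ b) (hx : δ / 2 ≤ F.val x - b) (hg : F.p * θ ^ 2 ≤ 2 * g) :
    F.val (s + d) - b + β / 2 * ∑ i, F.N (v' - u) i ^ 2 + θ / 2 * F.curv (s + d) (v' - (s + d))
        + 1 / 8 * F.gain (lam F.p ρ) θ x v (s + d) + θ * δ / 2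
      ≤ F.val x - b + β / 2 * ∑ i, F.N (v - u) i ^ 2 + g / 2 * F.curv x (v - x) ∧
    a ≤ 49 * F.p * F.gain (lam F.p ρ) θ x v (s + d) ∧
    (∀ ξ ∈ V, F.grad (s + d) ξ ^ 2 ≤ 4 * lam F.p ρ * F.gain (lam F.p ρ) θ x v (s + d)
      * ∑ i, F.N ξ i ^ 2) := by
  set l := lam F.p ρ with hldef
  set y := x + θ • (v - x) with hy
  set z := s + d with hz
  set G := F.gain l θ x v z with hG
  have hys : y - s ∈ V := by
    have : y - s = (x - s) + θ • ((v - s) - (x - s)) := by rw [hy, sub_sub_sub_cancel_right]; abel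
    rw [this]
    exact V.add_mem hxs (V.smul_mem _ (V.sub_mem hvs hxs))
  obtain ⟨h1, h2⟩ := F.newton_accept hp hρ hstab hd hE ha hys hs
  have hl : 0 < l := lam_pos hp hρ
  have hxz : x - z ∈ V := by have := V.sub_mem hxs hd.1; rwa [sub_sub] at this
  have huz : u - z ∈ V := by have := V.sub_mem hus hd.1; rwa [sub_sub] at this
  have huv : u - v' ∈ V := by have := V.sub_mem hus hvV; rwa [sub_sub_sub_cancel_right] at this
  have hY : ∀ i, F.N y i = F.N x i + θ * (F.N v i - F.N x i) := fun i => by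
    rw [hy]; simp only [map_add, map_sub, map_smul, Pi.add_apply, Pi.sub_apply, Pi.smul_apply,
        smul_eq_mul]
  have hacc := F.accelerated_step hp hl hθ0 hθβ hxz huz huv hY (fun i => rfl)
    (fun ξ hξ => F.grad_newton hd ξ hξ) hv' hu
  have hsymm : ∑ i, (F.N z i - F.N y i) ^ 2 = ∑ i, F.N (y - z) i ^ 2 :=
    Finset.sum_congr rfl fun i _ => by rw [map_sub, Pi.sub_apply]; ring
  rw [hsymm] at hacc
  have hgain : G = l * ∑ i, F.N (y - z) i ^ 2 + F.div x z + F.p * θ ^ 2 * F.curv x (v - x) := rfl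
  have hr0 : 0 ≤ l * ∑ i, F.N (y - z) i ^ 2 :=
    mul_nonneg hl.le (Finset.sum_nonneg fun i _ => sq_nonneg _)
  have hd0 := F.div_nonneg hp x z
  have hc := F.curv_nonneg hp x (v - x)
  have hc0 : 0 ≤ F.p * θ ^ 2 * F.curv x (v - x) := mul_nonneg (by positivity) hc
  -- The curvature part of the gain is paid by the curvature term that the previous step left in the
  -- potential.
  have hgc : F.p * θ ^ 2 * F.curv x (v - x) ≤ 2 * g * F.curv x (v - x) := by gcongr
  refine ⟨?_, h1, ?_⟩
  · have e1 : θ * δ / 2 ≤ θ * (F.val x - b) := by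
      have := mul_le_mul_of_nonneg_left hx hθ0
      linarith
    have e2 : θ * F.div x z ≤ 1 / 2 * F.div x z := by gcongr
    linarith
  · intro ξ hξ
    rw [F.grad_newton hd ξ hξ, neg_sq]
    refine (Finset.sum_mul_sq_le_sq_mul_sq _ _ _).trans ?_
    refine mul_le_mul_of_nonneg_right ?_ (Finset.sum_nonneg fun i _ => sq_nonneg _)
    have h3 : ∀ i, (l * (F.N z i - F.N y i) - F.residual s d i) ^ 2
        ≤ 2 * l * (l * (F.N z i - F.N y i) ^ 2) + 2 * F.residual s d i ^ 2 := fun i => by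
      have : 0 ≤ (l * (F.N z i - F.N y i) + F.residual s d i) ^ 2 := sq_nonneg _
      linarith
    have h4 := Finset.sum_le_sum fun i (_ : i ∈ Finset.univ) => h3 i
    rw [Finset.sum_add_distrib, ← Finset.mul_sum, ← Finset.mul_sum, ← Finset.mul_sum, hsymm] at h4
    rw [div_le_iff₀ hl] at h2
    have h5 : l * (l * ∑ i, F.N (y - z) i ^ 2) ≤ l * G := by gcongr; linarith
    have h6 : 0 ≤ l * G := mul_nonneg hl.le (F.gain_nonneg hp hl.le θ x v z)
    linarith

/-- The gain of a step whose extrapolation is limited by one of the coordinates. -/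
theorem gain_tight (hp : 2 ≤ F.p) (hρ : 0 < ρ) {z : E} {i : κ}
    (h : TightMove F.p ρ (F.N x i) (F.N (x + θ • (v - x)) i)) :
    ρ ^ F.p / (32 * F.p) ≤ F.gain (lam F.p ρ) θ x v z := by
  set y := x + θ • (v - x) with hy
  have hl : 0 < lam F.p ρ := lam_pos hp hρ
  have hp0 : 0 < F.p := by linarith
  have h1 := breg_tight hp hρ (z := F.N z i) h
  have h2 : F.N (y - z) i ^ 2 ≤ ∑ i, F.N (y - z) i ^ 2 :=
    Finset.single_le_sum (f := fun i => F.N (y - z) i ^ 2) (fun j _ => sq_nonneg _) (Finset.mem_univ i)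
  have h3 : breg F.p (F.N x i) (F.N z i) ≤ ∑ i, breg F.p (F.N x i) (F.N z i) :=
    Finset.single_le_sum (f := fun i => breg F.p (F.N x i) (F.N z i))
      (fun j _ => breg_nonneg hp _ _) (Finset.mem_univ i)
  have h4 := F.curv_nonneg hp x (v - x)
  have h5 : 0 ≤ ∑ i, F.M (x - z) i ^ 2 := Finset.sum_nonneg fun i _ => sq_nonneg _
  have h6 : 0 ≤ F.p * θ ^ 2 * F.curv x (v - x) := by positivity
  have h7 := mul_le_mul_of_nonneg_left h2 hl.le
  rw [map_sub, Pi.sub_apply, ← map_sub] at h7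
  rw [← Pi.sub_apply (F.N y), ← map_sub] at h1
  simp only [gain, div]
  rw [map_sub, Pi.sub_apply] at h1
  rw [map_sub] at h7 ⊢
  linarith

end Macro

end Objective
end LpRegression

namespace LpRegression

/-! ### The extrapolation parameter -/

/-- The distance by which a coordinate `x` can be moved in the direction of `w`. -/
noncomputable def room (p ρ x w : ℝ) : ℝ :=
  if |x| ≤ ρ then (1 + 1 / p) * ρ - x * (if 0 ≤ w then 1 else -1) else |x| / p

theorem le_room {p ρ : ℝ} (hp : 2 ≤ p) (x w : ℝ) : ρ / p ≤ room p ρ x w := by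
  have hp0 : 0 < p := by linarith
  unfold room
  have e : (1 + 1 / p) * ρ = ρ + ρ / p := by ring
  split_ifs with h1 h2
  · have := (abs_le.1 h1).2; linarith
  · have := (abs_le.1 h1).1; linarith
  · push Not at h1; gcongr

theorem room_pos {p ρ : ℝ} (hp : 2 ≤ p) (hρ : 0 < ρ) (x w : ℝ) : 0 < room p ρ x w :=
  (by positivity : 0 < ρ / p).trans_le (le_room hp x w)

theorem stableMove_of_mul_abs_le {p ρ x w θ : ℝ} (hp : 2 ≤ p) (hρ : 0 < ρ) (hθ : 0 ≤ θ)
    (h : θ * |w| ≤ room p ρ x w) : StableMove p ρ x (x + θ * w) := by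
  have hp0 : 0 < p := by linarith
  have hr : 0 ≤ ρ / p := by positivity
  have e : (1 + 1 / p) * ρ = ρ + ρ / p := by ring
  unfold room at h
  unfold StableMove
  split_ifs at h with h1 h2
  · right
    rw [abs_of_nonneg h2] at h
    have := abs_le.1 h1
    have h3 : 0 ≤ θ * w := by positivity
    exact ⟨h1, abs_le.2 ⟨by linarith, by linarith⟩⟩
  · right
    push Not at h2
    rw [abs_of_neg h2] at h
    have := abs_le.1 h1
    have h3 : 0 ≤ θ * -w := mul_nonneg hθ (by linarith)
    exact ⟨h1, abs_le.2 ⟨by linarith, by linarith⟩⟩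
  · left
    push Not at h1
    rw [add_sub_cancel_left, abs_mul, abs_of_nonneg hθ]
    exact ⟨h1, h⟩

/-- The room of a small coordinate can be as large as `2 ρ + ρ / p`. Using all but the fraction `1 /
(4p)` of it leaves the target at most `ρ / p` short, so `ρ` is still reached. -/
theorem tightMove_of_le_mul_abs {p ρ x w θ : ℝ} (hp : 2 ≤ p) (hρ : 0 < ρ) (hθ : 0 ≤ θ)
    (h : θ * |w| ≤ room p ρ x w) (h' : (1 - 1 / (4 * p)) * room p ρ x w ≤ θ * |w|) :
    TightMove p ρ x (x + θ * w) := by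
  have hp0 : 0 < p := by linarith
  have hr : 0 ≤ ρ / p := by positivity
  have hroom := le_room (ρ := ρ) hp x w
  have hip : 1 / (4 * p) ≤ 1 / 8 := by
    rw [div_le_div_iff₀ (by positivity) (by positivity)]; linarith
  have hip0 : 0 < 1 / (4 * p) := by positivity
  have hfar : 3 / 4 * room p ρ x w ≤ θ * |w| := by
    refine le_trans ?_ h'
    have := hr.trans hroom
    gcongr
    linarith
  have e0 : |x + θ * w - x| = θ * |w| := by
    rw [add_sub_cancel_left, abs_mul, abs_of_nonneg hθ]
  have e : (1 + 1 / p) * ρ = ρ + ρ / p := by ring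
  have hfar2 : 3 / 4 * (ρ / p) ≤ θ * |w| := by linarith
  have hq : 1 / (4 * p) * (2 * ρ + ρ / p) ≤ ρ / p := by
    have e2 : 1 / (4 * p) * (2 * ρ + ρ / p) = 1 / 2 * (ρ / p) + 1 / (4 * p) * (ρ / p) := by
      field_simp; ring
    rw [e2]
    nlinarith
  unfold TightMove
  rw [e0]
  by_cases h1 : |x| ≤ ρ
  · refine Or.inr ⟨h1, ?_, hfar2⟩
    have hx := abs_le.1 h1
    unfold room at h h'
    rw [if_pos h1] at h h'
    rcases le_or_gt 0 w with h2 | h2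
    · rw [if_pos h2, abs_of_nonneg h2] at h h'
      refine le_trans ?_ (le_abs_self _)
      have : 1 / (4 * p) * ((1 + 1 / p) * ρ - x * 1) ≤ 1 / (4 * p) * (2 * ρ + ρ / p) := by
        gcongr; linarith
      linarith
    · rw [if_neg (not_le.2 h2), abs_of_neg h2] at h h'
      refine le_trans ?_ (neg_le_abs _)
      have : 1 / (4 * p) * ((1 + 1 / p) * ρ - x * -1) ≤ 1 / (4 * p) * (2 * ρ + ρ / p) := by
        gcongr; linarith
      linarith
  · have h3 : room p ρ x w = |x| / p := if_neg h1
    rw [h3] at h hfar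
    exact Or.inl ⟨not_le.1 h1, h, hfar⟩

section StepSize

variable {κ : Type*} [Fintype κ]

/-- The extrapolation parameter at the point `X` in the direction `W`. -/
noncomputable def stepSize (p q ρ T : ℝ) (X W : κ → ℝ) : ℝ :=
  1 / max T ((∑ i, |(|W i| / room p ρ (X i) (W i))| ^ q) ^ (1 / q))

variable {p q ρ T : ℝ} {X W : κ → ℝ}

theorem stepSize_pos (hT : 0 < T) : 0 < stepSize p q ρ T X W :=
  one_div_pos.2 (lt_max_of_lt_left hT)

theorem stepSize_le (hT : 0 < T) : stepSize p q ρ T X W ≤ 1 / T :=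
  one_div_le_one_div_of_le hT (le_max_left _ _)

theorem abs_le_sum_rpow (hq : 0 < q) (a : κ → ℝ) (i : κ) :
    |a i| ≤ (∑ i, |a i| ^ q) ^ (1 / q) := by
  have h1 : |a i| ^ q ≤ ∑ i, |a i| ^ q :=
    Finset.single_le_sum (f := fun i => |a i| ^ q)
      (fun j _ => Real.rpow_nonneg (abs_nonneg _) _) (Finset.mem_univ i)
  calc |a i| = (|a i| ^ q) ^ (1 / q) := by
        rw [← Real.rpow_mul (abs_nonneg _), mul_one_div_cancel hq.ne', Real.rpow_one]
    _ ≤ _ := Real.rpow_le_rpow (Real.rpow_nonneg (abs_nonneg _) _) h1 (by positivity)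

theorem stepSize_mul_le (hp : 2 ≤ p) (hρ : 0 < ρ) (hq : 0 < q) (hT : 0 < T) (i : κ) :
    stepSize p q ρ T X W * |W i| ≤ room p ρ (X i) (W i) := by
  have hr := room_pos hp hρ (X i) (W i)
  have h1 := abs_le_sum_rpow hq (fun i => |W i| / room p ρ (X i) (W i)) i
  rw [abs_of_nonneg (by positivity : 0 ≤ |W i| / room p ρ (X i) (W i))] at h1
  have h2 := h1.trans (le_max_right T _)
  unfold stepSize
  have h3 : 0 < max T ((∑ i, |(|W i| / room p ρ (X i) (W i))| ^ q) ^ (1 / q)) :=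
    lt_max_of_lt_left hT
  rw [div_le_iff₀ hr] at h2
  rw [one_div, inv_mul_le_iff₀ h3]
  exact h2

theorem stepSize_stable (hp : 2 ≤ p) (hρ : 0 < ρ) (hq : 0 < q) (hT : 0 < T) (i : κ) :
    StableMove p ρ (X i) (X i + stepSize p q ρ T X W * W i) :=
  stableMove_of_mul_abs_le hp hρ (stepSize_pos hT).le (stepSize_mul_le hp hρ hq hT i)

/-- The instructions include no maximum over the coordinates of a vector, so `stepSize` uses a
`q`-norm instead. With `q = 4 p m` it exceeds the maximum at most by a factor `m ^ (1/q)`, and the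
largest coordinate still uses the fraction `1 - 1/(4p)` of its room. -/
theorem exists_tight (hp : 2 ≤ p) (hρ : 0 < ρ) (hT : 0 < T)
    (hq : q = 4 * p * Fintype.card κ) (h0 : 0 < Fintype.card κ)
    (hlt : stepSize p q ρ T X W < 1 / T) :
    ∃ i, TightMove p ρ (X i) (X i + stepSize p q ρ T X W * W i) := by
  have hp0 : 0 < p := by linarith
  have hm : (0 : ℝ) < Fintype.card κ := by exact_mod_cast h0
  have hq0 : 0 < q := by rw [hq]; positivity
  set θ := stepSize p q ρ T X W with hθ
  set a : κ → ℝ := fun i => |W i| / room p ρ (X i) (W i) with ha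
  have ha0 : ∀ i, 0 ≤ a i := fun i => div_nonneg (abs_nonneg _) (room_pos hp hρ _ _).le
  set S := ∑ i, |a i| ^ q with hS
  have hS0 : 0 ≤ S := Finset.sum_nonneg fun i _ => Real.rpow_nonneg (abs_nonneg _) _
  have hTS : T < S ^ (1 / q) := by
    by_contra hc
    push Not at hc
    have : θ = 1 / T := by
      rw [hθ]; unfold stepSize; rw [max_eq_left]; exact hc
    linarith
  have hθS : θ = 1 / S ^ (1 / q) := by
    rw [hθ]; unfold stepSize; rw [max_eq_right]; exact hTS.le
  have hSpos : 0 < S ^ (1 / q) := hT.trans hTS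
  have hθ0 : 0 < θ := by rw [hθS]; positivity
  have : Nonempty κ := Fintype.card_pos_iff.1 h0
  obtain ⟨i, -, hi⟩ := Finset.exists_max_image Finset.univ (fun i => |a i| ^ q)
    Finset.univ_nonempty
  have hsum : S ≤ Fintype.card κ * |a i| ^ q := by
    have := Finset.sum_le_card_nsmul Finset.univ (fun i => |a i| ^ q) (|a i| ^ q)
      (fun j hj => hi j hj)
    simpa [nsmul_eq_mul] using this
  have hroot : S ^ (1 / q) ≤ (Fintype.card κ : ℝ) ^ (1 / q) * a i := by
    have h1 := Real.rpow_le_rpow hS0 hsum (by positivity : 0 ≤ 1 / q)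
    rwa [Real.mul_rpow hm.le (Real.rpow_nonneg (abs_nonneg _) _), ← Real.rpow_mul (abs_nonneg _),
      mul_one_div_cancel hq0.ne', Real.rpow_one, abs_of_nonneg (ha0 i)] at h1
  -- From `m ≤ e ^ m` one gets `m ^ (1/q) ≤ e ^ (1/(4p))`.
  have hexp : (1 - 1 / (4 * p)) * (Fintype.card κ : ℝ) ^ (1 / q) ≤ 1 := by
    have h1 : (Fintype.card κ : ℝ) ≤ Real.exp (Fintype.card κ) := by
      have := Real.add_one_le_exp (Fintype.card κ : ℝ); linarith
    have h2 := Real.rpow_le_rpow hm.le h1 (by positivity : 0 ≤ 1 / q)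
    have e : (Fintype.card κ : ℝ) * (1 / q) = 1 / (4 * p) := by
      rw [hq]; field_simp
    rw [← Real.exp_mul, e] at h2
    have h3 := Real.one_sub_le_exp_neg (1 / (4 * p))
    have h4 : 0 ≤ (Fintype.card κ : ℝ) ^ (1 / q) := by positivity
    calc (1 - 1 / (4 * p)) * (Fintype.card κ : ℝ) ^ (1 / q)
        ≤ Real.exp (-(1 / (4 * p))) * Real.exp (1 / (4 * p)) := by gcongr
      _ = 1 := by rw [← Real.exp_add]; simp
  have hai : 1 - 1 / (4 * p) ≤ θ * a i := by
    rw [hθS, div_mul_eq_mul_div, one_mul, le_div_iff₀ hSpos]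
    have : 0 ≤ 1 - 1 / (4 * p) := by
      have : 1 / (4 * p) ≤ 1 := by rw [div_le_one (by positivity)]; linarith
      linarith
    calc (1 - 1 / (4 * p)) * S ^ (1 / q)
        ≤ (1 - 1 / (4 * p)) * ((Fintype.card κ : ℝ) ^ (1 / q) * a i) := by gcongr
      _ = (1 - 1 / (4 * p)) * (Fintype.card κ : ℝ) ^ (1 / q) * a i := by ring
      _ ≤ 1 * a i := by gcongr; exact ha0 i
      _ = a i := one_mul _
  refine ⟨i, tightMove_of_le_mul_abs hp hρ hθ0.le (stepSize_mul_le hp hρ hq0 hT i) ?_⟩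
  have hr := room_pos hp hρ (X i) (W i)
  calc (1 - 1 / (4 * p)) * room p ρ (X i) (W i) ≤ θ * a i * room p ρ (X i) (W i) := by gcongr
    _ = θ * |W i| := by simp only [ha]; field_simp

/-- Every room is at least `ρ / p`, and the `q`-norm is at most the 2-norm. -/
theorem le_stepSize (hp : 2 ≤ p) (hρ : 0 < ρ) (hq : 2 ≤ q) {B : ℝ} (hB : 0 ≤ B) (hT : 0 < T)
    (hW : ∑ i, W i ^ 2 ≤ B ^ 2) : 1 / max T (p * B / ρ) ≤ stepSize p q ρ T X W := by
  have hp0 : 0 < p := by linarith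
  have hq0 : 0 < q := by linarith
  unfold stepSize
  refine one_div_le_one_div_of_le (lt_max_of_lt_left hT) (max_le_max le_rfl ?_)
  set D := p * B / ρ with hD
  have hD0 : 0 ≤ D := by positivity
  set a : κ → ℝ := fun i => |W i| / room p ρ (X i) (W i) with ha
  have ha1 : ∀ i, |a i| ≤ p / ρ * |W i| := fun i => by
    simp only [ha]
    rw [abs_of_nonneg (div_nonneg (abs_nonneg _) (room_pos hp hρ _ _).le),
      div_le_iff₀ (room_pos hp hρ _ _)]
    have := le_room (ρ := ρ) hp (X i) (W i)
    calc |W i| = p / ρ * |W i| * (ρ / p) := by field_simp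
      _ ≤ _ := by gcongr
  have hsq : ∑ i, |a i| ^ 2 ≤ D ^ 2 := by
    calc ∑ i, |a i| ^ 2 ≤ ∑ i, (p / ρ * |W i|) ^ 2 :=
          Finset.sum_le_sum fun i _ => by gcongr; exact ha1 i
      _ = (p / ρ) ^ 2 * ∑ i, W i ^ 2 := by
          rw [Finset.mul_sum]
          exact Finset.sum_congr rfl fun i _ => by rw [mul_pow, sq_abs]
      _ ≤ (p / ρ) ^ 2 * B ^ 2 := by gcongr
      _ = D ^ 2 := by rw [hD]; ring
  have hai : ∀ i, |a i| ≤ D := fun i => by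
    have h1 : |a i| ^ 2 ≤ ∑ i, |a i| ^ 2 :=
      Finset.single_le_sum (f := fun i => |a i| ^ 2) (fun j _ => sq_nonneg _) (Finset.mem_univ i)
    exact le_of_sq_le_sq (h1.trans hsq) hD0
  have hpow : ∑ i, |a i| ^ q ≤ D ^ q := by
    calc ∑ i, |a i| ^ q ≤ ∑ i, D ^ (q - 2) * |a i| ^ 2 := by
          refine Finset.sum_le_sum fun i _ => ?_
          have e : |a i| ^ q = |a i| ^ (q - 2) * |a i| ^ 2 := by
            rw [← Real.rpow_natCast (|a i|) 2, ← Real.rpow_add_of_nonneg (abs_nonneg _)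
              (by linarith) (by norm_num)]
            congr 1; push_cast; ring
          rw [e]
          have := Real.rpow_le_rpow (abs_nonneg _) (hai i) (by linarith : 0 ≤ q - 2)
          gcongr
      _ = D ^ (q - 2) * ∑ i, |a i| ^ 2 := by rw [Finset.mul_sum]
      _ ≤ D ^ (q - 2) * D ^ 2 := by
          have := Real.rpow_nonneg hD0 (q - 2)
          gcongr
      _ = D ^ q := by
          rw [← Real.rpow_natCast D 2, ← Real.rpow_add_of_nonneg hD0 (by linarith) (by norm_num)]
          congr 1; push_cast; ring
  have h0 : 0 ≤ ∑ i, |a i| ^ q := Finset.sum_nonneg fun i _ => Real.rpow_nonneg (abs_nonneg _) _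
  calc (∑ i, |a i| ^ q) ^ (1 / q) ≤ (D ^ q) ^ (1 / q) :=
        Real.rpow_le_rpow h0 hpow (by positivity)
    _ = D := by rw [← Real.rpow_mul hD0, mul_one_div_cancel hq0.ne', Real.rpow_one]

end StepSize

end LpRegression

/-! ### Iterates of an epoch and their invariant -/

namespace LpRegression

/-- The points that an epoch of the algorithm keeps, and its extrapolation parameter. -/
structure Iterate (E : Type*) where
  best : E
  x : E
  v : E
  s : E
  θ : ℝ

namespace Iterate

variable {E : Type*} [AddCommGroup E] [Module ℝ E]

/-- The extrapolated point. -/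
def y (I : Iterate E) : E := I.x + I.θ • (I.v - I.x)

end Iterate

namespace Objective

variable {E ι κ : Type*} [AddCommGroup E] [Module ℝ E] [Fintype ι] [Fintype κ]
variable (F : Objective E ι κ)

/-- The Euclidean norm of `N w`. -/
noncomputable def nrm (w : E) : ℝ := ‖(WithLp.toLp 2 (F.N w) : EuclideanSpace ℝ κ)‖

theorem nrm_nonneg (w : E) : 0 ≤ F.nrm w := norm_nonneg _

theorem nrm_sq (w : E) : F.nrm w ^ 2 = ∑ i, F.N w i ^ 2 := by
  simp [nrm, EuclideanSpace.norm_sq_eq]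

theorem nrm_add_le (a b : E) : F.nrm (a + b) ≤ F.nrm a + F.nrm b := by
  unfold nrm
  rw [map_add, WithLp.toLp_add]
  exact norm_add_le _ _

theorem nrm_smul (t : ℝ) (a : E) : F.nrm (t • a) = |t| * F.nrm a := by
  unfold nrm
  rw [map_smul, WithLp.toLp_smul, norm_smul, Real.norm_eq_abs]

theorem nrm_neg (a : E) : F.nrm (-a) = F.nrm a := by
  rw [← neg_one_smul ℝ, nrm_smul]; simp

/-- `w'` is the better one of the points `w` and `z`. -/
def Better (w z w' : E) : Prop :=
  F.val w' ≤ F.val w ∧ F.val w' ≤ F.val z ∧ (w' = w ∨ w' = z)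

/-- One iteration of an epoch: a Newton step, and an accelerated step once the Newton steps have
converged. -/
def Tick (V : Submodule ℝ E) (ρ T q : ℝ) (I J : Iterate E) : Prop :=
  ∃ d, F.IsNewton V (lam F.p ρ) (F.N I.y) I.s d ∧
    ((ρ ^ F.p < F.energy (lam F.p ρ) I.s d ∧ J.x = I.x ∧ J.v = I.v ∧ J.θ = I.θ ∧
        J.s = I.s + √(ρ ^ F.p / F.energy (lam F.p ρ) I.s d) • d ∧ F.Better I.best J.s J.best) ∨
      (F.energy (lam F.p ρ) I.s d ≤ ρ ^ F.p ∧ J.x = I.s + d ∧ J.v - I.v ∈ V ∧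
        (∀ ξ ∈ V, I.θ * F.curvB J.x (J.v - J.x) ξ
            + 2 * lam F.p ρ / T ^ 2 * ∑ i, F.N (J.v - I.v) i * F.N ξ i
          = I.θ * ∑ i, (lam F.p ρ * (F.N J.x i - F.N I.y i) - F.residual I.s d i) * F.N ξ i) ∧
        J.θ = stepSize F.p q ρ T (F.N J.x) (F.N (J.v - J.x)) ∧ J.s = J.y ∧
        F.Better I.best J.x J.best))

/-- The iterates of an epoch after `n` iterations. -/
inductive EpochReach (V : Submodule ℝ E) (ρ T q : ℝ) (x₀ : E) : ℕ → Iterate E → Prop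
  | start : EpochReach V ρ T q x₀ 0 ⟨x₀, x₀, x₀, x₀, 1 / T⟩
  | tick {n : ℕ} {I J : Iterate E} : EpochReach V ρ T q x₀ n I → F.Tick V ρ T q I J →
      EpochReach V ρ T q x₀ (n + 1) J

section Epoch

variable {V : Submodule ℝ E} {ρ T q δ τ : ℝ} {x₀ u : E} {b : ℝ}

theorem EpochReach.mem {n : ℕ} {I : Iterate E} (h : F.EpochReach V ρ T q x₀ n I) :
    I.best - x₀ ∈ V ∧ I.x - x₀ ∈ V ∧ I.v - x₀ ∈ V ∧ I.s - x₀ ∈ V := by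
  induction h with
  | start => simp
  | tick _ ht ih =>
    rename_i n I J _
    obtain ⟨hb, hx, hv, hs⟩ := ih
    obtain ⟨d, hd, ⟨-, h1, h2, -, h3, -, -, h4⟩ | ⟨-, h1, h2, -, -, h3, -, -, h4⟩⟩ := ht
    · have hs' : J.s - x₀ ∈ V := by
        rw [h3, add_sub_right_comm]
        exact V.add_mem hs (V.smul_mem _ hd.1)
      refine ⟨?_, by rwa [h1], by rwa [h2], hs'⟩
      rcases h4 with h4 | h4 <;> rwa [h4]
    · have hx' : J.x - x₀ ∈ V := by
        rw [h1, add_sub_right_comm]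
        exact V.add_mem hs hd.1
      have hv' : J.v - x₀ ∈ V := by
        have := V.add_mem h2 hv
        rwa [sub_add_sub_cancel] at this
      refine ⟨?_, hx', hv', ?_⟩
      · rcases h4 with h4 | h4 <;> rwa [h4]
      · have : J.s - x₀ = (J.x - x₀) + J.θ • ((J.v - x₀) - (J.x - x₀)) := by
          rw [h3, Iterate.y, sub_sub_sub_cancel_right]; abel
        rw [this]
        exact V.add_mem hx' (V.smul_mem _ (V.sub_mem hv' hx'))

/-- The potential of an iterate with respect to the point `u` and the value `b`. -/
noncomputable def potential (ρ T b g : ℝ) (u : E) (I : Iterate E) : ℝ :=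
  F.val I.x - b + 2 * lam F.p ρ / T ^ 2 / 2 * ∑ i, F.N (I.v - u) i ^ 2
    + g / 2 * F.curv I.x (I.v - I.x)

/-- The radius of the iterates. -/
noncomputable def spread (p ρ T δ : ℝ) : ℝ := T * √(2 * δ / lam p ρ)

/-- What is known of the iterates, after `k` iterations up to the last accelerated step and `j`
Newton steps since then, if no point of value at most `b + δ / 2` was found. -/
structure Invariant (V : Submodule ℝ E) (ρ T δ b : ℝ) (u : E) (k j : ℕ) (g : ℝ)
    (I : Iterate E) : Prop where
  pot : F.potential ρ T b g u I ≤ 2 * δ - k * (δ / (2 * T))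
  val_x : δ / 2 ≤ F.val I.x - b
  dist : F.nrm (I.x - u) ≤ spread F.p ρ T δ * (1 + k / (2 * T)
    + 2 * (2 * δ - F.potential ρ T b g u I) / (δ * T))
  θ_le : I.θ ≤ 1 / T
  θ_pos : 0 < I.θ
  le_θ : F.p / T ^ 2 ≤ 2 * I.θ
  θ_sq : F.p * I.θ ^ 2 ≤ 2 * g
  stable : ∀ i, StableMove F.p ρ (F.N I.x i) (F.N I.y i)
  tight : I.θ < 1 / T → ∃ i, TightMove F.p ρ (F.N I.x i) (F.N I.y i)
  grad : F.grad I.x (I.v - I.x) ^ 2 ≤ 64 * lam F.p ρ * δ * ∑ i, F.N (I.v - I.x) i ^ 2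
  prox : F.prox (lam F.p ρ) (F.N I.y) I.s ≤ F.prox (lam F.p ρ) (F.N I.y) I.y - j * (ρ ^ F.p / 4)
  val_s : j = 0 ∨ δ / 2 ≤ F.val I.s - b

variable {F}

theorem spread_sq {p : ℝ} (hp : 2 ≤ p) (hρ : 0 < ρ) (hδ : 0 < δ) :
    spread p ρ T δ ^ 2 = 2 * δ * T ^ 2 / lam p ρ := by
  have := lam_pos hp hρ
  unfold spread
  rw [mul_pow, Real.sq_sqrt (by positivity)]
  ring

theorem spread_pos {p : ℝ} (hp : 2 ≤ p) (hρ : 0 < ρ) (hδ : 0 < δ) (hT : 0 < T) :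
    0 < spread p ρ T δ := by
  have := lam_pos hp hρ
  unfold spread
  positivity

variable {k j : ℕ} {g : ℝ} {I : Iterate E}

/-- The drop of `δ / (2T)` per iteration, from `2 δ` to no less than `δ / 2`, gives `k ≤ 3 T`. The
distance term of the potential keeps `v` within `spread` of `u`, and `k ≤ 3 T` turns the distance
bound for `x` into `(1 + 3/2 + 1/2) * spread`. -/
theorem potential_bounds (hp : 2 ≤ F.p) (hρ : 0 < ρ) (hδ : 0 < δ) (hT : 4000 ≤ T) (hg0 : 0 ≤ g)
    (hpot : F.potential ρ T b g u I ≤ 2 * δ - k * (δ / (2 * T)))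
    (hx : δ / 2 ≤ F.val I.x - b)
    (hdist : F.nrm (I.x - u) ≤ spread F.p ρ T δ * (1 + k / (2 * T)
      + 2 * (2 * δ - F.potential ρ T b g u I) / (δ * T))) :
    δ / 2 ≤ F.potential ρ T b g u I ∧ F.potential ρ T b g u I ≤ 2 * δ ∧ (k : ℝ) ≤ 3 * T ∧
    F.nrm (I.v - u) ≤ spread F.p ρ T δ ∧
    F.nrm (I.v - I.x) ≤ 4 * spread F.p ρ T δ ∧ g / 2 * F.curv I.x (I.v - I.x) ≤ 2 * δ := by
  have hl := lam_pos hp hρ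
  have hT0 : 0 < T := by linarith
  have hp0 : 0 < F.p := by linarith
  have hS := spread_pos hp hρ hδ hT0
  have hN0 : 0 ≤ 2 * lam F.p ρ / T ^ 2 / 2 * ∑ i, F.N (I.v - u) i ^ 2 :=
    mul_nonneg (by positivity) (Finset.sum_nonneg fun i _ => sq_nonneg _)
  have hc0 : 0 ≤ g / 2 * F.curv I.x (I.v - I.x) := mul_nonneg (by positivity) (F.curv_nonneg hp _ _)
  have hk0 : 0 ≤ k * (δ / (2 * T)) := by positivity
  have hdef : F.potential ρ T b g u I = F.val I.x - b
    + 2 * lam F.p ρ / T ^ 2 / 2 * ∑ i, F.N (I.v - u) i ^ 2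
    + g / 2 * F.curv I.x (I.v - I.x) := rfl
  have hP1 : δ / 2 ≤ F.potential ρ T b g u I := by linarith
  have hP2 : F.potential ρ T b g u I ≤ 2 * δ := by linarith
  have hk : (k : ℝ) ≤ 3 * T := by
    have : k * (δ / (2 * T)) ≤ 3 * T * (δ / (2 * T)) := by
      have : 3 * T * (δ / (2 * T)) = 3 / 2 * δ := by field_simp
      linarith
    exact le_of_mul_le_mul_right this (by positivity)
  have hv : F.nrm (I.v - u) ≤ spread F.p ρ T δ := by
    refine le_of_sq_le_sq ?_ hS.le
    rw [spread_sq hp hρ hδ, nrm_sq, le_div_iff₀ hl]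
    have h1 : 2 * lam F.p ρ / T ^ 2 / 2 * ∑ i, F.N (I.v - u) i ^ 2 ≤ 2 * δ := by linarith
    have h2 : (∑ i, F.N (I.v - u) i ^ 2) * lam F.p ρ
      = 2 * lam F.p ρ / T ^ 2 / 2 * (∑ i, F.N (I.v - u) i ^ 2) * T ^ 2 := by field_simp
    rw [h2]
    gcongr
  have hx3 : F.nrm (I.x - u) ≤ 3 * spread F.p ρ T δ := by
    refine hdist.trans ?_
    rw [mul_comm]
    gcongr
    have h1 : k / (2 * T) ≤ 3 / 2 := by rw [div_le_iff₀ (by positivity)]; linarith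
    have h2 : 2 * (2 * δ - F.potential ρ T b g u I) / (δ * T) ≤ 1 / 2 := by
      rw [div_le_iff₀ (by positivity)]
      have : δ * 4000 ≤ δ * T := by gcongr
      linarith
    linarith
  refine ⟨hP1, hP2, hk, hv, ?_, by linarith⟩
  have h1 := F.nrm_add_le (I.v - u) (-(I.x - u))
  rw [F.nrm_neg, ← sub_eq_add_neg, sub_sub_sub_cancel_right] at h1
  linarith

namespace Invariant

theorem g_nonneg (h : F.Invariant V ρ T δ b u k j g I) (hp : 2 ≤ F.p) : 0 ≤ g := by
  have : 0 ≤ F.p * I.θ ^ 2 := mul_nonneg (by linarith) (sq_nonneg _)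
  linarith [h.θ_sq]

theorem bounds (h : F.Invariant V ρ T δ b u k j g I) (hp : 2 ≤ F.p) (hρ : 0 < ρ) (hδ : 0 < δ)
    (hT : 4000 ≤ T) :
    δ / 2 ≤ F.potential ρ T b g u I ∧ F.potential ρ T b g u I ≤ 2 * δ ∧ (k : ℝ) ≤ 3 * T ∧
    F.nrm (I.v - u) ≤ spread F.p ρ T δ ∧
    F.nrm (I.v - I.x) ≤ 4 * spread F.p ρ T δ ∧ g / 2 * F.curv I.x (I.v - I.x) ≤ 2 * δ :=
  potential_bounds hp hρ hδ hT (h.g_nonneg hp) h.pot h.val_x h.dist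

/-- There are few Newton steps after the last accelerated step. -/
theorem newton_count_le (h : F.Invariant V ρ T δ b u k j g I) (hp : 2 ≤ F.p) (hρ : 0 < ρ)
    (hδ : 0 < δ) (hT : 4000 ≤ T) : j * (ρ ^ F.p / 4) ≤ 210 * δ := by
  obtain ⟨-, hP2, -, -, hvx, hgc⟩ := h.bounds hp hρ hδ hT
  have hl := lam_pos hp hρ
  have hT0 : 0 < T := by linarith
  have hp0 : 0 < F.p := by linarith
  have hS := spread_pos hp hρ hδ hT0
  have hS2 := spread_sq (T := T) hp hρ hδ
  rcases h.val_s with h0 | hs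
  · rw [h0]; simp; linarith
  have hprox := h.prox
  simp only [Objective.prox, sub_self] at hprox
  have hsq : 0 ≤ lam F.p ρ / 2 * ∑ i, (F.N I.s i - F.N I.y i) ^ 2 :=
    mul_nonneg (by positivity) (Finset.sum_nonneg fun i _ => sq_nonneg _)
  norm_num at hprox
  have hval := F.val_eq I.y I.x
  -- The objective at `y` exceeds `b` by at most `210 δ`: `2 δ` from `x`, `48 δ` from the gradient
  -- term, and `32 δ + 128 δ` from the divergence. The Newton steps descend from there and never
  -- pass below `b`.
  have hdiv : F.div I.y I.x ≤ _ := F.div_extrapolation_le hp hρ h.stable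
  have hN : ∑ i, F.N (I.v - I.x) i ^ 2 ≤ 16 * (2 * δ * T ^ 2 / lam F.p ρ) := by
    rw [← nrm_sq, ← hS2]
    calc F.nrm (I.v - I.x) ^ 2 ≤ (4 * spread F.p ρ T δ) ^ 2 := by
          have := F.nrm_nonneg (I.v - I.x); gcongr
      _ = _ := by ring
  have hθ0 := h.θ_pos.le
  have hθT : I.θ * T ≤ 1 := by have := h.θ_le; rwa [le_div_iff₀ hT0] at this
  have hθ2 : I.θ ^ 2 * T ^ 2 ≤ 1 := by
    rw [← mul_pow]; exact pow_le_one₀ (by positivity) hθT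
  have h1 : lam F.p ρ * (I.θ ^ 2 * ∑ i, F.N (I.v - I.x) i ^ 2) ≤ 32 * δ := by
    calc lam F.p ρ * (I.θ ^ 2 * ∑ i, F.N (I.v - I.x) i ^ 2)
        ≤ lam F.p ρ * (I.θ ^ 2 * (16 * (2 * δ * T ^ 2 / lam F.p ρ))) := by gcongr
      _ = 32 * δ * (I.θ ^ 2 * T ^ 2) := by field_simp; ring
      _ ≤ 32 * δ * 1 := by gcongr
      _ = 32 * δ := by ring
  have h2 : F.p * I.θ ^ 2 * F.curv I.x (I.v - I.x) ≤ 2 * g * F.curv I.x (I.v - I.x) :=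
    mul_le_mul_of_nonneg_right h.θ_sq (F.curv_nonneg hp _ _)
  have h3 : F.grad I.x (I.v - I.x) ≤ 48 * δ * T := by
    refine le_of_abs_le (abs_le_of_sq_le_sq ?_ (by positivity))
    refine h.grad.trans ?_
    calc 64 * lam F.p ρ * δ * ∑ i, F.N (I.v - I.x) i ^ 2
        ≤ 64 * lam F.p ρ * δ * (16 * (2 * δ * T ^ 2 / lam F.p ρ)) := by gcongr
      _ = 2048 * (δ ^ 2 * T ^ 2) := by field_simp; ring
      _ ≤ (48 * δ * T) ^ 2 := by
        have : 0 ≤ δ ^ 2 * T ^ 2 := by positivity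
        have e : (48 * δ * T) ^ 2 = 2304 * (δ ^ 2 * T ^ 2) := by ring
        linarith
  have h4 : F.grad I.x (I.y - I.x) = I.θ * F.grad I.x (I.v - I.x) := by
    rw [Iterate.y, add_sub_cancel_left]
    simp only [Objective.grad, map_smul, Pi.smul_apply, smul_eq_mul, mul_add, Finset.mul_sum]
    congr 1
    · congr 1
      exact Finset.sum_congr rfl fun i _ => by ring
    · exact Finset.sum_congr rfl fun i _ => by ring
  have h5 : I.θ * F.grad I.x (I.v - I.x) ≤ 48 * δ := by
    calc I.θ * F.grad I.x (I.v - I.x) ≤ I.θ * (48 * δ * T) := by gcongr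
      _ = 48 * δ * (I.θ * T) := by ring
      _ ≤ 48 * δ * 1 := by gcongr
      _ = 48 * δ := by ring
  have h6 : F.val I.x - b ≤ 2 * δ := by
    have hN0 : 0 ≤ 2 * lam F.p ρ / T ^ 2 / 2 * ∑ i, F.N (I.v - u) i ^ 2 :=
      mul_nonneg (by positivity) (Finset.sum_nonneg fun i _ => sq_nonneg _)
    have hc0 : 0 ≤ g / 2 * F.curv I.x (I.v - I.x) := by
      have := F.curv_nonneg hp I.x (I.v - I.x)
      have : 0 ≤ F.p * I.θ ^ 2 := by positivity
      have : 0 ≤ g := by linarith [h.θ_sq]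
      positivity
    unfold potential at hP2
    linarith
  have e : F.N I.y = F.N (I.x + I.θ • (I.v - I.x)) := rfl
  linarith

end Invariant

end Epoch

end Objective
end LpRegression

/-! ### The invariant is preserved -/

namespace LpRegression
namespace Objective

variable {E ι κ : Type*} [AddCommGroup E] [Module ℝ E] [Fintype ι] [Fintype κ]
variable {F : Objective E ι κ}

variable {V : Submodule ℝ E} {ρ T q δ τ : ℝ} {x₀ u : E} {b : ℝ}
variable {k j : ℕ} {g : ℝ} {I J : Iterate E}

theorem curv_zero (z : E) : F.curv z 0 = 0 := by simp [curv]

theorem grad_zero (z : E) : F.grad z 0 = 0 := by simp [grad]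

/-- This makes the lower bound of `le_stepSize`, for a direction of length `4 * spread`, at least `p
/ (2 T²)`. -/
theorem spread_le (hp : 2 ≤ F.p) (hρ : 0 < ρ) (hδ : 0 < δ) (hτ : 1 ≤ τ)
    (hT : T = 2000 * (F.p * τ)) (hu : ρ ^ F.p * τ = δ) :
    2 * F.p ^ 2 * spread F.p ρ T δ ≤ T ^ 2 * ρ := by
  have hp0 : 0 < F.p := by linarith
  have hl := lam_pos hp hρ
  have hr := Real.rpow_pos_of_pos hρ F.p
  refine le_of_sq_le_sq ?_ (by positivity)
  rw [mul_pow, spread_sq hp hρ hδ, ← mul_div_assoc, div_le_iff₀ hl]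
  have e1 : (T ^ 2 * ρ) ^ 2 * lam F.p ρ = T ^ 2 * (T ^ 2 * (10000 * F.p ^ 2 * ρ ^ F.p)) := by
    rw [← lam_mul_sq hρ]; ring
  have hT2 : F.p ^ 2 * τ ≤ T ^ 2 := by
    rw [hT]
    have : τ * 1 ≤ τ * τ := by gcongr
    nlinarith [sq_nonneg F.p]
  rw [e1, ← hu]
  have h1 : 0 ≤ T ^ 2 * (F.p ^ 2 * ρ ^ F.p) := by positivity
  have h2 : T ^ 2 * (F.p ^ 2 * ρ ^ F.p) * (F.p ^ 2 * τ) ≤ T ^ 2 * (F.p ^ 2 * ρ ^ F.p) * T ^ 2 := by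
    gcongr
  nlinarith [h1, mul_nonneg h1 (by positivity : 0 ≤ F.p ^ 2 * τ)]

theorem invariant_start (hp : 2 ≤ F.p) (hρ : 0 < ρ) (hδ : 0 < δ) (hT : 4000 ≤ T)
    (hpT : F.p ≤ T) (hx₀ : F.val x₀ ≤ b + δ)
    (hR : lam F.p ρ / T ^ 2 * ∑ i, F.N (x₀ - u) i ^ 2 ≤ δ)
    (h : δ / 2 ≤ F.val x₀ - b) :
    F.Invariant V ρ T δ b u 0 0 (1 / T) ⟨x₀, x₀, x₀, x₀, 1 / T⟩ := by
  have hT0 : 0 < T := by linarith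
  have hl := lam_pos hp hρ
  have hpT2 : F.p / T ^ 2 ≤ 1 / T := by
    rw [div_le_div_iff₀ (by positivity) hT0]; nlinarith
  have hT1 : 0 < 1 / T := by positivity
  have hy : (⟨x₀, x₀, x₀, x₀, 1 / T⟩ : Iterate E).y = x₀ := by simp [Iterate.y]
  have hpot : F.potential ρ T b (1 / T) u ⟨x₀, x₀, x₀, x₀, 1 / T⟩
      = F.val x₀ - b + lam F.p ρ / T ^ 2 * ∑ i, F.N (x₀ - u) i ^ 2 := by
    simp only [potential, sub_self, curv_zero]; ring
  have hpot2 : F.potential ρ T b (1 / T) u ⟨x₀, x₀, x₀, x₀, 1 / T⟩ ≤ 2 * δ := by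
    rw [hpot]; linarith
  constructor
  · simpa using hpot2
  · exact h
  · have h1 : F.nrm (x₀ - u) ≤ spread F.p ρ T δ := by
      refine le_of_sq_le_sq ?_ (spread_pos hp hρ hδ hT0).le
      rw [spread_sq hp hρ hδ, nrm_sq, le_div_iff₀ hl]
      have : (∑ i, F.N (x₀ - u) i ^ 2) * lam F.p ρ
        = T ^ 2 * (lam F.p ρ / T ^ 2 * ∑ i, F.N (x₀ - u) i ^ 2) := by field_simp
      rw [this]
      nlinarith [mul_le_mul_of_nonneg_left hR (sq_nonneg T), mul_pos hδ (pow_pos hT0 2)]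
    refine h1.trans (le_mul_of_one_le_right (spread_pos hp hρ hδ hT0).le ?_)
    have : 0 ≤ 2 * (2 * δ - F.potential ρ T b (1 / T) u ⟨x₀, x₀, x₀, x₀, 1 / T⟩) / (δ * T) :=
      _root_.div_nonneg (by linarith) (by positivity)
    simp only [Nat.cast_zero, zero_div, add_zero]
    linarith
  · exact le_rfl
  · exact hT1
  · change F.p / T ^ 2 ≤ 2 * (1 / T); linarith
  · change F.p * (1 / T) ^ 2 ≤ 2 * (1 / T)
    have : F.p * (1 / T) ^ 2 = F.p / T ^ 2 := by field_simp
    linarith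
  · intro i
    rw [hy]
    have : 0 < F.p := by linarith
    rcases le_or_gt |F.N x₀ i| ρ with h1 | h1
    · right
      refine ⟨h1, h1.trans (le_mul_of_one_le_left hρ.le ?_)⟩
      have : 0 ≤ 1 / F.p := by positivity
      linarith
    · left
      refine ⟨h1, ?_⟩
      simp only [sub_self, abs_zero]
      positivity
  · intro h1; exact absurd h1 (lt_irrefl _)
  · simp [grad_zero]
  · rw [hy]; simp
  · left; rfl

/-- Only the proximal objective changes: `x`, `v` and `θ` stay, so all other parts of the invariant
are inherited. -/
theorem Invariant.newton (h : F.Invariant V ρ T δ b u k j g I) (hp : 2 ≤ F.p) (hρ : 0 < ρ)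
    {d : E} (hd : F.IsNewton V (lam F.p ρ) (F.N I.y) I.s d)
    (hE : ρ ^ F.p < F.energy (lam F.p ρ) I.s d) (hx : J.x = I.x) (hv : J.v = I.v)
    (hθ : J.θ = I.θ) (hs : J.s = I.s + √(ρ ^ F.p / F.energy (lam F.p ρ) I.s d) • d)
    (hval : δ / 2 ≤ F.val J.s - b) : F.Invariant V ρ T δ b u k (j + 1) g J := by
  have hy : J.y = I.y := by simp only [Iterate.y, hx, hv, hθ]
  have hpot : F.potential ρ T b g u J = F.potential ρ T b g u I := by
    simp only [potential, hx, hv]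
  have hr := Real.rpow_pos_of_pos hρ F.p
  set En := F.energy (lam F.p ρ) I.s d with hEn
  have hEn0 : 0 < En := hr.trans hE
  set t := √(ρ ^ F.p / En) with ht
  have ht2 : t ^ 2 * En = ρ ^ F.p := by
    rw [ht, Real.sq_sqrt (by positivity)]; field_simp
  have ht0 : 0 ≤ t := Real.sqrt_nonneg _
  have ht1 : t ≤ 1 := by
    rw [ht, Real.sqrt_le_left (by norm_num), one_pow, div_le_one hEn0]
    exact hE.le
  have hdec := F.prox_newton_le hp hρ hd ht2.le
  rw [← hs] at hdec
  constructor
  · rw [hpot]; exact h.pot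
  · rw [hx]; exact h.val_x
  · rw [hpot, hx]; exact h.dist
  · rw [hθ]; exact h.θ_le
  · rw [hθ]; exact h.θ_pos
  · rw [hθ]; exact h.le_θ
  · rw [hθ]; exact h.θ_sq
  · rw [hy, hx]; exact h.stable
  · rw [hy, hx, hθ]; exact h.tight
  · rw [hx, hv]; exact h.grad
  · rw [hy]
    have h1 := h.prox
    -- The damping is chosen with `t² En = ρ ^ p` and `t ≤ 1`, hence the decrease is at least `(1 -
    -- 51/100) ρ ^ p`, more than `ρ ^ p / 4`.
    have h2 : t ^ 2 * En ≤ t * En := by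
      have : t ^ 2 ≤ t := by nlinarith
      gcongr
    push_cast
    linarith
  · right; exact hval

-- The accounting of an accelerated step. Its drop of the potential pays `δ / (2T)` for itself and
-- for each of the `j` Newton steps before it, so `k` advances by `j + 1`. The old `θ` becomes the
-- weight `g` of the curvature term. It is not too small for the next step because `θ ≥ p / (2 T²)`,
-- while the new `θ` is at most `1 / T`.
set_option maxHeartbeats 400000 in
theorem Invariant.accelerate (h : F.Invariant V ρ T δ b u k j g I) (hp : 2 ≤ F.p) (hρ : 0 < ρ)
    (hδ : 0 < δ) (hτ : 1 ≤ τ) (hT : T = 2000 * (F.p * τ)) (hu : ρ ^ F.p * τ = δ)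
    (hq : q = 4 * F.p * Fintype.card κ) (hκ : 0 < Fintype.card κ)
    (hxs : I.x - I.s ∈ V) (hvs : I.v - I.s ∈ V) (hus : u - I.s ∈ V) (hub : F.val u ≤ b)
    {d : E} (hd : F.IsNewton V (lam F.p ρ) (F.N I.y) I.s d)
    (hE : F.energy (lam F.p ρ) I.s d ≤ ρ ^ F.p) (hx : J.x = I.s + d) (hv : J.v - I.v ∈ V)
    (hopt : ∀ ξ ∈ V, I.θ * F.curvB J.x (J.v - J.x) ξ
            + 2 * lam F.p ρ / T ^ 2 * ∑ i, F.N (J.v - I.v) i * F.N ξ i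
          = I.θ * ∑ i, (lam F.p ρ * (F.N J.x i - F.N I.y i) - F.residual I.s d i) * F.N ξ i)
    (hθ : J.θ = stepSize F.p q ρ T (F.N J.x) (F.N (J.v - J.x))) (hs : J.s = J.y)
    (hval : δ / 2 ≤ F.val J.x - b) : F.Invariant V ρ T δ b u (k + j + 1) 0 I.θ J := by
  have hp0 : 0 < F.p := by linarith
  have hl := lam_pos hp hρ
  have hr := Real.rpow_pos_of_pos hρ F.p
  have hpτ : 2 * 1 ≤ F.p * τ := by gcongr
  have hT4 : 4000 ≤ T := by linarith
  have hT0 : 0 < T := by linarith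
  have hpT : F.p ≤ T := by
    have : F.p * 1 ≤ F.p * τ := by gcongr
    linarith
  have hm1 : (1 : ℝ) ≤ Fintype.card κ := by exact_mod_cast hκ
  have hq2 : 2 ≤ q := by
    have : 4 * F.p * 1 ≤ 4 * F.p * Fintype.card κ := by gcongr
    linarith
  have hS := spread_pos (T := T) hp hρ hδ hT0
  have hS2 := spread_sq (T := T) hp hρ hδ
  obtain ⟨-, hP2, -, hvu, -, -⟩ := h.bounds hp hρ hδ hT4
  have hθ0 := h.θ_pos
  have hθT : I.θ * T ≤ 1 := by have := h.θ_le; rwa [le_div_iff₀ hT0] at this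
  have hθ2 : I.θ ^ 2 * T ^ 2 ≤ 1 := by
    rw [← mul_pow]; exact pow_le_one₀ (by positivity) hθT
  have hθ1 : I.θ ≤ 1 / 2 := by
    refine h.θ_le.trans ?_
    rw [div_le_div_iff₀ hT0 (by norm_num)]; linarith
  have hvV : J.v - I.s ∈ V := by
    have := V.add_mem hv hvs
    rwa [sub_add_sub_cancel] at this
  have hθβ : 2 * lam F.p ρ * I.θ ^ 2 ≤ 2 * lam F.p ρ / T ^ 2 := by
    rw [le_div_iff₀ (by positivity)]
    nlinarith
  have ha : (0 : ℝ) ≤ j * (ρ ^ F.p / 4) := by positivity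
  rw [hx] at hopt
  obtain ⟨h1, h2, h3⟩ := F.macro_step hp hρ h.stable hd hE ha h.prox hxs hvs hus hvV hθ0.le hθ1
    hθβ hopt hub h.val_x h.θ_sq
  rw [← hx] at h1 h2 h3
  set G := F.gain (lam F.p ρ) I.θ I.x I.v J.x with hG
  have hG0 : 0 ≤ G := F.gain_nonneg hp hl.le _ _ _ _
  have hpotJ : F.potential ρ T b I.θ u J = F.val J.x - b
    + 2 * lam F.p ρ / T ^ 2 / 2 * ∑ i, F.N (J.v - u) i ^ 2
    + I.θ / 2 * F.curv J.x (J.v - J.x) := rfl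
  have hpotI : F.potential ρ T b g u I = F.val I.x - b
    + 2 * lam F.p ρ / T ^ 2 / 2 * ∑ i, F.N (I.v - u) i ^ 2
    + g / 2 * F.curv I.x (I.v - I.x) := rfl
  rw [← hpotJ, ← hpotI] at h1
  have hθδ : 0 ≤ I.θ * δ / 2 := by positivity
  -- The unit of payment, expressed by the energy threshold; this matches the gain `ρ ^ p / (32 p)`
  -- of a tight step.
  have hunit : δ / (2 * T) = ρ ^ F.p / (4000 * F.p) := by
    rw [← hu, hT]
    have : 0 < τ := by linarith
    field_simp; norm_num
  have hj : j * (δ / (2 * T)) ≤ 196 / 4000 * G := by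
    rw [hunit, ← mul_div_assoc, div_le_iff₀ (by positivity)]
    linarith
  -- Either `θ` is limited by a tight coordinate and the gain pays, or `θ = 1 / T` and `θ δ / 2` is
  -- exactly one unit.
  have hdrop : (j + 1) * (δ / (2 * T)) ≤ 1 / 8 * G + I.θ * δ / 2 := by
    rcases h.θ_le.lt_or_eq with hlt | heq
    · obtain ⟨i, hi⟩ := h.tight hlt
      have h4 := F.gain_tight hp hρ (z := J.x) hi
      rw [← hG] at h4
      have h5 : δ / (2 * T) ≤ 32 / 4000 * G := by
        have : δ / (2 * T) = 32 / 4000 * (ρ ^ F.p / (32 * F.p)) := by rw [hunit]; field_simp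
        rw [this]; gcongr
      linarith
    · have : I.θ * δ / 2 = δ / (2 * T) := by rw [heq]; field_simp
      linarith
  have hpot : F.potential ρ T b I.θ u J
      ≤ 2 * δ - ((k + j + 1 : ℕ) : ℝ) * (δ / (2 * T)) := by
    have := h.pot
    push_cast
    linarith
  have hGd : G ≤ 8 * (F.potential ρ T b g u I - F.potential ρ T b I.θ u J) := by linarith
  have hJ0 : 0 ≤ F.potential ρ T b I.θ u J := by
    have hN0 : 0 ≤ 2 * lam F.p ρ / T ^ 2 / 2 * ∑ i, F.N (J.v - u) i ^ 2 :=
      mul_nonneg (by positivity) (Finset.sum_nonneg fun i _ => sq_nonneg _)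
    have hc0 : 0 ≤ I.θ / 2 * F.curv J.x (J.v - J.x) :=
      mul_nonneg (by positivity) (F.curv_nonneg hp _ _)
    rw [hpotJ]
    linarith
  have hdist : F.nrm (J.x - u) ≤ spread F.p ρ T δ * (1 + ((k + j + 1 : ℕ) : ℝ) / (2 * T)
      + 2 * (2 * δ - F.potential ρ T b I.θ u J) / (δ * T)) := by
    set S := spread F.p ρ T δ with hSdef
    set A := S * (1 + k / (2 * T) + 2 * (2 * δ - F.potential ρ T b g u I) / (δ * T)) with hA
    have hAS : S ≤ A := by
      refine le_mul_of_one_le_right hS.le ?_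
      have : 0 ≤ 2 * (2 * δ - F.potential ρ T b g u I) / (δ * T) :=
        _root_.div_nonneg (by linarith) (by positivity)
      have : (0 : ℝ) ≤ k / (2 * T) := by positivity
      linarith
    set r := F.nrm (I.y - J.x) with hrdef
    -- The extrapolated point is a convex combination of `x` and `v`, both within the current bound,
    -- so the distance grows only by the proximal displacement `r`.
    have e1 : J.x - u = -(I.y - J.x) + ((1 - I.θ) • (I.x - u) + I.θ • (I.v - u)) := by
      rw [Iterate.y]; module
    have h4 : F.nrm (J.x - u) ≤ r + A := by
      rw [e1]
      refine (F.nrm_add_le _ _).trans ?_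
      rw [F.nrm_neg]
      refine add_le_add le_rfl ((F.nrm_add_le _ _).trans ?_)
      rw [F.nrm_smul, F.nrm_smul, abs_of_nonneg hθ0.le, abs_of_nonneg (by linarith)]
      have h5 : (1 - I.θ) * F.nrm (I.x - u) ≤ (1 - I.θ) * A :=
        mul_le_mul_of_nonneg_left h.dist (by linarith)
      have h6 : I.θ * F.nrm (I.v - u) ≤ I.θ * A :=
        mul_le_mul_of_nonneg_left (hvu.trans hAS) hθ0.le
      linarith
    have h5 : lam F.p ρ * r ^ 2 ≤ G := by
      rw [hrdef, F.nrm_sq]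
      have h6 := F.div_nonneg hp I.x J.x
      have h7 : 0 ≤ F.p * I.θ ^ 2 * F.curv I.x (I.v - I.x) :=
        mul_nonneg (by positivity) (F.curv_nonneg hp _ _)
      have e : G = lam F.p ρ * ∑ i, F.N (I.y - J.x) i ^ 2 + F.div I.x J.x
        + F.p * I.θ ^ 2 * F.curv I.x (I.v - I.x) := rfl
      linarith
    -- The arithmetic-geometric mean inequality splits `r` into a part charged to the iteration
    -- count and a part charged to the drop of the potential, through `lam * r² ≤ G`.
    have h6 : r ≤ S / (2 * T) + T / (2 * S) * r ^ 2 := by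
      have h7 : 0 ≤ T / (2 * S) * (r - S / T) ^ 2 := by positivity
      have e : T / (2 * S) * (r - S / T) ^ 2 = T / (2 * S) * r ^ 2 - r + S / (2 * T) := by
        field_simp; ring
      linarith
    have h7 : T / (2 * S) * r ^ 2
        ≤ S * (2 * (F.potential ρ T b g u I - F.potential ρ T b I.θ u J) / (δ * T)) := by
      have e : T / (2 * S) * r ^ 2 = S * (1 / 4 * (lam F.p ρ * r ^ 2)) / (δ * T) := by
        have h8 : S ^ 2 * lam F.p ρ = 2 * δ * T ^ 2 := by rw [hS2]; field_simp
        rw [div_mul_eq_mul_div, div_eq_div_iff (by positivity) (by positivity)]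
        linear_combination (-(1 / 2) * r ^ 2) * h8
      rw [e, mul_div_assoc]
      exact mul_le_mul_of_nonneg_left
        (div_le_div_of_nonneg_right (by linarith) (by positivity)) hS.le
    have hj0 : (0 : ℝ) ≤ S * (j / (2 * T)) := by positivity
    calc F.nrm (J.x - u) ≤ r + A := h4
      _ ≤ S / (2 * T) + S * (2 * (F.potential ρ T b g u I - F.potential ρ T b I.θ u J) / (δ * T))
          + A + S * (j / (2 * T)) := by linarith
      _ = _ := by rw [hA]; push_cast; ring
  obtain ⟨-, -, -, -, hvx, -⟩ := potential_bounds hp hρ hδ hT4 hθ0.le hpot hval hdist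
  have hYJ : ∀ i, F.N J.y i = F.N J.x i + J.θ * F.N (J.v - J.x) i := fun i => by
    rw [Iterate.y]; simp only [map_add, map_smul, Pi.add_apply, Pi.smul_apply, smul_eq_mul]
  constructor
  · exact hpot
  · exact hval
  · exact hdist
  · rw [hθ]; exact stepSize_le hT0
  · rw [hθ]; exact stepSize_pos hT0
  · have h4 := le_stepSize (q := q) (X := F.N J.x) (W := F.N (J.v - J.x)) hp hρ hq2
      (B := 4 * spread F.p ρ T δ) (by positivity) hT0 (by
        rw [← F.nrm_sq]
        have := F.nrm_nonneg (J.v - J.x)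
        gcongr)
    rw [hθ]
    refine le_trans ?_ (mul_le_mul_of_nonneg_left h4 (by norm_num))
    have hmax : 0 < max T (F.p * (4 * spread F.p ρ T δ) / ρ) := lt_max_of_lt_left hT0
    rw [mul_one_div, div_le_div_iff₀ (by positivity) hmax, mul_comm]
    rw [← le_div_iff₀ hp0]
    refine max_le ?_ ?_
    · rw [le_div_iff₀ hp0]
      have h5 : T * F.p ≤ T * T := by gcongr
      have h6 : 0 ≤ T * T := by positivity
      linarith [sq T]
    · have h5 := spread_le hp hρ hδ hτ hT hu
      rw [div_le_div_iff₀ hρ hp0]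
      have e : F.p * (4 * spread F.p ρ T δ) * F.p = 2 * (2 * F.p ^ 2 * spread F.p ρ T δ) := by ring
      rw [e]
      linarith
  · have h4 : J.θ ≤ 1 / T := by rw [hθ]; exact stepSize_le hT0
    have h5 : 0 < J.θ := by rw [hθ]; exact stepSize_pos hT0
    have h6 : J.θ * T ≤ 1 := by rwa [le_div_iff₀ hT0] at h4
    have h7 : J.θ ^ 2 * T ^ 2 ≤ 1 := by
      rw [← mul_pow]; exact pow_le_one₀ (by positivity) h6
    refine le_trans ?_ h.le_θ
    rw [le_div_iff₀ (by positivity)]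
    nlinarith
  · intro i
    rw [hYJ i, hθ]
    exact stepSize_stable hp hρ (by linarith) hT0 i
  · intro hlt
    rw [hθ] at hlt
    obtain ⟨i, hi⟩ := exists_tight hp hρ hT0 hq hκ hlt
    exact ⟨i, by rwa [hYJ i, hθ]⟩
  · have hvJ : J.v - J.x ∈ V := by
      have := V.sub_mem hvV hd.1
      rwa [sub_sub, ← hx] at this
    refine (h3 _ hvJ).trans ?_
    refine mul_le_mul_of_nonneg_right ?_ (Finset.sum_nonneg fun i _ => sq_nonneg _)
    have : lam F.p ρ * G ≤ lam F.p ρ * (16 * δ) := by gcongr; linarith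
    linarith
  · rw [hs]; simp
  · left; rfl

/-- An epoch that is long enough halves the gap to every point that is close enough. -/
theorem EpochReach.best_le {n : ℕ} (hn : F.EpochReach V ρ T q x₀ n I) (hp : 2 ≤ F.p) (hρ : 0 < ρ)
    (hδ : 0 < δ) (hτ : 1 ≤ τ) (hT : T = 2000 * (F.p * τ)) (hu : ρ ^ F.p * τ = δ)
    (hq : q = 4 * F.p * Fintype.card κ) (hκ : 0 < Fintype.card κ) (huV : u - x₀ ∈ V)
    (hub : F.val u ≤ b) (hx₀ : F.val x₀ ≤ b + δ)
    (hR : lam F.p ρ / T ^ 2 * ∑ i, F.N (x₀ - u) i ^ 2 ≤ δ) (hnT : 5 * T ≤ n) :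
    F.val I.best ≤ b + δ / 2 := by
  have hp0 : 0 < F.p := by linarith
  have hpτ : 2 * 1 ≤ F.p * τ := by gcongr
  have hT4 : 4000 ≤ T := by linarith
  have hpT : F.p ≤ T := by
    have : F.p * 1 ≤ F.p * τ := by gcongr
    linarith
  -- The best value is nonincreasing, so a bad final value means that no recorded point was good.
  -- This gives the lower bounds `δ / 2` on the gap that the invariant requires.
  have key : ∀ {n : ℕ} {I : Iterate E}, F.EpochReach V ρ T q x₀ n I → b + δ / 2 < F.val I.best →
      ∃ k j : ℕ, ∃ g, n = k + j ∧ F.Invariant V ρ T δ b u k j g I := by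
    intro n I hn
    induction hn with
    | start =>
      intro h
      exact ⟨0, 0, 1 / T, rfl, invariant_start hp hρ hδ hT4 hpT hx₀ hR (by simp only at h; linarith)⟩
    | tick hI ht ih =>
      intro hb
      rename_i n I J
      obtain ⟨-, hxV, hvV, hsV⟩ := hI.mem
      obtain ⟨d, hd, ⟨hE, h1, h2, h3, h4, h5, h6, -⟩ | ⟨hE, h1, h2, h3, h4, h5, h6, h7, -⟩⟩ := ht
      · obtain ⟨k, j, g, hn, hinv⟩ := ih (by linarith)
        exact ⟨k, j + 1, g, by omega, hinv.newton hp hρ hd hE h1 h2 h3 h4 (by linarith)⟩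
      · obtain ⟨k, j, g, hn, hinv⟩ := ih (by linarith)
        refine ⟨k + j + 1, 0, I.θ, by omega, hinv.accelerate hp hρ hδ hτ hT hu hq hκ ?_ ?_ ?_ hub
          hd hE h1 h2 h3 h4 h5 (by linarith)⟩
        · have := V.sub_mem hxV hsV; rwa [sub_sub_sub_cancel_right] at this
        · have := V.sub_mem hvV hsV; rwa [sub_sub_sub_cancel_right] at this
        · have := V.sub_mem huV hsV; rwa [sub_sub_sub_cancel_right] at this
  by_contra hcon
  push Not at hcon
  obtain ⟨k, j, g, hkj, hinv⟩ := key hn hcon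
  obtain ⟨-, -, hk, -⟩ := hinv.bounds hp hρ hδ hT4
  have hj := hinv.newton_count_le hp hρ hδ hT4
  have hr := Real.rpow_pos_of_pos hρ F.p
  -- The trailing Newton steps number at most `840 τ ≤ T`, so `k + j ≤ 4 T`, which contradicts `5 T
  -- ≤ n`.
  have hj2 : (j : ℝ) ≤ 840 * τ := by
    rw [← hu] at hj
    have : j * (ρ ^ F.p / 4) ≤ 840 * τ * (ρ ^ F.p / 4) := by linarith
    exact le_of_mul_le_mul_right this (by positivity)
  have hτT : 4000 * τ ≤ T := by
    have : 2 * τ ≤ F.p * τ := by gcongr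
    linarith
  rw [hkj] at hnT
  push_cast at hnT
  linarith

end Objective
end LpRegression

/-! ### Existence of a minimizer and the distance to it -/

namespace LpRegression
namespace Objective

variable {E ι κ : Type*} [AddCommGroup E] [Module ℝ E] [Fintype ι] [Fintype κ]
variable (F : Objective E ι κ)

theorem sq_sub_one_le_rpow {p : ℝ} (hp : 2 ≤ p) (t : ℝ) : t ^ 2 - 1 ≤ |t| ^ p := by
  rcases le_total |t| 1 with h | h
  · have h1 : |t| ^ 2 ≤ 1 := pow_le_one₀ (abs_nonneg _) h
    rw [sq_abs] at h1
    have := Real.rpow_nonneg (abs_nonneg t) p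
    linarith
  · have h1 := Real.rpow_le_rpow_of_exponent_le h hp
    rw [Real.rpow_ofNat, sq_abs] at h1
    linarith

theorem norm_sq_le_sum_sq (a : κ → ℝ) : ‖a‖ ^ 2 ≤ ∑ i, a i ^ 2 := by
  have h0 : 0 ≤ ∑ i, a i ^ 2 := Finset.sum_nonneg fun i _ => sq_nonneg _
  have h1 : ‖a‖ ≤ √(∑ i, a i ^ 2) := by
    refine (pi_norm_le_iff_of_nonneg (Real.sqrt_nonneg _)).2 fun i => ?_
    rw [Real.norm_eq_abs]
    refine Real.abs_le_sqrt ?_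
    exact Finset.single_le_sum (f := fun i => a i ^ 2) (fun j _ => sq_nonneg _) (Finset.mem_univ i)
  calc ‖a‖ ^ 2 ≤ √(∑ i, a i ^ 2) ^ 2 := by gcongr
    _ = _ := Real.sq_sqrt h0

/-- The objective attains its minimum on an affine subspace on which it is bounded in the common
kernel of the matrices. -/
theorem exists_minimizer (hp : 2 ≤ F.p) (V : Submodule ℝ E) (x₀ : E)
    (hc : ∀ v ∈ V, F.M v = 0 → F.N v = 0 → F.c v = 0) :
    ∃ xs, xs - x₀ ∈ V ∧ ∀ y, y - x₀ ∈ V → F.val xs ≤ F.val y := by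
  -- The objective is minimized over the image of `V` under `(M, N)`, a finite-dimensional space on
  -- which it is coercive. The section `σ` lifts the minimizer; the choice of lift is irrelevant
  -- because `c` vanishes on the common kernel.
  let Φ : V →ₗ[ℝ] (ι → ℝ) × (κ → ℝ) := (F.M.prod F.N).comp V.subtype
  obtain ⟨σ, hσ⟩ := Φ.rangeRestrict.exists_rightInverse_of_surjective
    (LinearMap.range_rangeRestrict Φ)
  have hσ' : ∀ r : LinearMap.range Φ, F.M (σ r) = r.1.1 ∧ F.N (σ r) = r.1.2 := by
    intro r
    have h1 : Φ.rangeRestrict (σ r) = r := LinearMap.congr_fun hσ r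
    have h2 : (F.M (σ r), F.N (σ r)) = r.1 := congrArg Subtype.val h1
    exact ⟨congrArg Prod.fst h2, congrArg Prod.snd h2⟩
  let L : LinearMap.range Φ →L[ℝ] ℝ := LinearMap.toContinuousLinearMap (F.c.comp (V.subtype.comp σ))
  have hL : ∀ r, F.c (σ r) = L r := fun r => rfl
  have hval : ∀ r : LinearMap.range Φ, F.val (x₀ + σ r) = F.c x₀ + L r
      + ∑ i, (F.M x₀ i + r.1.1 i) ^ 2 + ∑ i, |F.N x₀ i + r.1.2 i| ^ F.p := by
    intro r
    simp only [val, map_add, Pi.add_apply, (hσ' r).1, (hσ' r).2, hL]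
  have hcont : Continuous fun r : LinearMap.range Φ => F.val (x₀ + σ r) := by
    simp only [hval]
    have hp0 : 0 ≤ F.p := by linarith
    have h1 : Continuous fun r : LinearMap.range Φ => r.1.1 := by fun_prop
    have h2 : Continuous fun r : LinearMap.range Φ => r.1.2 := by fun_prop
    refine ((continuous_const.add L.continuous).add (continuous_finsetSum _ fun i _ => ?_)).add
      (continuous_finsetSum _ fun i _ => ?_)
    · fun_prop
    · exact Continuous.rpow_const (by fun_prop) fun _ => Or.inr hp0
  set K := ∑ i, F.M x₀ i ^ 2 + ∑ i, (F.N x₀ i ^ 2 + 1) with hK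
  -- Since `|t| ^ p ≥ t² - 1`, quadratic growth in both components beats the linear term.
  have hlow : ∀ r : LinearMap.range Φ,
      F.c x₀ - ‖L‖ * ‖r‖ + ‖r‖ ^ 2 / 2 - K ≤ F.val (x₀ + σ r) := by
    intro r
    rw [hval]
    have h1 : -(‖L‖ * ‖r‖) ≤ L r := (abs_le.1 (L.le_opNorm r)).1
    have h2 : ∑ i, r.1.1 i ^ 2 / 2 ≤ ∑ i, ((F.M x₀ i + r.1.1 i) ^ 2 + F.M x₀ i ^ 2) :=
      Finset.sum_le_sum fun i _ => by nlinarith [sq_nonneg (2 * F.M x₀ i + r.1.1 i)]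
    have h3 : ∑ i, r.1.2 i ^ 2 / 2
        ≤ ∑ i, (|F.N x₀ i + r.1.2 i| ^ F.p + (F.N x₀ i ^ 2 + 1)) :=
      Finset.sum_le_sum fun i _ => by
        have := sq_sub_one_le_rpow hp (F.N x₀ i + r.1.2 i)
        nlinarith [sq_nonneg (2 * F.N x₀ i + r.1.2 i)]
    rw [Finset.sum_add_distrib, ← Finset.sum_div] at h2 h3
    have h4 : ‖r‖ ^ 2 ≤ ∑ i, r.1.1 i ^ 2 + ∑ i, r.1.2 i ^ 2 := by
      have h5 : 0 ≤ ∑ i, r.1.1 i ^ 2 := Finset.sum_nonneg fun i _ => sq_nonneg _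
      have h6 : 0 ≤ ∑ i, r.1.2 i ^ 2 := Finset.sum_nonneg fun i _ => sq_nonneg _
      have h7 := norm_sq_le_sum_sq r.1.1
      have h8 := norm_sq_le_sum_sq r.1.2
      have h9 : ‖r‖ = max ‖r.1.1‖ ‖r.1.2‖ := rfl
      rw [h9]
      rcases max_cases ‖r.1.1‖ ‖r.1.2‖ with ⟨h, -⟩ | ⟨h, -⟩ <;> rw [h] <;> linarith
    linarith
  obtain ⟨r, hr⟩ := hcont.exists_forall_le' 0 (by
    filter_upwards [(tendsto_norm_cocompact_atTop (E := LinearMap.range Φ)).eventually_ge_atTop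
      (2 * (‖L‖ + 1) + |F.val (x₀ + σ 0) + K - F.c x₀|)] with r hr
    refine le_trans ?_ (hlow r)
    have h1 := le_abs_self (F.val (x₀ + σ 0) + K - F.c x₀)
    have h2 := abs_nonneg (F.val (x₀ + σ 0) + K - F.c x₀)
    have h3 := norm_nonneg L
    have h4 : ‖r‖ * 1 ≤ ‖r‖ * (‖r‖ / 2 - ‖L‖) :=
      mul_le_mul_of_nonneg_left (by linarith) (norm_nonneg _)
    nlinarith)
  refine ⟨x₀ + σ r, by simp, fun y hy => ?_⟩
  refine (hr (Φ.rangeRestrict ⟨y - x₀, hy⟩)).trans (le_of_eq ?_)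
  set w := σ (Φ.rangeRestrict ⟨y - x₀, hy⟩) with hw
  obtain ⟨hM, hN⟩ := hσ' (Φ.rangeRestrict ⟨y - x₀, hy⟩)
  have hM' : F.M w = F.M (y - x₀) := hM
  have hN' : F.N w = F.N (y - x₀) := hN
  have hcw : F.c (w - (y - x₀)) = 0 := by
    refine hc _ (V.sub_mem w.2 hy) ?_ ?_
    · rw [map_sub, hM', sub_self]
    · rw [map_sub, hN', sub_self]
  rw [map_sub, sub_eq_zero] at hcw
  simp only [val, map_add, hM', hN', hcw, map_sub, add_sub_cancel]

theorem val_convex (hp : 2 ≤ F.p) (x y : E) {t : ℝ} (h0 : 0 ≤ t) (h1 : t ≤ 1) :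
    F.val (x + t • (y - x)) ≤ (1 - t) * F.val x + t * F.val y := by
  have hx := F.val_eq x (x + t • (y - x))
  have hy := F.val_eq y (x + t • (y - x))
  have e1 : x - (x + t • (y - x)) = (-t) • (y - x) := by module
  have e2 : y - (x + t • (y - x)) = (1 - t) • (y - x) := by module
  have hs : ∀ (z ξ : E) (a : ℝ), F.grad z (a • ξ) = a * F.grad z ξ := fun z ξ a => by
    simp only [grad, map_smul, Pi.smul_apply, smul_eq_mul, mul_add, Finset.mul_sum]
    congr 1
    · congr 1
      exact Finset.sum_congr rfl fun i _ => by ring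
    · exact Finset.sum_congr rfl fun i _ => by ring
  rw [e1, hs] at hx
  rw [e2, hs] at hy
  have h2 := mul_nonneg (sub_nonneg.2 h1) (F.div_nonneg hp x (x + t • (y - x)))
  have h3 := mul_nonneg h0 (F.div_nonneg hp y (x + t • (y - x)))
  rw [hx, hy]
  nlinarith

/-- The `p`-norm distance to a minimizer in terms of the gap. -/
theorem sum_rpow_le_gap (hp : 2 ≤ F.p) {V : Submodule ℝ E} {x xs : E} (hV : xs - x ∈ V)
    (hmin : ∀ y, y - x ∈ V → F.val xs ≤ F.val y) :
    ∑ i, |F.N (x - xs) i| ^ F.p ≤ 2 ^ F.p * (F.val x - F.val xs) := by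
  -- The midpoint is feasible, so its value is at least the minimum. Clarkson's inequality puts the
  -- midpoint below the average of the two values by the `p`-th power of half the distance.
  have hmid := hmin (x + (1 / 2 : ℝ) • (xs - x)) (by
    rw [add_sub_cancel_left]; exact V.smul_mem _ hV)
  have hp0 : 0 < F.p := by linarith
  have hM : ∑ i, F.M (x + (1 / 2 : ℝ) • (xs - x)) i ^ 2
      ≤ 1 / 2 * ∑ i, F.M x i ^ 2 + 1 / 2 * ∑ i, F.M xs i ^ 2 := by
    rw [Finset.mul_sum, Finset.mul_sum, ← Finset.sum_add_distrib]
    refine Finset.sum_le_sum fun i _ => ?_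
    simp only [map_add, map_smul, map_sub, Pi.add_apply, Pi.smul_apply, Pi.sub_apply, smul_eq_mul]
    nlinarith [sq_nonneg (F.M x i - F.M xs i)]
  have hN : ∑ i, |F.N (x + (1 / 2 : ℝ) • (xs - x)) i| ^ F.p
      + (1 / 2) ^ F.p * ∑ i, |F.N (x - xs) i| ^ F.p
      ≤ 1 / 2 * ∑ i, |F.N x i| ^ F.p + 1 / 2 * ∑ i, |F.N xs i| ^ F.p := by
    rw [Finset.mul_sum, Finset.mul_sum, Finset.mul_sum, ← Finset.sum_add_distrib,
      ← Finset.sum_add_distrib]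
    refine Finset.sum_le_sum fun i _ => ?_
    have h1 := clarkson hp ((F.N x i + F.N xs i) / 2) ((F.N x i - F.N xs i) / 2)
    have e1 : (F.N x i + F.N xs i) / 2 + (F.N x i - F.N xs i) / 2 = F.N x i := by ring
    have e2 : (F.N x i + F.N xs i) / 2 - (F.N x i - F.N xs i) / 2 = F.N xs i := by ring
    rw [e1, e2] at h1
    have e3 : F.N (x + (1 / 2 : ℝ) • (xs - x)) i = (F.N x i + F.N xs i) / 2 := by
      simp only [map_add, map_smul, map_sub, Pi.add_apply, Pi.smul_apply, Pi.sub_apply, smul_eq_mul]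
      ring
    have e4 : |(F.N x i - F.N xs i) / 2| ^ F.p = (1 / 2) ^ F.p * |F.N (x - xs) i| ^ F.p := by
      rw [← Real.mul_rpow (by norm_num) (abs_nonneg _), map_sub, Pi.sub_apply, abs_div, abs_two]
      congr 1; ring
    rw [e3, ← e4]
    linarith
  have hcm : F.c (x + (1 / 2 : ℝ) • (xs - x)) = 1 / 2 * F.c x + 1 / 2 * F.c xs := by
    simp only [map_add, map_smul, map_sub, smul_eq_mul]; ring
  have hgap : (1 / 2) ^ F.p * ∑ i, |F.N (x - xs) i| ^ F.p ≤ 1 / 2 * (F.val x - F.val xs) := by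
    unfold val at *
    rw [hcm] at hmid
    linarith
  have hself := hmin x (by simp)
  have e : (2 : ℝ) ^ F.p * (1 / 2) ^ F.p = 1 := by
    rw [← Real.mul_rpow (by norm_num) (by norm_num)]; norm_num
  have h2 : (0 : ℝ) < 2 ^ F.p := by positivity
  calc ∑ i, |F.N (x - xs) i| ^ F.p = 2 ^ F.p * ((1 / 2) ^ F.p * ∑ i, |F.N (x - xs) i| ^ F.p) := by
        rw [← mul_assoc, e, one_mul]
    _ ≤ 2 ^ F.p * (F.val x - F.val xs) := by
        gcongr; linarith

/-- The power mean inequality with exponent `p / 2`, applied to the squares. -/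
theorem sum_sq_le_rpow {p : ℝ} (hp : 2 ≤ p) (a : κ → ℝ) :
    ∑ i, a i ^ 2 ≤ (Fintype.card κ : ℝ) ^ (1 - 2 / p) * (∑ i, |a i| ^ p) ^ (2 / p) := by
  have hp0 : 0 < p := by linarith
  have h := Real.rpow_sum_le_const_mul_sum_rpow_of_nonneg Finset.univ (f := fun i => a i ^ 2)
    (p := p / 2) (by linarith) (fun i _ => sq_nonneg _)
  have e : ∀ i, (a i ^ 2) ^ (p / 2) = |a i| ^ p := fun i => by
    rw [← sq_abs, ← Real.rpow_natCast, ← Real.rpow_mul (abs_nonneg _)]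
    congr 1; push_cast; ring
  simp only [e] at h
  have h0 : 0 ≤ ∑ i, a i ^ 2 := Finset.sum_nonneg fun i _ => sq_nonneg _
  have hc : (0 : ℝ) ≤ (Finset.univ : Finset κ).card := Nat.cast_nonneg _
  have hs : 0 ≤ ∑ i, |a i| ^ p := Finset.sum_nonneg fun i _ => Real.rpow_nonneg (abs_nonneg _) _
  have h1 := Real.rpow_le_rpow (Real.rpow_nonneg h0 _) h (by positivity : 0 ≤ 2 / p)
  rw [← Real.rpow_mul h0, div_mul_div_cancel₀ (by norm_num), _root_.div_self hp0.ne', Real.rpow_one,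
    Real.mul_rpow (Real.rpow_nonneg hc _) hs, ← Real.rpow_mul hc] at h1
  have e2 : (p / 2 - 1) * (2 / p) = 1 - 2 / p := by field_simp
  rwa [e2] at h1

end Objective
end LpRegression

/-! ### Choice of the parameters -/

namespace LpRegression

/-- `m ^ ((p - 2) / (3 p - 2))`. -/
noncomputable def tau (p m : ℝ) : ℝ := m ^ ((p - 2) / (3 * p - 2))

/-- The target decrease divided by `tau`, as a length. -/
noncomputable def radius (p m δ : ℝ) : ℝ := (δ / tau p m) ^ (1 / p)

/-- The inverse of the largest extrapolation parameter. -/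
noncomputable def horizon (p m : ℝ) : ℝ := 2000 * (p * tau p m)

theorem one_le_tau {p m : ℝ} (hp : 2 ≤ p) (hm : 1 ≤ m) : 1 ≤ tau p m :=
  Real.one_le_rpow hm (div_nonneg (by linarith) (by linarith))

theorem radius_pos {p m δ : ℝ} (hp : 2 ≤ p) (hm : 1 ≤ m) (hδ : 0 < δ) : 0 < radius p m δ := by
  have := one_le_tau hp hm
  unfold radius
  positivity

theorem radius_rpow {p m δ : ℝ} (hp : 2 ≤ p) (hm : 1 ≤ m) (hδ : 0 < δ) :
    radius p m δ ^ p = δ / tau p m := by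
  have := one_le_tau hp hm
  unfold radius
  rw [← Real.rpow_mul (by positivity), one_div_mul_cancel (by linarith), Real.rpow_one]

/-- The proximal weight is small enough for comparison points at distance `2 δ ^ (1 / p)` in the
`p`-norm. -/
theorem weight_mul_le {p m δ : ℝ} (hp : 2 ≤ p) (hm : 1 ≤ m) (hδ : 0 < δ) :
    lam p (radius p m δ) / horizon p m ^ 2 * (m ^ (1 - 2 / p) * (4 * δ ^ (2 / p))) ≤ δ := by
  have hτ1 := one_le_tau hp hm
  have hp0 : 0 < p := by linarith
  set τ := tau p m with hτ
  have hτ0 : 0 < τ := by linarith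
  have hm0 : 0 < m := by linarith
  have e1 : radius p m δ ^ (p - 2) = δ ^ (1 - 2 / p) * (τ ^ (1 - 2 / p))⁻¹ := by
    unfold radius
    rw [← hτ, ← Real.rpow_mul (by positivity), Real.div_rpow hδ.le hτ0.le, div_eq_mul_inv]
    have : 1 / p * (p - 2) = 1 - 2 / p := by field_simp
    rw [this]
  -- The defining property of the exponent: `(p-2)/(3p-2) * (3 - 2/p) = 1 - 2/p`. Here `τ²` comes
  -- from `T²` and `τ ^ (1 - 2/p)` from `ρ ^ (p-2)`.
  have e2 : m ^ (1 - 2 / p) = τ ^ 2 * τ ^ (1 - 2 / p) := by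
    rw [← Real.rpow_natCast, ← Real.rpow_add hτ0, hτ, tau, ← Real.rpow_mul hm0.le]
    congr 1
    have : 3 * p - 2 ≠ 0 := by intro h; linarith
    have h2 : (2 : ℝ) + (1 - 2 / p) = (3 * p - 2) / p := by field_simp; ring
    push_cast
    rw [h2, div_mul_div_comm, mul_comm (p - 2), mul_div_mul_left _ _ this]
    field_simp
  have e3 : δ ^ (1 - 2 / p) * δ ^ (2 / p) = δ := by
    rw [← Real.rpow_add hδ]; simp
  have h4 : 0 < τ ^ (1 - 2 / p) := by positivity
  rw [lam, horizon, e1, e2, ← hτ]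
  have : 10000 * (p ^ 2 * (δ ^ (1 - 2 / p) * (τ ^ (1 - 2 / p))⁻¹)) / (2000 * (p * τ)) ^ 2
      * (τ ^ 2 * τ ^ (1 - 2 / p) * (4 * δ ^ (2 / p)))
      = 1 / 100 * (δ ^ (1 - 2 / p) * δ ^ (2 / p)) := by
    field_simp; norm_num
  rw [this, e3]
  linarith

namespace Objective

variable {E ι κ : Type*} [AddCommGroup E] [Module ℝ E] [Fintype ι] [Fintype κ]
variable (F : Objective E ι κ)

/-- The result of an epoch with the target decrease `δ`. -/
theorem EpochReach.progress {V : Submodule ℝ E} {δ : ℝ} {x₀ xs : E} {n : ℕ} {I : Iterate E}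
    (hp : 2 ≤ F.p) (hδ : 0 < δ) (hκ : 0 < Fintype.card κ)
    (hn : F.EpochReach V (radius F.p (Fintype.card κ) δ) (horizon F.p (Fintype.card κ))
      (4 * F.p * Fintype.card κ) x₀ n I)
    (hnT : 5 * horizon F.p (Fintype.card κ) ≤ n) (hxs : xs - x₀ ∈ V)
    (hmin : ∀ y, y - x₀ ∈ V → F.val xs ≤ F.val y) :
    (F.val x₀ ≤ F.val xs + δ → F.val I.best ≤ F.val xs + δ / 2) ∧
      (F.val xs + δ ≤ F.val x₀ → F.val I.best ≤ F.val x₀ - δ / 2) := by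
  have hp0 : 0 < F.p := by linarith
  have hm : (1 : ℝ) ≤ Fintype.card κ := by exact_mod_cast hκ
  set m : ℝ := (Fintype.card κ : ℝ) with hmdef
  have hm0 : 0 < m := by linarith
  have hτ := one_le_tau hp hm
  have hρ := radius_pos hp hm hδ
  have hu : radius F.p m δ ^ F.p * tau F.p m = δ := by
    rw [radius_rpow hp hm hδ, div_mul_cancel₀]
    linarith
  have hw := weight_mul_le hp hm hδ
  have hw0 : 0 ≤ lam F.p (radius F.p m δ) / horizon F.p m ^ 2 :=
    _root_.div_nonneg (lam_pos hp hρ).le (sq_nonneg _)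
  have hself := hmin x₀ (by simp)
  have hclose := F.sum_rpow_le_gap hp hxs hmin
  have hsq := sum_sq_le_rpow hp (F.N (x₀ - xs))
  set gap := F.val x₀ - F.val xs with hgap
  have hgap0 : 0 ≤ gap := by linarith
  have hs0 : 0 ≤ ∑ i, |F.N (x₀ - xs) i| ^ F.p :=
    Finset.sum_nonneg fun i _ => Real.rpow_nonneg (abs_nonneg _) _
  have hdist : ∑ i, F.N (x₀ - xs) i ^ 2 ≤ m ^ (1 - 2 / F.p) * (4 * gap ^ (2 / F.p)) := by
    refine hsq.trans (mul_le_mul_of_nonneg_left ?_ (by positivity))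
    refine (Real.rpow_le_rpow hs0 hclose (by positivity)).trans (le_of_eq ?_)
    rw [Real.mul_rpow (by positivity) hgap0, ← Real.rpow_mul (by norm_num),
      mul_div_cancel₀ _ hp0.ne']
    norm_num
  constructor
  · intro h
    refine hn.best_le hp hρ hδ hτ rfl hu rfl hκ hxs le_rfl h ((mul_le_mul_of_nonneg_left
      (hdist.trans ?_) hw0).trans hw) hnT
    have : gap ≤ δ := by linarith
    gcongr
  · intro h
    -- If the gap is larger than the target, the comparison point is not the minimizer but the point
    -- of the segment towards it at which convexity guarantees the decrease `δ`. Shortening by `δ /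
    -- gap` makes its distance the one that belongs to a gap of `δ`.
    have hδg : δ ≤ gap := by linarith
    have hg0 : 0 < gap := hδ.trans_le hδg
    have ht0 : 0 ≤ δ / gap := by positivity
    have ht1 : δ / gap ≤ 1 := (div_le_one hg0).2 hδg
    have hub : F.val (x₀ + (δ / gap) • (xs - x₀)) ≤ F.val x₀ - δ := by
      refine (F.val_convex hp x₀ xs ht0 ht1).trans (le_of_eq ?_)
      have : δ / gap * gap = δ := div_mul_cancel₀ _ hg0.ne'
      have e : (1 - δ / gap) * F.val x₀ + δ / gap * F.val xs = F.val x₀ - δ / gap * gap := by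
        rw [hgap]; ring
      rw [e, this]
    have hR : ∑ i, F.N (x₀ - (x₀ + (δ / gap) • (xs - x₀))) i ^ 2
        ≤ m ^ (1 - 2 / F.p) * (4 * δ ^ (2 / F.p)) := by
      have e : x₀ - (x₀ + (δ / gap) • (xs - x₀)) = (δ / gap) • (x₀ - xs) := by module
      simp only [e, map_smul, Pi.smul_apply, smul_eq_mul, mul_pow, ← Finset.mul_sum]
      -- The distance scales with the exponent `2`, while only `2 / p` is needed; the base is at
      -- most `1`.
      have h1 : (δ / gap) ^ 2 ≤ (δ / gap) ^ (2 / F.p) := by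
        have h2 := Real.rpow_le_rpow_of_exponent_ge (by positivity : 0 < δ / gap) ht1
          (show 2 / F.p ≤ 2 by rw [div_le_iff₀ hp0]; linarith)
        rwa [Real.rpow_ofNat] at h2
      calc (δ / gap) ^ 2 * ∑ i, F.N (x₀ - xs) i ^ 2
          ≤ (δ / gap) ^ (2 / F.p) * (m ^ (1 - 2 / F.p) * (4 * gap ^ (2 / F.p))) := by gcongr
        _ = m ^ (1 - 2 / F.p) * (4 * ((δ / gap) ^ (2 / F.p) * gap ^ (2 / F.p))) := by ring
        _ = _ := by rw [← Real.mul_rpow ht0 hgap0, div_mul_cancel₀ _ hg0.ne']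
    have := hn.best_le hp hρ hδ hτ rfl hu rfl hκ (b := F.val x₀ - δ)
      (u := x₀ + (δ / gap) • (xs - x₀))
      (by rw [add_sub_cancel_left]; exact V.smul_mem _ hxs) hub (by linarith)
      ((mul_le_mul_of_nonneg_left hR hw0).trans hw) hnT
    linarith

end Objective

/-! ### Linear systems -/

/-- A symmetric system is solvable if the right-hand side is orthogonal to the kernel. -/
theorem exists_mulVec_eq {n : Type*} [Fintype n] [DecidableEq n] {K : Matrix n n ℝ}
    (hK : Kᵀ = K) {r : n → ℝ} (h : ∀ w, K *ᵥ w = 0 → w ⬝ᵥ r = 0) : ∃ z, K *ᵥ z = r := by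
  have hsymm : (Matrix.toEuclideanLin K).IsSymmetric := by
    rw [Matrix.isSymmetric_toEuclideanLin_iff]
    exact (Matrix.conjTranspose_eq_transpose_of_trivial K).trans hK
  have hadj : LinearMap.adjoint (Matrix.toEuclideanLin K) = Matrix.toEuclideanLin K :=
    LinearMap.isSelfAdjoint_iff'.1 ((LinearMap.isSymmetric_iff_isSelfAdjoint _).1 hsymm)
  have h1 : (WithLp.toLp 2 r : EuclideanSpace ℝ n) ∈ (LinearMap.ker (Matrix.toEuclideanLin K))ᗮ := by
    rw [Submodule.mem_orthogonal]
    intro w hw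
    have h2 : K *ᵥ w.ofLp = 0 := by
      have h3 : Matrix.toEuclideanLin K w = 0 := hw
      have h4 := congrArg WithLp.ofLp h3
      simpa using h4
    have h3 := h _ h2
    simp only [EuclideanSpace.inner_eq_star_dotProduct, star_trivial]
    rw [dotProduct_comm]
    exact h3
  rw [LinearMap.orthogonal_ker, hadj] at h1
  obtain ⟨z, hz⟩ := h1
  exact ⟨z.ofLp, by simpa using congrArg WithLp.ofLp hz⟩

section KKT

variable {n d m₁ m₂ : Type*} [Fintype n] [Fintype d] [Fintype m₁] [Fintype m₂]
variable [DecidableEq n] [DecidableEq d] [DecidableEq m₂]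

/-- The matrix of the optimality conditions of a weighted least squares problem. -/
noncomputable def kkt (A : Matrix d n ℝ) (M : Matrix m₁ n ℝ) (N : Matrix m₂ n ℝ) (μ : ℝ)
    (W : m₂ → ℝ) : Matrix (n ⊕ d) (n ⊕ d) ℝ :=
  Matrix.fromBlocks (μ • (Mᵀ * M) + Nᵀ * (Matrix.diagonal W * N)) Aᵀ A 0

variable {A : Matrix d n ℝ} {M : Matrix m₁ n ℝ} {N : Matrix m₂ n ℝ} {μ : ℝ} {W : m₂ → ℝ}

theorem dotProduct_hessian (x ξ : n → ℝ) :
    ξ ⬝ᵥ ((μ • (Mᵀ * M) + Nᵀ * (Matrix.diagonal W * N)) *ᵥ x)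
      = μ * ∑ i, (M *ᵥ x) i * (M *ᵥ ξ) i + ∑ i, W i * (N *ᵥ x) i * (N *ᵥ ξ) i := by
  rw [Matrix.add_mulVec, dotProduct_add, Matrix.smul_mulVec, dotProduct_smul,
    ← Matrix.mulVec_mulVec, ← Matrix.mulVec_mulVec, ← Matrix.mulVec_mulVec,
    Matrix.dotProduct_mulVec ξ Mᵀ, Matrix.dotProduct_mulVec ξ Nᵀ, Matrix.vecMul_transpose,
    Matrix.vecMul_transpose, smul_eq_mul]
  congr 1
  · congr 1
    exact Finset.sum_congr rfl fun i _ => mul_comm _ _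
  · refine Finset.sum_congr rfl fun i _ => ?_
    rw [Matrix.mulVec_diagonal]; ring

/-- Positive weights force the first component of a kernel vector into the common kernel of `M`, `N`
and `A`, and to this the right-hand side is orthogonal. -/
theorem exists_kkt (hμ : 0 < μ) (hW : ∀ i, 0 < W i) {r : n → ℝ}
    (hr : ∀ v, M *ᵥ v = 0 → N *ᵥ v = 0 → A *ᵥ v = 0 → v ⬝ᵥ r = 0) :
    ∃ z, kkt A M N μ W *ᵥ z = Sum.elim r 0 := by
  refine exists_mulVec_eq ?_ fun w hw => ?_
  · unfold kkt
    rw [Matrix.fromBlocks_transpose]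
    simp only [Matrix.transpose_add, Matrix.transpose_smul, Matrix.transpose_mul,
      Matrix.transpose_transpose, Matrix.diagonal_transpose, Matrix.transpose_zero,
      Matrix.mul_assoc]
  · obtain ⟨x, ν, rfl⟩ : ∃ x ν, w = Sum.elim x ν :=
      ⟨w ∘ Sum.inl, w ∘ Sum.inr, (Sum.elim_comp_inl_inr w).symm⟩
    unfold kkt at hw
    rw [Matrix.fromBlocks_mulVec] at hw
    simp only [Sum.elim_comp_inl, Sum.elim_comp_inr, Matrix.zero_mulVec, add_zero] at hw
    have h1 : (μ • (Mᵀ * M) + Nᵀ * (Matrix.diagonal W * N)) *ᵥ x + Aᵀ *ᵥ ν = 0 :=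
      funext fun i => congrFun hw (Sum.inl i)
    have h2 : A *ᵥ x = 0 := funext fun i => congrFun hw (Sum.inr i)
    -- Pairing with `x` removes the multiplier, as `A x = 0`, and leaves a sum of nonnegative terms.
    have h3 := congrArg (x ⬝ᵥ ·) h1
    simp only [dotProduct_add, dotProduct_hessian, dotProduct_zero] at h3
    rw [Matrix.dotProduct_mulVec, Matrix.vecMul_transpose, h2, zero_dotProduct, add_zero] at h3
    have hM0 : ∀ i, 0 ≤ (M *ᵥ x) i * (M *ᵥ x) i := fun i => mul_self_nonneg _
    have hN0 : ∀ i, 0 ≤ W i * (N *ᵥ x) i * (N *ᵥ x) i := fun i => by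
      rw [mul_assoc]; exact mul_nonneg (hW i).le (mul_self_nonneg _)
    have hMs := Finset.sum_nonneg fun i (_ : i ∈ Finset.univ) => hM0 i
    have hNs := Finset.sum_nonneg fun i (_ : i ∈ Finset.univ) => hN0 i
    have hM1 : ∑ i, (M *ᵥ x) i * (M *ᵥ x) i = 0 := by
      have := mul_nonneg hμ.le hMs
      have h4 : μ * ∑ i, (M *ᵥ x) i * (M *ᵥ x) i = 0 := by linarith
      exact (mul_eq_zero.1 h4).resolve_left hμ.ne'
    have hN1 : ∑ i, W i * (N *ᵥ x) i * (N *ᵥ x) i = 0 := by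
      rw [hM1] at h3; linarith
    rw [sumElim_dotProduct_sumElim, dotProduct_zero, add_zero]
    refine hr x (funext fun i => ?_) (funext fun i => ?_) h2
    · exact mul_self_eq_zero.1
        ((Finset.sum_eq_zero_iff_of_nonneg fun i _ => hM0 i).1 hM1 i (Finset.mem_univ i))
    · have := (Finset.sum_eq_zero_iff_of_nonneg fun i _ => hN0 i).1 hN1 i (Finset.mem_univ i)
      rw [mul_assoc, mul_eq_zero] at this
      exact mul_self_eq_zero.1 (this.resolve_left (hW i).ne')

/-- Testing with directions in `ker A` eliminates the multiplier. This holds for any solution, so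
uniqueness plays no role. -/
theorem kkt_spec {z : n ⊕ d → ℝ} {r : n → ℝ} (h : kkt A M N μ W *ᵥ z = Sum.elim r 0) :
    A *ᵥ (z ∘ Sum.inl) = 0 ∧ ∀ ξ, A *ᵥ ξ = 0 →
      μ * ∑ i, (M *ᵥ (z ∘ Sum.inl)) i * (M *ᵥ ξ) i
        + ∑ i, W i * (N *ᵥ (z ∘ Sum.inl)) i * (N *ᵥ ξ) i = ξ ⬝ᵥ r := by
  unfold kkt at h
  rw [Matrix.fromBlocks_mulVec] at h
  simp only [Matrix.zero_mulVec, add_zero] at h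
  have h1 : (μ • (Mᵀ * M) + Nᵀ * (Matrix.diagonal W * N)) *ᵥ (z ∘ Sum.inl)
      + Aᵀ *ᵥ (z ∘ Sum.inr) = r := funext fun i => congrFun h (Sum.inl i)
  refine ⟨funext fun i => congrFun h (Sum.inr i), fun ξ hξ => ?_⟩
  rw [← dotProduct_hessian, ← h1, dotProduct_add, Matrix.dotProduct_mulVec ξ Aᵀ,
    Matrix.vecMul_transpose, hξ, zero_dotProduct, add_zero]

end KKT

end LpRegression

/-! ### Compiling expressions to programs -/

namespace LpRegression

variable {D : Dims}

theorem State.set_same (σ : State D) (s : Space) (i : ℕ) (v : s.Idx D → ℝ) (j : ℕ) :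
    (σ.set s i v) s j = if j = i then v else σ s j :=
  (congrFun (Function.update_self (β := fun s : Space => ℕ → s.Idx D → ℝ) s _ σ) j).trans
    (Function.update_apply _ _ _ _)

theorem State.set_self (σ : State D) (s : Space) (i : ℕ) (v : s.Idx D → ℝ) :
    (σ.set s i v) s i = v := by rw [State.set_same, if_pos rfl]

theorem State.set_of_ne (σ : State D) {s : Space} {i : ℕ} (v : s.Idx D → ℝ) {t : Space} {j : ℕ}
    (h : (t, j) ≠ (s, i)) : (σ.set s i v) t j = σ t j := by
  by_cases hts : t = s
  · subst hts
    rw [State.set_same, if_neg]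
    rintro rfl; exact h rfl
  · exact congrFun (Function.update_of_ne (β := fun s : Space => ℕ → s.Idx D → ℝ) hts _ σ) j

/-! ### Expressions -/

/-- Expressions for vectors. -/
inductive Ex : Space → Type where
  | reg (s : Space) (i : ℕ) : Ex s
  | const (q : ℚ) : Ex .scalar
  | fill (s : Space) (e : Ex .scalar) : Ex s
  | op {s : Space} (o : Op) (e f : Ex s) : Ex s
  | inner {s : Space} (e f : Ex s) : Ex .scalar
  | pair {s t : Space} (e : Ex s) (f : Ex t) : Ex (.sum s t)
  | fst {s t : Space} (e : Ex (.sum s t)) : Ex s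
  | apply {s t : Space} (K : MatExpr s t) (e : Ex t) : Ex s
  | solve {s : Space} (K : MatExpr s s) (e : Ex s) : Ex s

/-- All registers in the expression have numbers below `B`. -/
def MatExpr.bounded (B : ℕ) : {s t : Space} → MatExpr s t → Bool
  | _, _, .A => true
  | _, _, .M => true
  | _, _, .N => true
  | _, _, .zero _ _ => true
  | _, _, .diag _ i => decide (i < B)
  | _, _, .col _ i => decide (i < B)
  | _, _, .smul i K => decide (i < B) && K.bounded B
  | _, _, .plus K L => K.bounded B && L.bounded B
  | _, _, .mul K L => K.bounded B && L.bounded B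
  | _, _, .transpose K => K.bounded B
  | _, _, .blocks K₁ K₂ K₃ K₄ => (K₁.bounded B && K₂.bounded B) && (K₃.bounded B && K₄.bounded B)

namespace Ex

/-- The value of an expression. -/
noncomputable def eval (S : LinearSystemSolver) (Q : Problem D) (σ : State D) :
    {s : Space} → Ex s → s.Idx D → ℝ
  | _, .reg s i => σ s i
  | _, .const q => fun _ => (q : ℝ)
  | _, .fill _ e => fun _ => e.eval S Q σ ()
  | _, .op o e f => fun i => o.eval (e.eval S Q σ i) (f.eval S Q σ i)
  | _, .inner e f => fun _ => e.eval S Q σ ⬝ᵥ f.eval S Q σ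
  | _, .pair e f => Sum.elim (e.eval S Q σ) (f.eval S Q σ)
  | _, .fst e => fun i => e.eval S Q σ (Sum.inl i)
  | _, .apply K e => K.eval Q σ *ᵥ e.eval S Q σ
  | _, .solve K e => S.solve (K.eval Q σ) (e.eval S Q σ)

/-- All registers in the expression have numbers below `B`. -/
def bounded (B : ℕ) : {s : Space} → Ex s → Bool
  | _, .reg _ i => decide (i < B)
  | _, .const _ => true
  | _, .fill _ e => e.bounded B
  | _, .op _ e f => e.bounded B && f.bounded B
  | _, .inner e f => e.bounded B && f.bounded B
  | _, .pair e f => e.bounded B && f.bounded B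
  | _, .fst e => e.bounded B
  | _, .apply K e => K.bounded B && e.bounded B
  | _, .solve K e => K.bounded B && e.bounded B

/-- A program that leaves the value of the expression in register `k` and uses only registers with
numbers at least `k`. -/
def compile : {s : Space} → Ex s → ℕ → Program
  | _, .reg s i, k => .instr (.op .max s k i i)
  | _, .const q, k => .instr (.const k q)
  | _, .fill s e, k => .seq (e.compile k) (.instr (.fill s k k))
  | s, .op o e f, k => .seq (e.compile k) (.seq (f.compile (k + 1)) (.instr (.op o s k k (k + 1))))
  | _, .inner (s := s) e f, k =>
    .seq (e.compile k) (.seq (f.compile (k + 1)) (.instr (.inner s k k (k + 1))))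
  | _, .pair (s := s) (t := t) e f, k =>
    .seq (e.compile k) (.seq (f.compile (k + 1)) (.instr (.pair s t k k (k + 1))))
  | _, .fst (s := s) (t := t) e, k => .seq (e.compile k) (.instr (.fst s t k k))
  | _, .apply K e, k => .seq (e.compile k) (.instr (.apply K k k))
  | _, .solve K e, k => .seq (e.compile k) (.instr (.solve K k k))

/-- The number of instructions of the compiled expression. -/
def cost : {s : Space} → Ex s → ℕ
  | _, .reg _ _ => 1
  | _, .const _ => 1
  | _, .fill _ e => e.cost + 1
  | _, .op _ e f => e.cost + (f.cost + 1)
  | _, .inner e f => e.cost + (f.cost + 1)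
  | _, .pair e f => e.cost + (f.cost + 1)
  | _, .fst e => e.cost + 1
  | _, .apply _ e => e.cost + 1
  | _, .solve _ e => e.cost + 1

end Ex

/-- The two states agree on the registers with numbers below `B`. -/
def Agree (B : ℕ) (σ τ : State D) : Prop := ∀ s i, i < B → τ s i = σ s i

theorem Agree.refl (B : ℕ) (σ : State D) : Agree B σ σ := fun _ _ _ => rfl

theorem Agree.trans {B : ℕ} {σ τ υ : State D} (h : Agree B σ τ) (h' : Agree B τ υ) :
    Agree B σ υ := fun s i hi => (h' s i hi).trans (h s i hi)

theorem Agree.mono {B k : ℕ} {σ τ : State D} (h : Agree k σ τ) (hk : B ≤ k) : Agree B σ τ :=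
  fun s i hi => h s i (hi.trans_le hk)

theorem Agree.scal {B : ℕ} {σ τ : State D} (h : Agree B σ τ) {i : ℕ} (hi : i < B) :
    τ.scal i = σ.scal i := congrFun (h .scalar i hi) ()

theorem agree_set (σ : State D) (s : Space) (k : ℕ) (v : s.Idx D → ℝ) : Agree k σ (σ.set s k v) :=
  fun t i hi => State.set_of_ne σ v (by intro h; cases h; exact lt_irrefl _ hi)

theorem MatExpr.eval_congr {B : ℕ} {Q : Problem D} {σ τ : State D} (h : Agree B σ τ)
    {s t : Space} (K : MatExpr s t) (hK : K.bounded B = true) : K.eval Q τ = K.eval Q σ := by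
  induction K with
  | A => rfl
  | M => rfl
  | N => rfl
  | zero => rfl
  | diag s i => simp only [MatExpr.eval, h s i (of_decide_eq_true hK)]
  | col s i => simp only [MatExpr.eval, h s i (of_decide_eq_true hK)]
  | smul i K ih =>
    simp only [MatExpr.bounded, Bool.and_eq_true, decide_eq_true_eq] at hK
    simp only [MatExpr.eval, ih hK.2, h.scal hK.1]
  | plus K L ih ih' =>
    simp only [MatExpr.bounded, Bool.and_eq_true] at hK
    simp only [MatExpr.eval, ih hK.1, ih' hK.2]
  | mul K L ih ih' =>
    simp only [MatExpr.bounded, Bool.and_eq_true] at hK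
    simp only [MatExpr.eval, ih hK.1, ih' hK.2]
  | transpose K ih =>
    simp only [MatExpr.eval, ih hK]
  | blocks K₁ K₂ K₃ K₄ i1 i2 i3 i4 =>
    simp only [MatExpr.bounded, Bool.and_eq_true] at hK
    simp only [MatExpr.eval, i1 hK.1.1, i2 hK.1.2, i3 hK.2.1, i4 hK.2.2]
    rfl

section Semantics

variable {S : LinearSystemSolver} {Q : Problem D}

theorem Ex.eval_congr {B : ℕ} {σ τ : State D} (h : Agree B σ τ) {s : Space} (e : Ex s)
    (he : e.bounded B = true) : e.eval S Q τ = e.eval S Q σ := by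
  induction e with
  | reg s i => exact h s i (of_decide_eq_true he)
  | const => rfl
  | fill s e ih => simp only [Ex.eval, ih he]
  | op o e f ih ih' =>
    simp only [Ex.bounded, Bool.and_eq_true] at he
    simp only [Ex.eval, ih he.1, ih' he.2]
  | inner e f ih ih' =>
    simp only [Ex.bounded, Bool.and_eq_true] at he
    simp only [Ex.eval, ih he.1, ih' he.2]
  | pair e f ih ih' =>
    simp only [Ex.bounded, Bool.and_eq_true] at he
    simp only [Ex.eval, ih he.1, ih' he.2]
    rfl
  | fst e ih => simp only [Ex.eval, ih he]
  | apply K e ih =>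
    simp only [Ex.bounded, Bool.and_eq_true] at he
    simp only [Ex.eval, ih he.2, K.eval_congr h he.1]
  | solve K e ih =>
    simp only [Ex.bounded, Bool.and_eq_true] at he
    simp only [Ex.eval, ih he.2, K.eval_congr h he.1]

/-- The second operand is compiled from `k + 1` on, so it leaves the first result in register `k`
intact. The registers that the expression reads lie below `B ≤ k` and are never overwritten. -/
theorem Ex.exec_compile {B : ℕ} {s : Space} (e : Ex s) (he : e.bounded B = true) {k : ℕ}
    (hk : B ≤ k) (σ : State D) : ∃ τ c, Exec S Q (e.compile k) σ τ c e.cost ∧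
      τ s k = e.eval S Q σ ∧ Agree k σ τ := by
  induction e generalizing k σ with
  | reg s i =>
    exact ⟨_, _, Exec.instr _ _, by simp [Instr.run, State.set_self, Op.eval, Ex.eval],
      agree_set _ _ _ _⟩
  | const q => exact ⟨_, _, Exec.instr _ _, by simp [Instr.run, State.set_self, Ex.eval],
      agree_set _ _ _ _⟩
  | fill s e ih =>
    obtain ⟨τ, c, h1, h2, h3⟩ := ih he hk σ
    refine ⟨_, _, Exec.seq h1 (Exec.instr _ _), ?_, h3.trans (agree_set _ _ _ _)⟩
    simp only [Instr.run, State.set_self, Ex.eval, State.scal, h2]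
  | op o e f ih ih' =>
    simp only [Ex.bounded, Bool.and_eq_true] at he
    obtain ⟨τ, c, h1, h2, h3⟩ := ih he.1 hk σ
    obtain ⟨υ, c', h4, h5, h6⟩ := ih' he.2 (hk.trans (Nat.le_succ k)) τ
    refine ⟨_, _, Exec.seq h1 (Exec.seq h4 (Exec.instr _ _)), ?_,
      (h3.trans (h6.mono (Nat.le_succ k))).trans (agree_set _ _ _ _)⟩
    simp only [Instr.run, State.set_self, Ex.eval, h6 _ k (Nat.lt_succ_self k), h2, h5,
      f.eval_congr (h3.mono hk) he.2]
  | inner e f ih ih' =>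
    simp only [Ex.bounded, Bool.and_eq_true] at he
    obtain ⟨τ, c, h1, h2, h3⟩ := ih he.1 hk σ
    obtain ⟨υ, c', h4, h5, h6⟩ := ih' he.2 (hk.trans (Nat.le_succ k)) τ
    refine ⟨_, _, Exec.seq h1 (Exec.seq h4 (Exec.instr _ _)), ?_,
      (h3.trans (h6.mono (Nat.le_succ k))).trans (agree_set _ _ _ _)⟩
    simp only [Instr.run, State.set_self, Ex.eval, h6 _ k (Nat.lt_succ_self k), h2, h5,
      f.eval_congr (h3.mono hk) he.2]
  | pair e f ih ih' =>
    simp only [Ex.bounded, Bool.and_eq_true] at he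
    obtain ⟨τ, c, h1, h2, h3⟩ := ih he.1 hk σ
    obtain ⟨υ, c', h4, h5, h6⟩ := ih' he.2 (hk.trans (Nat.le_succ k)) τ
    refine ⟨_, _, Exec.seq h1 (Exec.seq h4 (Exec.instr _ _)), ?_,
      (h3.trans (h6.mono (Nat.le_succ k))).trans (agree_set _ _ _ _)⟩
    simp only [Instr.run, Ex.eval, h6 _ k (Nat.lt_succ_self k), h2, h5,
      f.eval_congr (h3.mono hk) he.2]
    exact State.set_self _ _ _ _
  | fst e ih =>
    obtain ⟨τ, c, h1, h2, h3⟩ := ih he hk σ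
    refine ⟨_, _, Exec.seq h1 (Exec.instr _ _), ?_, h3.trans (agree_set _ _ _ _)⟩
    simp only [Instr.run, State.set_self, Ex.eval, h2]
  | apply K e ih =>
    simp only [Ex.bounded, Bool.and_eq_true] at he
    obtain ⟨τ, c, h1, h2, h3⟩ := ih he.2 hk σ
    refine ⟨_, _, Exec.seq h1 (Exec.instr _ _), ?_, h3.trans (agree_set _ _ _ _)⟩
    simp only [Instr.run, State.set_self, Ex.eval, h2, K.eval_congr (h3.mono hk) he.1]
  | solve K e ih =>
    simp only [Ex.bounded, Bool.and_eq_true] at he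
    obtain ⟨τ, c, h1, h2, h3⟩ := ih he.2 hk σ
    refine ⟨_, _, Exec.seq h1 (Exec.instr _ _), ?_, h3.trans (agree_set _ _ _ _)⟩
    simp only [Instr.run, State.set_self, Ex.eval, h2, K.eval_congr (h3.mono hk) he.1]

theorem Exec.calls_le {P : Program} {σ τ : State D} {c k : ℕ} (h : Exec S Q P σ τ c k) :
    c ≤ k := by
  induction h with
  | skip => exact le_rfl
  | instr I σ => cases I <;> simp [Instr.calls]
  | seq _ _ h h' => omega
  | ite_true _ _ h => omega
  | ite_false _ _ h => omega
  | while_true _ _ _ h h' => omega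
  | while_false _ => omega

/-! ### Reasoning about programs -/

/-- Started in a state that agrees with `σ` on the registers below `B`, the program halts within
`n` steps in a state that agrees with one in which `φ` holds. -/
def Reach (B : ℕ) (S : LinearSystemSolver) (Q : Problem D) (P : Program) (n : ℕ) (σ : State D)
    (φ : State D → Prop) : Prop :=
  ∀ σ', Agree B σ σ' → ∃ τ' c k, Exec S Q P σ' τ' c k ∧ k ≤ n ∧ ∃ τ, Agree B τ τ' ∧ φ τ

variable {B : ℕ}

theorem Reach.mono {P : Program} {n n' : ℕ} {σ : State D} {φ ψ : State D → Prop}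
    (h : Reach B S Q P n σ φ) (hn : n ≤ n') (hφ : ∀ τ, φ τ → ψ τ) : Reach B S Q P n' σ ψ := by
  intro σ' hσ
  obtain ⟨τ', c, k, h1, h2, τ, h3, h4⟩ := h σ' hσ
  exact ⟨τ', c, k, h1, h2.trans hn, τ, h3, hφ τ h4⟩

theorem reach_skip {σ : State D} {φ : State D → Prop} (h : φ σ) : Reach B S Q .skip 0 σ φ :=
  fun σ' hσ => ⟨σ', 0, 0, Exec.skip _, le_rfl, σ, hσ, h⟩

theorem Reach.seq {P P' : Program} {n n' : ℕ} {σ : State D} {φ : State D → Prop}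
    (h : Reach B S Q P n σ fun τ => Reach B S Q P' n' τ φ) :
    Reach B S Q (.seq P P') (n + n') σ φ := by
  intro σ' hσ
  obtain ⟨τ', c, k, h1, h2, τ, h3, h4⟩ := h σ' hσ
  obtain ⟨υ', c', k', h5, h6, υ, h7, h8⟩ := h4 τ' h3
  exact ⟨υ', _, _, Exec.seq h1 h5, add_le_add h2 h6, υ, h7, h8⟩

theorem reach_ite {i j : ℕ} (hi : i < B) (hj : j < B) {P P' : Program} {n : ℕ} {σ : State D}
    {φ : State D → Prop} (h : σ.scal i < σ.scal j → Reach B S Q P n σ φ)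
    (h' : ¬ σ.scal i < σ.scal j → Reach B S Q P' n σ φ) :
    Reach B S Q (.ite i j P P') (n + 1) σ φ := by
  intro σ' hσ
  have e1 := hσ.scal hi
  have e2 := hσ.scal hj
  by_cases hc : σ.scal i < σ.scal j
  · obtain ⟨τ', c, k, h1, h2, h3⟩ := h hc σ' hσ
    exact ⟨τ', _, _, Exec.ite_true (by rwa [e1, e2]) h1, by omega, h3⟩
  · obtain ⟨τ', c, k, h1, h2, h3⟩ := h' hc σ' hσ
    exact ⟨τ', _, _, Exec.ite_false (by rwa [e1, e2]) h1, by omega, h3⟩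

/-- The invariant carries the iteration number, and the bound `k < N` has to follow from the
invariant together with the test. This gives termination and the cost at once. -/
theorem reach_while {i j : ℕ} (hi : i < B) (hj : j < B) {P : Program} {n N : ℕ}
    (I : ℕ → State D → Prop)
    (h : ∀ k σ, I k σ → σ.scal i < σ.scal j → k < N ∧ Reach B S Q P n σ (I (k + 1)))
    {σ : State D} (h0 : I 0 σ) :
    Reach B S Q (.while i j P) (N * (n + 1) + 1) σ
      fun τ => (∃ k, I k τ) ∧ ¬ τ.scal i < τ.scal j := by
  suffices H : ∀ l k σ, k + l = N → I k σ → Reach B S Q (.while i j P) (l * (n + 1) + 1) σ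
      fun τ => (∃ k, I k τ) ∧ ¬ τ.scal i < τ.scal j from H N 0 σ (zero_add N) h0
  intro l
  induction l with
  | zero =>
    intro k σ hk hI σ' hσ
    by_cases hc : σ.scal i < σ.scal j
    · have := (h k σ hI hc).1; omega
    · exact ⟨σ', _, _, Exec.while_false (by rwa [hσ.scal hi, hσ.scal hj]), by omega, σ, hσ,
        ⟨k, hI⟩, hc⟩
  | succ l ih =>
    intro k σ hk hI σ' hσ
    by_cases hc : σ.scal i < σ.scal j
    · obtain ⟨τ', c, m, h1, h2, τ, h3, h4⟩ := (h k σ hI hc).2 σ' hσ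
      obtain ⟨υ', c', m', h5, h6, h7⟩ := ih (k + 1) τ (by omega) h4 τ' h3
      refine ⟨υ', _, _, Exec.while_true (by rwa [hσ.scal hi, hσ.scal hj]) h1 h5, ?_, h7⟩
      rw [Nat.succ_mul]
      omega
    · exact ⟨σ', _, _, Exec.while_false (by rwa [hσ.scal hi, hσ.scal hj]), by omega, σ, hσ,
        ⟨k, hI⟩, hc⟩

/-- An assignment of the value of an expression to a register. -/
structure Assign where
  s : Space
  i : ℕ
  e : Ex s

/-- The effect of a list of assignments. -/
noncomputable def runAll (S : LinearSystemSolver) (Q : Problem D) (σ : State D) :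
    List Assign → State D
  | [] => σ
  | a :: l => runAll S Q (σ.set a.s a.i (a.e.eval S Q σ)) l

/-- The program of a list of assignments, with the registers from `B` on as scratch space. -/
def assigns (B : ℕ) : List Assign → Program
  | [] => .skip
  | a :: l => .seq (.seq (a.e.compile B) (.instr (.op .max a.s a.i B B))) (assigns B l)

def assignsCost : List Assign → ℕ
  | [] => 0
  | a :: l => a.e.cost + 1 + assignsCost l

def assignsBounded (B : ℕ) (l : List Assign) : Bool :=
  l.all fun a => a.e.bounded B && decide (a.i < B)

/-- An expression is evaluated in the scratch registers from `B` on and then copied, as the maximum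
with itself. Since `Reach` ignores the scratch registers, the effect is that of `runAll`. -/
theorem reach_assigns (l : List Assign) (hl : assignsBounded B l = true) {σ : State D}
    {φ : State D → Prop} (h : φ (runAll S Q σ l)) :
    Reach B S Q (assigns B l) (assignsCost l) σ φ := by
  induction l generalizing σ with
  | nil => exact reach_skip h
  | cons a l ih =>
    simp only [assignsBounded, List.all_cons, Bool.and_eq_true, decide_eq_true_eq] at hl
    refine Reach.seq fun σ' hσ => ?_
    obtain ⟨τ, c, h1, h2, h3⟩ := a.e.exec_compile (S := S) (Q := Q) hl.1.1 le_rfl σ'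
    refine ⟨_, _, _, Exec.seq h1 (Exec.instr _ _), le_rfl, _, ?_, ih hl.2 h⟩
    intro t j hj
    by_cases hta : (t, j) = (a.s, a.i)
    · cases hta
      simp only [Instr.run, State.set_self, h2, Op.eval, max_self, a.e.eval_congr hσ hl.1.1]
    · simp only [Instr.run]
      rw [State.set_of_ne _ _ hta, State.set_of_ne _ _ hta, h3 t j hj, hσ t j hj]

end Semantics

end LpRegression

/-! ### Problem data and solver calls as expressions -/

namespace LpRegression

variable {D : Dims}

/-- The objective of a problem as a function on `ℝⁿ`. -/
noncomputable def Problem.toObjective (Q : Problem D) (p : ℝ) :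
    Objective (Fin D.n → ℝ) (Fin D.m₁) (Fin D.m₂) where
  c := { toFun := fun x => Q.c ⬝ᵥ x
         map_add' := fun x y => dotProduct_add _ x y
         map_smul' := fun t x => dotProduct_smul t _ x }
  M := Q.M.mulVecLin
  N := Q.N.mulVecLin
  p := p

/-- The directions along the constraints. -/
noncomputable def Problem.directions (Q : Problem D) : Submodule ℝ (Fin D.n → ℝ) :=
  LinearMap.ker Q.A.mulVecLin

theorem Problem.mem_directions {Q : Problem D} {v : Fin D.n → ℝ} :
    v ∈ Q.directions ↔ Q.A *ᵥ v = 0 := by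
  simp [Problem.directions]

theorem Problem.toObjective_val (Q : Problem D) (p : ℝ) (x : Fin D.n → ℝ) :
    (Q.toObjective p).val x = Q.objective p x := rfl

/-! ### Values of expressions in the basic spaces -/

/-- The content of a register for points. -/
def State.pt (σ : State D) (i : ℕ) : Fin D.n → ℝ := σ .var i

/-- The content of a register for the coordinates in the `p`-norm term. -/
def State.row (σ : State D) (i : ℕ) : Fin D.m₂ → ℝ := σ .rowN i

namespace Ex

instance (s : Space) : Add (Ex s) := ⟨Ex.op .plus⟩
instance (s : Space) : Sub (Ex s) := ⟨Ex.op .minus⟩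
instance (s : Space) : Mul (Ex s) := ⟨Ex.op .times⟩
instance (s : Space) : Div (Ex s) := ⟨Ex.op .divide⟩

/-- `|e| ^ t` with a scalar exponent -/
def pow {s : Space} (e : Ex s) (t : Ex .scalar) : Ex s := .op .abspow e (.fill s t)

/-- A multiple of a vector. -/
def smul {s : Space} (t : Ex .scalar) (e : Ex s) : Ex s := .fill s t * e

/-- A scalar register. -/
abbrev sc (i : ℕ) : Ex .scalar := .reg .scalar i

/-- A register for a point. -/
abbrev vr (i : ℕ) : Ex .var := .reg .var i

/-- A register for the coordinates of a point in the `p`-norm term. -/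
abbrev rn (i : ℕ) : Ex .rowN := .reg .rowN i

variable (S : LinearSystemSolver) (Q : Problem D) (σ : State D)

/-- The value of a scalar expression. -/
noncomputable def sval (e : Ex .scalar) : ℝ := e.eval S Q σ ()

/-- The value of an expression for a point. -/
noncomputable def pval (e : Ex .var) : Fin D.n → ℝ := e.eval S Q σ

/-- The value of an expression for the coordinates in the quadratic term. -/
noncomputable def qval (e : Ex .rowM) : Fin D.m₁ → ℝ := e.eval S Q σ

/-- The value of an expression for the coordinates in the `p`-norm term. -/
noncomputable def rval (e : Ex .rowN) : Fin D.m₂ → ℝ := e.eval S Q σ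

variable {S Q σ}

@[simp] theorem sval_reg (i : ℕ) : sval S Q σ (.reg .scalar i) = σ.scal i := rfl
@[simp] theorem pval_reg (i : ℕ) : pval S Q σ (.reg .var i) = σ.pt i := rfl
@[simp] theorem rval_reg (i : ℕ) : rval S Q σ (.reg .rowN i) = σ.row i := rfl
theorem sval_const (q : ℚ) : sval S Q σ (.const q) = (q : ℝ) := rfl
@[simp] theorem sval_zero : sval S Q σ (.const 0) = 0 := by rw [sval_const]; norm_num
@[simp] theorem sval_one : sval S Q σ (.const 1) = 1 := by rw [sval_const]; norm_num
@[simp] theorem sval_two : sval S Q σ (.const 2) = 2 := by rw [sval_const]; norm_num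
@[simp] theorem sval_four : sval S Q σ (.const 4) = 4 := by rw [sval_const]; norm_num
@[simp] theorem sval_add (e f : Ex .scalar) :
    sval S Q σ (e + f) = sval S Q σ e + sval S Q σ f := rfl
@[simp] theorem sval_sub (e f : Ex .scalar) :
    sval S Q σ (e - f) = sval S Q σ e - sval S Q σ f := rfl
@[simp] theorem sval_mul (e f : Ex .scalar) :
    sval S Q σ (e * f) = sval S Q σ e * sval S Q σ f := rfl
@[simp] theorem sval_div (e f : Ex .scalar) :
    sval S Q σ (e / f) = sval S Q σ e / sval S Q σ f := rfl
@[simp] theorem sval_pow (e f : Ex .scalar) :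
    sval S Q σ (e.pow f) = |sval S Q σ e| ^ sval S Q σ f := rfl
@[simp] theorem sval_max (e f : Ex .scalar) :
    sval S Q σ (.op .max e f) = max (sval S Q σ e) (sval S Q σ f) := rfl
open Classical in
@[simp] theorem sval_le (e f : Ex .scalar) :
    sval S Q σ (.op .le e f) = if sval S Q σ e ≤ sval S Q σ f then 1 else 0 := rfl
@[simp] theorem sval_inner_var (e f : Ex .var) :
    sval S Q σ (.inner e f) = pval S Q σ e ⬝ᵥ pval S Q σ f := rfl
@[simp] theorem sval_inner_rowM (e f : Ex .rowM) :
    sval S Q σ (.inner e f) = ∑ i, qval S Q σ e i * qval S Q σ f i := rfl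
@[simp] theorem sval_inner_rowN (e f : Ex .rowN) :
    sval S Q σ (.inner e f) = ∑ i, rval S Q σ e i * rval S Q σ f i := rfl

@[simp] theorem pval_add (e f : Ex .var) :
    pval S Q σ (e + f) = pval S Q σ e + pval S Q σ f := rfl
@[simp] theorem pval_sub (e f : Ex .var) :
    pval S Q σ (e - f) = pval S Q σ e - pval S Q σ f := rfl
@[simp] theorem pval_smul (t : Ex .scalar) (e : Ex .var) :
    pval S Q σ (smul t e) = sval S Q σ t • pval S Q σ e := rfl
@[simp] theorem pval_transpose_M (e : Ex .rowM) :
    pval S Q σ (.apply (.transpose .M) e) = Q.Mᵀ *ᵥ qval S Q σ e := rfl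
@[simp] theorem pval_transpose_N (e : Ex .rowN) :
    pval S Q σ (.apply (.transpose .N) e) = Q.Nᵀ *ᵥ rval S Q σ e := rfl
@[simp] theorem qval_apply_M (e : Ex .var) :
    qval S Q σ (.apply .M e) = Q.M *ᵥ pval S Q σ e := rfl
@[simp] theorem qval_smul (t : Ex .scalar) (e : Ex .rowM) :
    qval S Q σ (smul t e) = sval S Q σ t • qval S Q σ e := rfl
@[simp] theorem rval_apply_N (e : Ex .var) :
    rval S Q σ (.apply .N e) = Q.N *ᵥ pval S Q σ e := rfl
@[simp] theorem rval_add (e f : Ex .rowN) (i : Fin D.m₂) :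
    rval S Q σ (e + f) i = rval S Q σ e i + rval S Q σ f i := rfl
@[simp] theorem rval_sub (e f : Ex .rowN) (i : Fin D.m₂) :
    rval S Q σ (e - f) i = rval S Q σ e i - rval S Q σ f i := rfl
@[simp] theorem rval_mul (e f : Ex .rowN) (i : Fin D.m₂) :
    rval S Q σ (e * f) i = rval S Q σ e i * rval S Q σ f i := rfl
@[simp] theorem rval_div (e f : Ex .rowN) (i : Fin D.m₂) :
    rval S Q σ (e / f) i = rval S Q σ e i / rval S Q σ f i := rfl
@[simp] theorem rval_pow (e : Ex .rowN) (t : Ex .scalar) (i : Fin D.m₂) :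
    rval S Q σ (e.pow t) i = |rval S Q σ e i| ^ sval S Q σ t := rfl
@[simp] theorem rval_smul (t : Ex .scalar) (e : Ex .rowN) (i : Fin D.m₂) :
    rval S Q σ (smul t e) i = sval S Q σ t * rval S Q σ e i := rfl
@[simp] theorem rval_fill (t : Ex .scalar) (i : Fin D.m₂) :
    rval S Q σ (.fill .rowN t) i = sval S Q σ t := rfl
open Classical in
@[simp] theorem rval_le (e f : Ex .rowN) (i : Fin D.m₂) :
    rval S Q σ (.op .le e f) i = if rval S Q σ e i ≤ rval S Q σ f i then 1 else 0 := rfl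

/-- The derivative of `|t| ^ p`. -/
def dpowE (e : Ex .rowN) : Ex .rowN := smul (sc 0) (e.pow (sc 0 - .const 2)) * e

/-- The second derivative of `|t| ^ p`. -/
def ddpowE (e : Ex .rowN) : Ex .rowN := smul (sc 0 * (sc 0 - .const 1)) (e.pow (sc 0 - .const 2))

@[simp] theorem rval_dpowE (e : Ex .rowN) (i : Fin D.m₂) :
    rval S Q σ (dpowE e) i = dpow (σ.scal 0) (rval S Q σ e i) := by
  simp [dpowE, dpow]

@[simp] theorem rval_ddpowE (e : Ex .rowN) (i : Fin D.m₂) :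
    rval S Q σ (ddpowE e) i = ddpow (σ.scal 0) (rval S Q σ e i) := by
  simp [ddpowE, ddpow]

/-- The objective. -/
def valE (e : Ex .var) : Ex .scalar :=
  .inner (vr 1) e + .inner (.apply .M e) (.apply .M e)
    + .inner ((Ex.apply .N e).pow (sc 0)) (.fill .rowN (.const 1))

theorem sval_valE (e : Ex .var) (hc : σ.pt 1 = Q.c) :
    sval S Q σ (valE e) = Q.objective (σ.scal 0) (pval S Q σ e) := by
  simp [valE, Problem.objective, hc, sq]

/-- The matrix of the least squares problems, with the factor of the quadratic term in a scalar
register and the weights in a vector register. -/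
def kktE : MatExpr (.sum .var .con) (.sum .var .con) :=
  .blocks (.plus (.smul 15 (.mul (.transpose .M) .M))
    (.mul (.transpose .N) (.mul (.diag .rowN 0) .N))) (.transpose .A) .A (.zero .con .con)

/-- The solution of a least squares problem. -/
def kktSolve (r : Ex .var) : Ex .var := .fst (.solve kktE (.pair r (.fill .con (.const 0))))

theorem pval_kktSolve (r : Ex .var) : pval S Q σ (kktSolve r)
    = (S.solve (kkt Q.A Q.M Q.N (σ.scal 15) (σ.row 0))
      (Sum.elim (pval S Q σ r) fun _ : Fin D.d => sval S Q σ (.const 0))) ∘ Sum.inl := rfl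

/-- Right-hand sides built from `c`, `Mᵀ` and `Nᵀ` vanish on the common kernel, so the system is
consistent and the specification of the solver applies. -/
theorem kktSolve_spec (hQ : Q.LinearTermOrthogonal) (r : Ex .var) {g : Fin D.m₁ → ℝ}
    {h : Fin D.m₂ → ℝ} {a : ℝ} (hμ : 0 < σ.scal 15) (hW : ∀ i, 0 < σ.row 0 i)
    (hr : pval S Q σ r = a • Q.c + Q.Mᵀ *ᵥ g + Q.Nᵀ *ᵥ h) :
    pval S Q σ (kktSolve r) ∈ Q.directions ∧ ∀ ξ ∈ Q.directions,
      σ.scal 15 * ∑ i, (Q.M *ᵥ pval S Q σ (kktSolve r)) i * (Q.M *ᵥ ξ) i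
        + ∑ i, σ.row 0 i * (Q.N *ᵥ pval S Q σ (kktSolve r)) i * (Q.N *ᵥ ξ) i
        = a * (Q.c ⬝ᵥ ξ) + ∑ i, g i * (Q.M *ᵥ ξ) i + ∑ i, h i * (Q.N *ᵥ ξ) i := by
  have hdot : ∀ v : Fin D.n → ℝ, v ⬝ᵥ pval S Q σ r
      = a * (Q.c ⬝ᵥ v) + ∑ i, g i * (Q.M *ᵥ v) i + ∑ i, h i * (Q.N *ᵥ v) i := by
    intro v
    rw [hr, dotProduct_add, dotProduct_add, dotProduct_smul, smul_eq_mul,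
      Matrix.dotProduct_mulVec v Q.Mᵀ, Matrix.dotProduct_mulVec v Q.Nᵀ, Matrix.vecMul_transpose,
      Matrix.vecMul_transpose, dotProduct_comm v]
    congr 1
    · congr 1
      exact Finset.sum_congr rfl fun i _ => mul_comm _ _
    · exact Finset.sum_congr rfl fun i _ => mul_comm _ _
  obtain ⟨z, hz⟩ := exists_kkt (A := Q.A) (M := Q.M) (N := Q.N) hμ hW
    (r := pval S Q σ r) (fun v h1 h2 h3 => by rw [hdot, hQ v h1 h2 h3, h1, h2]; simp)
  have hzero : (fun _ : Fin D.d => sval S Q σ (.const 0)) = 0 := by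
    funext i; simp
  obtain ⟨h1, h2⟩ := kkt_spec (S.solve_spec _ _ ⟨z, hz⟩)
  rw [pval_kktSolve, hzero]
  refine ⟨Problem.mem_directions.2 h1, fun ξ hξ => ?_⟩
  rw [h2 ξ (Problem.mem_directions.1 hξ), hdot]

end Ex

end LpRegression

namespace LpRegression

open Ex

variable {D : Dims} {S : LinearSystemSolver} {Q : Problem D}

/-! ### Effects of assignments -/

theorem State.scal_set_of_ne (σ : State D) {s : Space} {i : ℕ} (v : s.Idx D → ℝ) {j : ℕ}
    (h : (Space.scalar, j) ≠ (s, i)) : (σ.set s i v).scal j = σ.scal j :=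
  congrFun (σ.set_of_ne v h) ()

/-- The new state is generalised to any `τ` with the stated register contents. Blocks can then be
executed symbolically without nested updates in the terms. -/
theorem runAll_scalar {σ : State D} {i : ℕ} {e : Ex .scalar} {l : List Assign}
    {φ : State D → Prop} (h : ∀ τ : State D, τ.scal i = sval S Q σ e →
      (∀ j, j ≠ i → τ.scal j = σ.scal j) → τ.pt = σ.pt → τ.row = σ.row → φ (runAll S Q τ l)) :
    φ (runAll S Q σ (⟨.scalar, i, e⟩ :: l)) := by
  refine h _ ?_ (fun j hj => ?_) ?_ ?_
  · exact congrFun (State.set_self σ .scalar i _) ()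
  · exact State.scal_set_of_ne σ _ (by simpa using hj)
  · funext j; exact State.set_of_ne σ _ (by simp)
  · funext j; exact State.set_of_ne σ _ (by simp)

theorem runAll_var {σ : State D} {i : ℕ} {e : Ex .var} {l : List Assign}
    {φ : State D → Prop} (h : ∀ τ : State D, τ.pt i = pval S Q σ e →
      (∀ j, j ≠ i → τ.pt j = σ.pt j) → τ.scal = σ.scal → τ.row = σ.row → φ (runAll S Q τ l)) :
    φ (runAll S Q σ (⟨.var, i, e⟩ :: l)) := by
  refine h _ ?_ (fun j hj => ?_) ?_ ?_
  · exact State.set_self σ .var i _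
  · exact State.set_of_ne σ _ (by simpa using hj)
  · funext j; exact State.scal_set_of_ne σ _ (by simp)
  · funext j; exact State.set_of_ne σ _ (by simp)

theorem runAll_rowN {σ : State D} {i : ℕ} {e : Ex .rowN} {l : List Assign}
    {φ : State D → Prop} (h : ∀ τ : State D, τ.row i = rval S Q σ e →
      (∀ j, j ≠ i → τ.row j = σ.row j) → τ.scal = σ.scal → τ.pt = σ.pt → φ (runAll S Q τ l)) :
    φ (runAll S Q σ (⟨.rowN, i, e⟩ :: l)) := by
  refine h _ ?_ (fun j hj => ?_) ?_ ?_
  · exact State.set_self σ .rowN i _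
  · exact State.set_of_ne σ _ (by simpa using hj)
  · funext j; exact State.scal_set_of_ne σ _ (by simp)
  · funext j; exact State.set_of_ne σ _ (by simp)

theorem runAll_append (σ : State D) (l l' : List Assign) :
    runAll S Q σ (l ++ l') = runAll S Q (runAll S Q σ l) l' := by
  induction l generalizing σ with
  | nil => rfl
  | cons a l ih => exact ih _

/-! ### The better one of two points -/

/-- Replace the point in register `0` by the one in register `r` if that is better. -/
def betterBlock (r : ℕ) : List Assign :=
  [⟨.scalar, 15, .op .le (valE (vr r)) (valE (vr 0))⟩,
   ⟨.var, 0, smul (sc 15) (vr r) + smul (.const 1 - sc 15) (vr 0)⟩]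

theorem betterBlock_spec {σ : State D} {p : ℝ} (hp : σ.scal 0 = p) (hc : σ.pt 1 = Q.c) (r : ℕ)
    {φ : State D → Prop}
    (h : ∀ τ : State D, (Q.toObjective p).Better (σ.pt 0) (σ.pt r) (τ.pt 0) →
      (∀ j, j ≠ 15 → τ.scal j = σ.scal j) → (∀ j, j ≠ 0 → τ.pt j = σ.pt j) → τ.row = σ.row → φ τ) :
    φ (runAll S Q σ (betterBlock r)) := by
  refine runAll_scalar fun τ₁ a1 a2 a3 a4 => runAll_var fun τ₂ b1 b2 b3 b4 => h τ₂ ?_ ?_ ?_ ?_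
  · rw [sval_le, sval_valE _ hc, sval_valE _ hc, hp, pval_reg, pval_reg] at a1
    rw [b1]
    simp only [pval_add, pval_smul, sval_sub, sval_one, sval_reg, pval_reg, a3]
    by_cases hle : Q.objective p (σ.pt r) ≤ Q.objective p (σ.pt 0)
    · rw [if_pos hle] at a1
      rw [a1]
      simpa [Objective.Better, Problem.toObjective_val] using hle
    · rw [if_neg hle] at a1
      rw [a1]
      simpa [Objective.Better, Problem.toObjective_val] using (not_le.1 hle).le
  · intro j hj; rw [b3]; exact a2 j hj
  · intro j hj; rw [b2 j hj, a3]
  · rw [b4, a4]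

/-! ### The Newton step -/

/-- Registers of points: `0` best, `1` the vector `c`, `2` `x`, `3` `v`, `4` `s`, `5` the Newton
direction, `6` the accepted point `z`. Registers of rows: `0` weights, `1` `N y`, `2` `N s`, `3` `N
z`, `4` the negative gradient `G`. Scalars: `9` the threshold `ρ ^ p`, `10` `ρ`, `11` `lam`, `12`
the weight `2 lam / T²`, `13` the counter, `14` `θ`, `15` temporary values and the factor of the
quadratic term, `16` the energy. -/
def newtonRhs : Ex .var :=
  smul (.const 0 - .const 1) (vr 1)
    + .apply (.transpose .M) (smul (.const 0 - .const 2) (.apply .M (vr 4)))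
    + .apply (.transpose .N) (smul (.const 0 - .const 1) (dpowE (rn 2) + smul (sc 11) (rn 2 - rn 1)))

/-- Count the iteration and compute the Newton direction and its energy. -/
def newtonBlock : List Assign :=
  [⟨.scalar, 13, sc 13 + .const 1⟩,
   ⟨.rowN, 2, .apply .N (vr 4)⟩,
   ⟨.rowN, 0, ddpowE (rn 2) + .fill .rowN (sc 11)⟩,
   ⟨.scalar, 15, .const 2⟩,
   ⟨.var, 5, kktSolve newtonRhs⟩,
   ⟨.scalar, 16, .const 2 * .inner (.apply .M (vr 5)) (.apply .M (vr 5))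
      + .inner (rn 0 * .apply .N (vr 5)) (.apply .N (vr 5))⟩]

theorem newtonBlock_spec (hQ : Q.LinearTermOrthogonal) {σ : State D} {p l : ℝ} (hp : 2 ≤ p)
    (hl : 0 < l) (h0 : σ.scal 0 = p) (h11 : σ.scal 11 = l) (hc : σ.pt 1 = Q.c)
    {φ : State D → Prop}
    (h : ∀ τ : State D,
      (Q.toObjective p).IsNewton Q.directions l (σ.row 1) (σ.pt 4) (τ.pt 5) →
      τ.scal 16 = (Q.toObjective p).energy l (σ.pt 4) (τ.pt 5) →
      τ.row 2 = Q.N *ᵥ σ.pt 4 → τ.row 1 = σ.row 1 → τ.scal 13 = σ.scal 13 + 1 →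
      (∀ j, j ≠ 13 → j ≠ 15 → j ≠ 16 → τ.scal j = σ.scal j) →
      (∀ j, j ≠ 5 → τ.pt j = σ.pt j) → φ τ) :
    φ (runAll S Q σ newtonBlock) := by
  refine runAll_scalar fun τ₁ a1 a2 a3 a4 => ?_
  refine runAll_rowN fun τ₂ b1 b2 b3 b4 => ?_
  refine runAll_rowN fun τ₃ c1 c2 c3 c4 => ?_
  refine runAll_scalar fun τ₄ d1 d2 d3 d4 => ?_
  refine runAll_var fun τ₅ e1 e2 e3 e4 => ?_
  refine runAll_scalar fun τ₆ f1 f2 f3 f4 => ?_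
  have hs : τ₄.pt = σ.pt := by rw [d3, c4, b4, a3]
  have hrow2 : τ₄.row 2 = Q.N *ᵥ σ.pt 4 := by
    rw [d4, c2 2 (by norm_num), b1, rval_apply_N, pval_reg, a3]
  have hrow1 : τ₄.row 1 = σ.row 1 := by
    rw [d4, c2 1 (by norm_num), b2 1 (by norm_num), a4]
  have hsc : ∀ j, j ≠ 13 → j ≠ 15 → τ₄.scal j = σ.scal j := fun j h1 h2 => by
    rw [d2 j h2, c3, b3, a2 j h1]
  have hW : ∀ i, τ₄.row 0 i = ddpow p ((Q.N *ᵥ σ.pt 4) i) + l := fun i => by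
    have h2 : τ₂.row 2 = Q.N *ᵥ σ.pt 4 := by rw [b1, rval_apply_N, pval_reg, a3]
    rw [d4, c1, rval_add, rval_ddpowE, rval_fill, rval_reg, sval_reg, h2, b3,
      a2 0 (by norm_num), a2 11 (by norm_num), h0, h11]
  have hmu : τ₄.scal 15 = 2 := by rw [d1, sval_two]
  have hW0 : ∀ i, 0 < τ₄.row 0 i := fun i => by
    rw [hW]; have := ddpow_nonneg hp ((Q.N *ᵥ σ.pt 4) i); linarith
  obtain ⟨g1, g2⟩ := kktSolve_spec (S := S) hQ newtonRhs (g := (-2 : ℝ) • (Q.M *ᵥ σ.pt 4))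
    (h := fun i => -(dpow p ((Q.N *ᵥ σ.pt 4) i) + l * ((Q.N *ᵥ σ.pt 4) i - σ.row 1 i))) (a := -1)
    (by rw [hmu]; norm_num) hW0 (by
      simp only [newtonRhs, pval_add, pval_smul, pval_transpose_M, pval_transpose_N, qval_smul,
        qval_apply_M, sval_sub, sval_zero, sval_one, sval_two, zero_sub, pval_reg, hs, hc]
      congr 1
      congr 1
      funext i
      simp only [rval_smul, rval_add, rval_sub, rval_dpowE, rval_reg, sval_sub, sval_zero, sval_one,
        sval_reg, hrow2, hrow1, hsc 0 (by norm_num) (by norm_num), h0,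
        hsc 11 (by norm_num) (by norm_num), h11]
      ring)
  rw [← e1] at g1 g2
  have h5 : τ₆.pt 5 = τ₅.pt 5 := by rw [f3]
  refine h τ₆ ⟨by rw [h5]; exact g1, fun ξ hξ => ?_⟩ ?_ ?_ ?_ ?_ ?_ ?_
  · rw [h5]
    have h6 := g2 ξ hξ
    simp only [hmu, hW, Finset.mul_sum] at h6
    simp only [Objective.grad, Problem.toObjective, Matrix.mulVecLin_apply, Finset.mul_sum] at h6 ⊢
    have e7 : ∑ i, 2 * (Q.M *ᵥ τ₅.pt 5) i * (Q.M *ᵥ ξ) i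
        = ∑ i, 2 * ((Q.M *ᵥ τ₅.pt 5) i * (Q.M *ᵥ ξ) i) :=
      Finset.sum_congr rfl fun i _ => by ring
    rw [e7, h6]
    simp only [Pi.smul_apply, smul_eq_mul, LinearMap.coe_mk, AddHom.coe_mk]
    rw [add_assoc (Q.c ⬝ᵥ ξ), add_assoc (Q.c ⬝ᵥ ξ), add_assoc, neg_one_mul, neg_add]
    congr 1
    rw [add_assoc, neg_add, ← Finset.sum_neg_distrib, ← Finset.sum_add_distrib,
      ← Finset.sum_neg_distrib]
    congr 1
    · exact Finset.sum_congr rfl fun i _ => by ring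
    · exact Finset.sum_congr rfl fun i _ => by ring
  · rw [f1]
    simp only [sval_add, sval_mul, sval_two, sval_inner_rowM, sval_inner_rowN, qval_apply_M,
      pval_reg, rval_mul, rval_reg, rval_apply_N, e4, hW, Finset.mul_sum, Objective.energy,
      Problem.toObjective, Matrix.mulVecLin_apply, h5]
    congr 1
    · exact Finset.sum_congr rfl fun i _ => by ring
    · exact Finset.sum_congr rfl fun i _ => by ring
  · rw [f4, e4, hrow2]
  · rw [f4, e4, hrow1]
  · rw [f2 13 (by norm_num), e3, d2 13 (by norm_num), c3, b3, a1, sval_add, sval_one, sval_reg]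
  · intro j h1 h2 h3
    rw [f2 j h3, e3, hsc j h1 h2]
  · intro j h1
    rw [f3, e2 j h1, hs]

/-- A damped Newton step. -/
def dampedBlock : List Assign :=
  ⟨.var, 4, vr 4 + smul ((sc 9 / sc 16).pow (.const 1 / .const 2)) (vr 5)⟩ :: betterBlock 4

theorem dampedBlock_spec {σ : State D} {p u En : ℝ} (h0 : σ.scal 0 = p) (hc : σ.pt 1 = Q.c)
    (h9 : σ.scal 9 = u) (h16 : σ.scal 16 = En) (hu : 0 ≤ u / En) {φ : State D → Prop}
    (h : ∀ τ : State D, τ.pt 4 = σ.pt 4 + √(u / En) • σ.pt 5 →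
      (Q.toObjective p).Better (σ.pt 0) (τ.pt 4) (τ.pt 0) →
      (∀ j, j ≠ 15 → τ.scal j = σ.scal j) →
      (∀ j, j ≠ 0 → j ≠ 4 → τ.pt j = σ.pt j) → τ.row = σ.row → φ τ) :
    φ (runAll S Q σ dampedBlock) := by
  refine runAll_var fun τ₁ a1 a2 a3 a4 => betterBlock_spec (p := p) (by rw [a3, h0])
    (by rw [a2 1 (by norm_num), hc]) 4 fun τ₂ b1 b2 b3 b4 => h τ₂ ?_ ?_ ?_ ?_ ?_
  · rw [b3 4 (by norm_num), a1, pval_add, pval_smul]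
    simp only [sval_pow, sval_div, sval_reg, pval_reg, sval_one, sval_two, h9, h16]
    rw [Real.sqrt_eq_rpow, abs_of_nonneg hu]
  · rw [b3 4 (by norm_num)]
    rwa [a2 0 (by norm_num)] at b1
  · intro j hj; rw [b2 j hj, a3]
  · intro j h1 h2; rw [b3 j h1, a2 j h2]
  · rw [b4, a4]

end LpRegression

namespace LpRegression

open Ex

variable {D : Dims} {S : LinearSystemSolver} {Q : Problem D}

/-! ### The accelerated step -/

/-- The direction in which the next point is extrapolated. -/
def moveE : Ex .rowN := .apply .N (vr 3 - vr 2)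

/-- The absolute value. -/
def absE (e : Ex .rowN) : Ex .rowN := e.pow (.const 1)

def nearE : Ex .rowN := .op .le (absE (rn 3)) (.fill .rowN (sc 10))

def signE : Ex .rowN := .op .le (.fill .rowN (.const 0)) moveE

/-- The case distinctions of `room` are made by `0`-`1` indicators, since branching is available
only on scalars. -/
def roomE : Ex .rowN :=
  nearE * (.fill .rowN ((.const 1 + .const 1 / sc 0) * sc 10)
      - rn 3 * (signE * .fill .rowN (.const 2) - .fill .rowN (.const 1)))
    + (.fill .rowN (.const 1) - nearE) * (absE (rn 3) / .fill .rowN (sc 0))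

def orderE : Ex .scalar := .const 4 * sc 0 * sc 5

def stepE : Ex .scalar :=
  .const 1 / .op .max (sc 7)
    ((Ex.inner ((absE moveE / roomE).pow orderE) (.fill .rowN (.const 1))).pow (.const 1 / orderE))

theorem rval_absE {σ : State D} (e : Ex .rowN) (i : Fin D.m₂) :
    rval S Q σ (absE e) i = |rval S Q σ e i| := by
  simp [absE]

theorem rval_roomE {σ : State D} (i : Fin D.m₂) :
    rval S Q σ roomE i
      = room (σ.scal 0) (σ.scal 10) (σ.row 3 i) ((Q.N *ᵥ (σ.pt 3 - σ.pt 2)) i) := by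
  have h1 : rval S Q σ nearE i = if |σ.row 3 i| ≤ σ.scal 10 then 1 else 0 := by
    simp [nearE, rval_absE]
  have h2 : rval S Q σ signE i = if 0 ≤ (Q.N *ᵥ (σ.pt 3 - σ.pt 2)) i then 1 else 0 := by
    simp only [signE, moveE, rval_le, rval_fill, sval_zero, rval_apply_N, pval_sub, pval_reg]
  simp only [roomE, rval_add, rval_mul, rval_sub, rval_div, rval_fill, rval_absE, rval_reg, h1, h2,
    sval_mul, sval_add, sval_div, sval_one, sval_two, sval_reg, room]
  by_cases h3 : |σ.row 3 i| ≤ σ.scal 10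
  · by_cases h4 : 0 ≤ (Q.N *ᵥ (σ.pt 3 - σ.pt 2)) i
    · simp only [if_pos h3, if_pos h4]; ring
    · simp only [if_pos h3, if_neg h4]; ring
  · simp only [if_neg h3]; ring

theorem sval_stepE {σ : State D} : sval S Q σ stepE
    = stepSize (σ.scal 0) (4 * σ.scal 0 * σ.scal 5) (σ.scal 10) (σ.scal 7) (σ.row 3)
      (Q.N *ᵥ (σ.pt 3 - σ.pt 2)) := by
  have h0 : 0 ≤ ∑ i, |(|(Q.N *ᵥ (σ.pt 3 - σ.pt 2)) i|
      / room (σ.scal 0) (σ.scal 10) (σ.row 3 i) ((Q.N *ᵥ (σ.pt 3 - σ.pt 2)) i))|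
        ^ (4 * σ.scal 0 * σ.scal 5) :=
    Finset.sum_nonneg fun i _ => Real.rpow_nonneg (abs_nonneg _) _
  simp only [stepE, orderE, moveE, sval_div, sval_one, sval_max, sval_reg, sval_pow,
    sval_inner_rowN, rval_pow, rval_div, rval_absE, rval_roomE, rval_fill, sval_mul, sval_four,
    rval_apply_N, pval_sub, pval_reg, mul_one, stepSize, abs_of_nonneg h0]

/-- The unknown is the increment `v' - v`, so the curvature term at `v - z` moves to the right-hand
side. The zero multiple of `c` only brings it to the form of `kktSolve_spec`. -/
def accelerationRhs : Ex .var :=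
  smul (.const 0) (vr 1)
    + .apply (.transpose .M) (smul (.const 0 - .const 2 * sc 14) (.apply .M (vr 3 - vr 6)))
    + .apply (.transpose .N) (smul (sc 14) (rn 4)
      - smul (sc 14 * sc 0) ((rn 3).pow (sc 0 - .const 2)) * .apply .N (vr 3 - vr 6))

/-- The end of the Newton steps: the data of the accelerated step. -/
def gradientBlock : List Assign :=
  [⟨.var, 6, vr 4 + vr 5⟩,
   ⟨.rowN, 3, .apply .N (vr 6)⟩,
   ⟨.rowN, 4, smul (sc 11) (rn 3 - rn 1)
      - (dpowE (rn 3) - dpowE (rn 2) - ddpowE (rn 2) * .apply .N (vr 5))⟩,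
   ⟨.scalar, 15, .const 2 * sc 14⟩,
   ⟨.rowN, 0, smul (sc 14 * sc 0) ((rn 3).pow (sc 0 - .const 2)) + .fill .rowN (sc 12)⟩]

theorem gradientBlock_spec {σ : State D} {p : ℝ} (h0 : σ.scal 0 = p)
    (h2 : σ.row 2 = Q.N *ᵥ σ.pt 4) {φ : State D → Prop}
    (h : ∀ τ : State D, τ.pt 6 = σ.pt 4 + σ.pt 5 → τ.row 3 = Q.N *ᵥ (σ.pt 4 + σ.pt 5) →
      (∀ i, τ.row 4 i = σ.scal 11 * ((Q.N *ᵥ (σ.pt 4 + σ.pt 5)) i - σ.row 1 i)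
        - (Q.toObjective p).residual (σ.pt 4) (σ.pt 5) i) →
      τ.scal 15 = 2 * σ.scal 14 →
      (∀ i, τ.row 0 i
        = σ.scal 14 * p * |(Q.N *ᵥ (σ.pt 4 + σ.pt 5)) i| ^ (p - 2) + σ.scal 12) →
      (∀ j, j ≠ 15 → τ.scal j = σ.scal j) → (∀ j, j ≠ 6 → τ.pt j = σ.pt j) → φ τ) :
    φ (runAll S Q σ gradientBlock) := by
  refine runAll_var fun τ₁ a1 a2 a3 a4 => ?_
  refine runAll_rowN fun τ₂ b1 b2 b3 b4 => ?_
  refine runAll_rowN fun τ₃ c1 c2 c3 c4 => ?_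
  refine runAll_scalar fun τ₄ d1 d2 d3 d4 => ?_
  refine runAll_rowN fun τ₅ e1 e2 e3 e4 => ?_
  have hz : τ₂.pt 6 = σ.pt 4 + σ.pt 5 := by rw [b4, a1, pval_add, pval_reg, pval_reg]
  have h3 : τ₂.row 3 = Q.N *ᵥ (σ.pt 4 + σ.pt 5) := by
    rw [b1, rval_apply_N, pval_reg, a1, pval_add, pval_reg, pval_reg]
  refine h τ₅ ?_ ?_ ?_ ?_ ?_ ?_ ?_
  · rw [e4, d3, c4, hz]
  · rw [e2 3 (by norm_num), d4, c2 3 (by norm_num), h3]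
  · intro i
    rw [e2 4 (by norm_num), d4, c1]
    simp only [rval_sub, rval_smul, rval_mul, rval_dpowE, rval_ddpowE, rval_reg, rval_apply_N,
      pval_reg, sval_reg, h3, b2 1 (by norm_num), b2 2 (by norm_num), b3, a3, a4, h0, h2, b4,
      a2 5 (by norm_num), Objective.residual, Problem.toObjective, Matrix.mulVecLin_apply]
  · rw [e3, d1, sval_mul, sval_two, sval_reg, c3, b3, a3]
  · intro i
    rw [e1]
    simp only [rval_add, rval_smul, rval_pow, rval_fill, rval_reg, sval_mul, sval_sub, sval_two,
      sval_reg, d4, c2 3 (by norm_num), h3, d2 14 (by norm_num), d2 0 (by norm_num),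
      d2 12 (by norm_num), c3, b3, a3, h0]
  · intro j hj; rw [e3, d2 j hj, c3, b3, a3]
  · intro j hj; rw [e4, d3, c4, b4, a2 j hj]

/-- The accelerated step. -/
def accelerationBlock : List Assign :=
  [⟨.var, 3, vr 3 + kktSolve accelerationRhs⟩,
   ⟨.var, 2, vr 6⟩,
   ⟨.scalar, 14, stepE⟩,
   ⟨.var, 4, vr 2 + smul (sc 14) (vr 3 - vr 2)⟩,
   ⟨.rowN, 1, .apply .N (vr 4)⟩] ++ betterBlock 2

theorem accelerationBlock_spec (hQ : Q.LinearTermOrthogonal) {σ : State D} {p θ β : ℝ}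
    {z : Fin D.n → ℝ} {G : Fin D.m₂ → ℝ} (hp : 2 ≤ p) (hθ : 0 < θ) (hβ : 0 < β)
    (h0 : σ.scal 0 = p) (hc : σ.pt 1 = Q.c) (h14 : σ.scal 14 = θ) (h15 : σ.scal 15 = 2 * θ)
    (hz : σ.pt 6 = z) (h3 : σ.row 3 = Q.N *ᵥ z) (h4 : σ.row 4 = G)
    (hW : ∀ i, σ.row 0 i = θ * p * |(Q.N *ᵥ z) i| ^ (p - 2) + β) {φ : State D → Prop}
    (h : ∀ τ : State D, τ.pt 2 = z → τ.pt 3 - σ.pt 3 ∈ Q.directions →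
      (∀ ξ ∈ Q.directions, θ * (Q.toObjective p).curvB z (τ.pt 3 - z) ξ
          + β * ∑ i, (Q.N *ᵥ (τ.pt 3 - σ.pt 3)) i * (Q.N *ᵥ ξ) i
        = θ * ∑ i, G i * (Q.N *ᵥ ξ) i) →
      τ.scal 14 = stepSize p (4 * p * σ.scal 5) (σ.scal 10) (σ.scal 7) (Q.N *ᵥ z)
        (Q.N *ᵥ (τ.pt 3 - z)) →
      τ.pt 4 = z + τ.scal 14 • (τ.pt 3 - z) → τ.row 1 = Q.N *ᵥ τ.pt 4 →
      (Q.toObjective p).Better (σ.pt 0) z (τ.pt 0) →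
      (∀ j, j ≠ 14 → j ≠ 15 → τ.scal j = σ.scal j) → τ.pt 1 = Q.c → φ τ) :
    φ (runAll S Q σ accelerationBlock) := by
  rw [accelerationBlock, runAll_append]
  let ψ : State D → Prop := fun τ => φ (runAll S Q τ (betterBlock 2))
  refine runAll_var (φ := ψ) fun τ₁ a1 a2 a3 a4 => ?_
  refine runAll_var (φ := ψ) fun τ₂ b1 b2 b3 b4 => ?_
  refine runAll_scalar (φ := ψ) fun τ₃ c1 c2 c3 c4 => ?_
  refine runAll_var (φ := ψ) fun τ₄ d1 d2 d3 d4 => ?_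
  refine runAll_rowN (φ := ψ) fun τ₅ e1 e2 e3 e4 => ?_
  refine betterBlock_spec (p := p) (Q := Q) (S := S) ?_ ?_ 2 fun τ₆ f1 f2 f3 f4 => ?_
  · show τ₅.scal 0 = p
    rw [e3, d3, c2 0 (by norm_num), b3, a3, h0]
  · show τ₅.pt 1 = Q.c
    rw [e4, d2 1 (by norm_num), c3, b2 1 (by norm_num), a2 1 (by norm_num), hc]
  change (Q.toObjective p).Better (τ₅.pt 0) (τ₅.pt 2) (τ₆.pt 0) at f1
  change ∀ j, j ≠ 15 → τ₆.scal j = τ₅.scal j at f2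
  change ∀ j, j ≠ 0 → τ₆.pt j = τ₅.pt j at f3
  change τ₆.row = τ₅.row at f4
  have hpw : ∀ i, 0 ≤ |(Q.N *ᵥ z) i| ^ (p - 2) := fun i => Real.rpow_nonneg (abs_nonneg _) _
  obtain ⟨g1, g2⟩ := kktSolve_spec (S := S) hQ accelerationRhs (σ := σ)
    (g := (-(2 * θ)) • (Q.M *ᵥ (σ.pt 3 - z)))
    (h := fun i => θ * G i - θ * p * |(Q.N *ᵥ z) i| ^ (p - 2) * (Q.N *ᵥ (σ.pt 3 - z)) i) (a := 0)
    (by rw [h15]; positivity)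
    (fun i => by rw [hW]; have := hpw i; positivity) (by
      simp only [accelerationRhs, pval_add, pval_smul, pval_transpose_M, pval_transpose_N,
        qval_smul, qval_apply_M, sval_sub, sval_zero, sval_two, sval_mul, sval_reg, zero_sub,
        pval_reg, pval_sub, hz, hc, h14]
      congr 1
      congr 1
      funext i
      simp only [rval_smul, rval_mul, rval_sub, rval_pow, rval_reg, rval_apply_N, sval_sub,
        sval_mul, sval_two, sval_reg, pval_sub, pval_reg, h3, h4, hz, h14, h0])
  set w := pval S Q σ (kktSolve accelerationRhs) with hw
  have hv1 : τ₁.pt 3 = σ.pt 3 + w := by rw [a1, pval_add, pval_reg]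
  have hv : τ₆.pt 3 = σ.pt 3 + w := by
    rw [f3 3 (by norm_num), e4, d2 3 (by norm_num), c3, b2 3 (by norm_num), hv1]
  have hvw : τ₆.pt 3 - σ.pt 3 = w := by rw [hv, add_sub_cancel_left]
  have hx2 : τ₂.pt 2 = z := by rw [b1, pval_reg, a2 6 (by norm_num), hz]
  have hx4 : τ₄.pt 2 = z := by rw [d2 2 (by norm_num), c3, hx2]
  have hv2 : τ₂.pt 3 = τ₆.pt 3 := by rw [hv, b2 3 (by norm_num), hv1]
  have hθ' : τ₆.scal 14 = τ₃.scal 14 := by rw [f2 14 (by norm_num), e3, d3]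
  refine h τ₆ ?_ ?_ ?_ ?_ ?_ ?_ ?_ ?_ ?_
  · rw [f3 2 (by norm_num), e4, hx4]
  · rw [hvw]; exact g1
  · intro ξ hξ
    have h5 := g2 ξ hξ
    rw [hvw]
    simp only [h15, hW, zero_mul, zero_add, Pi.smul_apply, smul_eq_mul] at h5
    have e7 : τ₆.pt 3 - z = (σ.pt 3 - z) + w := by rw [hv]; abel
    rw [e7]
    simp only [Objective.curvB, Problem.toObjective, Matrix.mulVecLin_apply, Matrix.mulVec_add,
      Pi.add_apply]
    have e8 : ∑ i, -(2 * θ) * (Q.M *ᵥ (σ.pt 3 - z)) i * (Q.M *ᵥ ξ) i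
        = -(θ * ∑ i, 2 * (Q.M *ᵥ (σ.pt 3 - z)) i * (Q.M *ᵥ ξ) i) := by
      rw [Finset.mul_sum, ← Finset.sum_neg_distrib]
      exact Finset.sum_congr rfl fun i _ => by ring
    have e9 : ∑ i, 2 * ((Q.M *ᵥ (σ.pt 3 - z)) i + (Q.M *ᵥ w) i) * (Q.M *ᵥ ξ) i
        = ∑ i, 2 * (Q.M *ᵥ (σ.pt 3 - z)) i * (Q.M *ᵥ ξ) i
          + 2 * ∑ i, (Q.M *ᵥ w) i * (Q.M *ᵥ ξ) i := by
      rw [Finset.mul_sum, ← Finset.sum_add_distrib]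
      exact Finset.sum_congr rfl fun i _ => by ring
    have e10 : θ * ∑ i, p * |(Q.N *ᵥ z) i| ^ (p - 2)
          * ((Q.N *ᵥ (σ.pt 3 - z)) i + (Q.N *ᵥ w) i) * (Q.N *ᵥ ξ) i
        + β * ∑ i, (Q.N *ᵥ w) i * (Q.N *ᵥ ξ) i
        = ∑ i, (θ * p * |(Q.N *ᵥ z) i| ^ (p - 2) + β) * (Q.N *ᵥ w) i * (Q.N *ᵥ ξ) i
          - ∑ i, (θ * G i - θ * p * |(Q.N *ᵥ z) i| ^ (p - 2) * (Q.N *ᵥ (σ.pt 3 - z)) i)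
            * (Q.N *ᵥ ξ) i + θ * ∑ i, G i * (Q.N *ᵥ ξ) i := by
      simp only [Finset.mul_sum]
      rw [← Finset.sum_add_distrib, ← Finset.sum_sub_distrib, ← Finset.sum_add_distrib]
      exact Finset.sum_congr rfl fun i _ => by ring
    rw [e8] at h5
    rw [e9, mul_add, add_assoc, e10]
    linarith
  · rw [hθ', c1, sval_stepE, b3, a3, h0, b4, a4, h3, hx2, hv2]
  · rw [f3 4 (by norm_num), e4, d1]
    simp only [pval_add, pval_smul, pval_sub, pval_reg, sval_reg, c3, hx2, hv2, hθ']
  · rw [f4, e1, rval_apply_N, pval_reg, f3 4 (by norm_num), e4]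
  · rw [e4, hx4, d2 0 (by norm_num), c3, b2 0 (by norm_num), a2 0 (by norm_num)] at f1
    exact f1
  · intro j h5 h6
    rw [f2 j h6, e3, d3, c2 j h5, b3, a3]
  · rw [f3 1 (by norm_num), e4, d2 1 (by norm_num), c3, b2 1 (by norm_num), a2 1 (by norm_num), hc]

end LpRegression

namespace LpRegression

open Ex

variable {D : Dims} {S : LinearSystemSolver} {Q : Problem D} {p ε δ : ℝ}

/-! ### The registers during an epoch -/

/-- The registers whose contents are fixed after the initialization. -/
structure Static (Q : Problem D) (p ε : ℝ) (σ : State D) : Prop where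
  reg_p : σ.scal 0 = p
  reg_ε : σ.scal 1 = ε
  reg_m : σ.scal 5 = D.m₂
  reg_T : σ.scal 7 = horizon p D.m₂
  reg_count : σ.scal 8 = 5 * horizon p D.m₂
  reg_τ : σ.scal 19 = tau p D.m₂
  reg_one : σ.scal 20 = 1
  reg_c : σ.pt 1 = Q.c

/-- The registers whose contents are fixed during an epoch. -/
structure Level (D : Dims) (p δ : ℝ) (σ : State D) : Prop where
  reg_δ : σ.scal 6 = δ
  reg_u : σ.scal 9 = δ / tau p D.m₂
  reg_ρ : σ.scal 10 = radius p D.m₂ δ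
  reg_l : σ.scal 11 = lam p (radius p D.m₂ δ)
  reg_β : σ.scal 12 = 2 * lam p (radius p D.m₂ δ) / horizon p D.m₂ ^ 2

/-- The registers that hold an iterate. -/
structure Holds (Q : Problem D) (σ : State D) (I : Iterate (Fin D.n → ℝ)) : Prop where
  best : σ.pt 0 = I.best
  x : σ.pt 2 = I.x
  v : σ.pt 3 = I.v
  s : σ.pt 4 = I.s
  θ : σ.scal 14 = I.θ
  y : σ.row 1 = Q.N *ᵥ I.y

theorem Static.congr {σ τ : State D} (h : Static Q p ε σ)
    (hs : ∀ j, j = 0 ∨ j = 1 ∨ j = 5 ∨ j = 7 ∨ j = 8 ∨ j = 19 ∨ j = 20 → τ.scal j = σ.scal j)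
    (hc : τ.pt 1 = Q.c) : Static Q p ε τ where
  reg_p := (hs 0 (by simp)).trans h.reg_p
  reg_ε := (hs 1 (by simp)).trans h.reg_ε
  reg_m := (hs 5 (by simp)).trans h.reg_m
  reg_T := (hs 7 (by simp)).trans h.reg_T
  reg_count := (hs 8 (by simp)).trans h.reg_count
  reg_τ := (hs 19 (by simp)).trans h.reg_τ
  reg_one := (hs 20 (by simp)).trans h.reg_one
  reg_c := hc

theorem Level.congr {σ τ : State D} (h : Level D p δ σ)
    (hs : ∀ j, j = 6 ∨ j = 9 ∨ j = 10 ∨ j = 11 ∨ j = 12 → τ.scal j = σ.scal j) :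
    Level D p δ τ where
  reg_δ := (hs 6 (by simp)).trans h.reg_δ
  reg_u := (hs 9 (by simp)).trans h.reg_u
  reg_ρ := (hs 10 (by simp)).trans h.reg_ρ
  reg_l := (hs 11 (by simp)).trans h.reg_l
  reg_β := (hs 12 (by simp)).trans h.reg_β

/-- The body of the inner loop. -/
def tickProgram : Program :=
  .seq (assigns 30 newtonBlock) (.ite 9 16 (assigns 30 dampedBlock)
    (assigns 30 (gradientBlock ++ accelerationBlock)))

def tickCost : ℕ :=
  assignsCost newtonBlock
    + (assignsCost dampedBlock + assignsCost (gradientBlock ++ accelerationBlock) + 1)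

theorem horizon_pos {p m : ℝ} (hp : 2 ≤ p) (hm : 1 ≤ m) : 0 < horizon p m := by
  have := one_le_tau hp hm
  unfold horizon
  positivity

/-- One pass through the loop body realises `Tick`. Positivity of `θ` is required because it enters
the weights of the second linear system. -/
theorem reach_tick (hQ : Q.LinearTermOrthogonal) (hp : 2 ≤ p) (hδ : 0 < δ) (hm : 1 ≤ D.m₂)
    {σ : State D} {I : Iterate (Fin D.n → ℝ)} (hσ : Static Q p ε σ) (hL : Level D p δ σ)
    (hI : Holds Q σ I) (hθ : 0 < I.θ) :
    Reach 30 S Q tickProgram tickCost σ fun τ =>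
      (∃ J, (Q.toObjective p).Tick Q.directions (radius p D.m₂ δ) (horizon p D.m₂)
        (4 * p * D.m₂) I J ∧ Holds Q τ J) ∧ Static Q p ε τ ∧ Level D p δ τ ∧
      τ.scal 13 = σ.scal 13 + 1 ∧ τ.scal 17 = σ.scal 17 ∧ τ.scal 18 = σ.scal 18 := by
  have hm1 : (1 : ℝ) ≤ D.m₂ := by exact_mod_cast hm
  have hρ := radius_pos hp hm1 hδ
  have hl := lam_pos hp hρ
  have hT := horizon_pos hp hm1
  have hu := radius_rpow hp hm1 hδ
  have hτ := one_le_tau hp hm1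
  -- An arbitrary postcondition `ψ` keeps the goals of the block lemmas small.
  suffices H : ∀ ψ : State D → Prop, (∀ τ : State D,
      (∃ J, (Q.toObjective p).Tick Q.directions (radius p D.m₂ δ) (horizon p D.m₂)
        (4 * p * D.m₂) I J ∧ Holds Q τ J) ∧ Static Q p ε τ ∧ Level D p δ τ ∧
      τ.scal 13 = σ.scal 13 + 1 ∧ τ.scal 17 = σ.scal 17 ∧ τ.scal 18 = σ.scal 18 → ψ τ) →
      Reach 30 S Q tickProgram tickCost σ ψ from H _ fun _ h => h
  intro ψ hψ
  refine Reach.seq ((reach_assigns _ rfl ?_).mono le_rfl fun τ h => h)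
  refine newtonBlock_spec (φ := fun τ' => Reach 30 S Q _ _ τ' ψ) hQ hp hl hσ.reg_p hL.reg_l hσ.reg_c fun τ a1 a2 a3 a4 a5 a6 a7 => ?_
  rw [hI.s, hI.y] at a1
  rw [hI.s] at a2 a3
  have hNy : Q.N *ᵥ I.y = (Q.toObjective p).N I.y := rfl
  rw [hNy] at a1
  have hE0 := (Q.toObjective p).energy_nonneg hp hl.le I.s (τ.pt 5)
  refine reach_ite (by norm_num) (by norm_num) (fun hc => ?_) fun hc => ?_
  · rw [a6 9 (by norm_num) (by norm_num) (by norm_num), hL.reg_u, a2, ← hu] at hc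
    refine (reach_assigns dampedBlock rfl (dampedBlock_spec (p := p) (u := δ / tau p D.m₂)
      (En := (Q.toObjective p).energy (lam p (radius p D.m₂ δ)) I.s (τ.pt 5)) ?_ ?_ ?_ a2
      (by rw [← hu]; positivity) (φ := ψ) fun υ b1 b2 b3 b4 b5 => ?_)).mono
      (by omega) fun υ h => h
    · rw [a6 0 (by norm_num) (by norm_num) (by norm_num), hσ.reg_p]
    · rw [a7 1 (by norm_num), hσ.reg_c]
    · rw [a6 9 (by norm_num) (by norm_num) (by norm_num), hL.reg_u]
    · rw [a7 4 (by norm_num), hI.s, ← hu] at b1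
      rw [a7 0 (by norm_num), hI.best] at b2
      have hsc : ∀ j, j ≠ 13 → j ≠ 15 → j ≠ 16 → υ.scal j = σ.scal j := fun j h1 h2 h3 => by
        rw [b3 j h2, a6 j h1 h2 h3]
      refine hψ υ ⟨⟨⟨υ.pt 0, I.x, I.v, υ.pt 4, I.θ⟩, ⟨τ.pt 5, a1, Or.inl ⟨hc, rfl, rfl, rfl, b1, b2⟩⟩,
        rfl, ?_, ?_, rfl, ?_, ?_⟩, hσ.congr ?_ ?_, hL.congr ?_, ?_, ?_, ?_⟩
      · rw [b4 2 (by norm_num) (by norm_num), a7 2 (by norm_num), hI.x]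
      · rw [b4 3 (by norm_num) (by norm_num), a7 3 (by norm_num), hI.v]
      · rw [hsc 14 (by norm_num) (by norm_num) (by norm_num), hI.θ]
      · rw [b5, a4, hI.y]; rfl
      · intro j hj
        exact hsc j (by omega) (by omega) (by omega)
      · rw [b4 1 (by norm_num) (by norm_num), a7 1 (by norm_num), hσ.reg_c]
      · intro j hj
        exact hsc j (by omega) (by omega) (by omega)
      · rw [b3 13 (by norm_num), a5]
      · exact hsc 17 (by norm_num) (by norm_num) (by norm_num)
      · exact hsc 18 (by norm_num) (by norm_num) (by norm_num)
  · rw [a6 9 (by norm_num) (by norm_num) (by norm_num), hL.reg_u, a2, ← hu, not_lt] at hc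
    refine (reach_assigns (gradientBlock ++ accelerationBlock) rfl ?_).mono
      (by omega) fun υ h => h
    rw [runAll_append]
    refine gradientBlock_spec (φ := fun υ => ψ (runAll S Q υ accelerationBlock)) (p := p)
      ?_ ?_ fun υ b1 b2 b3 b4 b5 b6 b7 => ?_
    · rw [a6 0 (by norm_num) (by norm_num) (by norm_num), hσ.reg_p]
    · rw [a3, a7 4 (by norm_num), hI.s]
    have h14 : τ.scal 14 = I.θ := by
      rw [a6 14 (by norm_num) (by norm_num) (by norm_num), hI.θ]
    have hs : τ.pt 4 = I.s := by rw [a7 4 (by norm_num), hI.s]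
    rw [hs] at b1 b2
    rw [h14] at b4
    simp only [hs, a4, hI.y, a6 11 (by norm_num) (by norm_num) (by norm_num), hL.reg_l] at b3
    simp only [hs, h14, a6 12 (by norm_num) (by norm_num) (by norm_num), hL.reg_β] at b5
    have hυ : ∀ j, j ≠ 13 → j ≠ 15 → j ≠ 16 → υ.scal j = σ.scal j := fun j h1 h2 h3 => by
      rw [b6 j h2, a6 j h1 h2 h3]
    refine accelerationBlock_spec hQ (φ := ψ) (G := fun i => lam p (radius p D.m₂ δ)
        * ((Q.N *ᵥ (I.s + τ.pt 5)) i - (Q.N *ᵥ I.y) i)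
        - (Q.toObjective p).residual I.s (τ.pt 5) i) hp hθ (by positivity)
      ?_ ?_ ?_ b4 b1 b2 (funext b3) b5 fun w c1 c2 c3 c4 c5 c6 c7 c8 c9 => ?_
    · rw [hυ 0 (by norm_num) (by norm_num) (by norm_num), hσ.reg_p]
    · rw [b7 1 (by norm_num), a7 1 (by norm_num), hσ.reg_c]
    · rw [b6 14 (by norm_num), h14]
    rw [b7 3 (by norm_num), a7 3 (by norm_num), hI.v] at c2
    simp only [b7 3 (by norm_num), a7 3 (by norm_num), hI.v] at c3
    rw [b7 0 (by norm_num), a7 0 (by norm_num), hI.best] at c7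
    rw [hυ 5 (by norm_num) (by norm_num) (by norm_num),
      hυ 10 (by norm_num) (by norm_num) (by norm_num),
      hυ 7 (by norm_num) (by norm_num) (by norm_num), hσ.reg_m, hσ.reg_T, hL.reg_ρ] at c4
    have hsc : ∀ j, j ≠ 13 → j ≠ 14 → j ≠ 15 → j ≠ 16 → w.scal j = σ.scal j :=
      fun j h1 h2 h3 h4 => by rw [c8 j h2 h3, hυ j h1 h3 h4]
    refine hψ w ⟨⟨⟨w.pt 0, I.s + τ.pt 5, w.pt 3, w.pt 4, w.scal 14⟩,
      ⟨τ.pt 5, a1, Or.inr ⟨hc, rfl, c2, c3, c4, c5, c7⟩⟩,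
      rfl, c1, rfl, rfl, rfl, ?_⟩, hσ.congr ?_ c9, hL.congr ?_, ?_, ?_, ?_⟩
    · rw [c6, c5]; rfl
    · intro j hj
      exact hsc j (by omega) (by omega) (by omega) (by omega)
    · intro j hj
      exact hsc j (by omega) (by omega) (by omega) (by omega)
    · rw [c8 13 (by norm_num) (by norm_num), b6 13 (by norm_num), a5]
    · exact hsc 17 (by norm_num) (by norm_num) (by norm_num) (by norm_num)
    · exact hsc 18 (by norm_num) (by norm_num) (by norm_num) (by norm_num)

end LpRegression

namespace LpRegression

open Ex

variable {D : Dims} {S : LinearSystemSolver} {Q : Problem D} {p ε δ : ℝ}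

/-! ### Epochs -/

/-- The parameters and the first iterate of an epoch. -/
def epochBlock : List Assign :=
  [⟨.scalar, 9, sc 6 / sc 19⟩,
   ⟨.scalar, 10, (sc 9).pow (.const 1 / sc 0)⟩,
   ⟨.scalar, 11, .const 10000 * (sc 0 * sc 0 * (sc 10).pow (sc 0 - .const 2))⟩,
   ⟨.scalar, 12, .const 2 * sc 11 / (sc 7 * sc 7)⟩,
   ⟨.scalar, 13, .const 0⟩,
   ⟨.scalar, 14, .const 1 / sc 7⟩,
   ⟨.scalar, 17, valE (vr 0)⟩,
   ⟨.var, 2, vr 0⟩,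
   ⟨.var, 3, vr 0⟩,
   ⟨.var, 4, vr 0⟩,
   ⟨.rowN, 1, .apply .N (vr 0)⟩]

theorem epochBlock_spec (hp : 2 ≤ p) (hδ : 0 < δ) (hm : 1 ≤ D.m₂) {σ : State D}
    (hσ : Static Q p ε σ) (h6 : σ.scal 6 = δ) {φ : State D → Prop}
    (h : ∀ τ : State D, Static Q p ε τ → Level D p δ τ → τ.scal 13 = 0 →
      Holds Q τ ⟨σ.pt 0, σ.pt 0, σ.pt 0, σ.pt 0, 1 / horizon p D.m₂⟩ →
      τ.scal 17 = Q.objective p (σ.pt 0) → τ.scal 18 = σ.scal 18 → φ τ) :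
    φ (runAll S Q σ epochBlock) := by
  have hm1 : (1 : ℝ) ≤ D.m₂ := by exact_mod_cast hm
  have hτ := one_le_tau hp hm1
  have hρ := radius_pos hp hm1 hδ
  have hu0 : 0 ≤ δ / tau p D.m₂ := by positivity
  refine runAll_scalar fun τ₁ a1 a2 a3 a4 => ?_
  refine runAll_scalar fun τ₂ b1 b2 b3 b4 => ?_
  refine runAll_scalar fun τ₃ c1 c2 c3 c4 => ?_
  refine runAll_scalar fun τ₄ d1 d2 d3 d4 => ?_
  refine runAll_scalar fun τ₅ e1 e2 e3 e4 => ?_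
  refine runAll_scalar fun τ₆ f1 f2 f3 f4 => ?_
  refine runAll_scalar fun τ₇ g1 g2 g3 g4 => ?_
  refine runAll_var fun τ₈ i1 i2 i3 i4 => ?_
  refine runAll_var fun τ₉ j1 j2 j3 j4 => ?_
  refine runAll_var fun τ₀ k1 k2 k3 k4 => ?_
  refine runAll_rowN fun τ l1 l2 l3 l4 => ?_
  have hsc : τ.scal = τ₇.scal := by rw [l3, k3, j3, i3]
  have hpt : τ₇.pt = σ.pt := by rw [g3, f3, e3, d3, c3, b3, a3]
  have h9 : τ₁.scal 9 = δ / tau p D.m₂ := by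
    rw [a1, sval_div, sval_reg, sval_reg, h6, hσ.reg_τ]
  have h10 : τ₂.scal 10 = radius p D.m₂ δ := by
    rw [b1, sval_pow, sval_div, sval_reg, sval_reg, sval_one, h9, a2 0 (by norm_num), hσ.reg_p,
      abs_of_nonneg hu0]
    rfl
  have h11 : τ₃.scal 11 = lam p (radius p D.m₂ δ) := by
    have e : sval S Q τ₂ (.const 10000) = 10000 := by rw [sval_const]; norm_num
    rw [c1]
    simp only [sval_mul, sval_pow, sval_sub, sval_reg, sval_two, h10, b2 0 (by norm_num),
      a2 0 (by norm_num), hσ.reg_p, abs_of_nonneg hρ.le, e, lam, sq]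
  have hrest : ∀ j, j ≠ 9 → j ≠ 10 → j ≠ 11 → j ≠ 12 → j ≠ 13 → j ≠ 14 → j ≠ 17 →
      τ.scal j = σ.scal j := fun j h1 h2 h3 h4 h5 h6 h7 => by
    rw [hsc, g2 j h7, f2 j h6, e2 j h5, d2 j h4, c2 j h3, b2 j h2, a2 j h1]
  have h7 : ∀ j, j = 0 ∨ j = 7 → τ₃.scal j = σ.scal j := fun j hj => by
    rw [c2 j (by omega), b2 j (by omega), a2 j (by omega)]
  have hc : τ₇.pt 1 = Q.c := by rw [hpt, hσ.reg_c]
  refine h τ (hσ.congr ?_ ?_) ⟨?_, ?_, ?_, ?_, ?_⟩ ?_ ⟨?_, ?_, ?_, ?_, ?_, ?_⟩ ?_ ?_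
  · intro j hj
    exact hrest j (by omega) (by omega) (by omega) (by omega) (by omega) (by omega) (by omega)
  · rw [l4, k2 1 (by norm_num), j2 1 (by norm_num), i2 1 (by norm_num), hc]
  · rw [hrest 6 (by norm_num) (by norm_num) (by norm_num) (by norm_num) (by norm_num)
      (by norm_num) (by norm_num), h6]
  · rw [hsc, g2 9 (by norm_num), f2 9 (by norm_num), e2 9 (by norm_num), d2 9 (by norm_num),
      c2 9 (by norm_num), b2 9 (by norm_num), h9]
  · rw [hsc, g2 10 (by norm_num), f2 10 (by norm_num), e2 10 (by norm_num), d2 10 (by norm_num),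
      c2 10 (by norm_num), h10]
  · rw [hsc, g2 11 (by norm_num), f2 11 (by norm_num), e2 11 (by norm_num), d2 11 (by norm_num),
      h11]
  · rw [hsc, g2 12 (by norm_num), f2 12 (by norm_num), e2 12 (by norm_num), d1]
    simp only [sval_div, sval_mul, sval_two, sval_reg, h11, h7 7 (by norm_num), hσ.reg_T, sq]
  · rw [hsc, g2 13 (by norm_num), f2 13 (by norm_num), e1, sval_zero]
  · rw [l4, k2 0 (by norm_num), j2 0 (by norm_num), i2 0 (by norm_num), hpt]
  · rw [l4, k2 2 (by norm_num), j2 2 (by norm_num), i1, pval_reg, hpt]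
  · rw [l4, k2 3 (by norm_num), j1, pval_reg, i2 0 (by norm_num), hpt]
  · rw [l4, k1, pval_reg, j2 0 (by norm_num), i2 0 (by norm_num), hpt]
  · rw [hsc, g2 14 (by norm_num), f1]
    simp only [sval_div, sval_one, sval_reg]
    rw [e2 7 (by norm_num), d2 7 (by norm_num), h7 7 (by norm_num), hσ.reg_T]
  · rw [l1, rval_apply_N, pval_reg, k2 0 (by norm_num), j2 0 (by norm_num), i2 0 (by norm_num), hpt]
    simp [Iterate.y]
  · rw [hsc, g1, sval_valE _ (by rw [f3, e3, d3, c3, b3, a3, hσ.reg_c]), f2 0 (by norm_num),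
      e2 0 (by norm_num), d2 0 (by norm_num), h7 0 (by norm_num), hσ.reg_p, pval_reg, f3, e3, d3,
      c3, b3, a3]
  · exact hrest 18 (by norm_num) (by norm_num) (by norm_num) (by norm_num) (by norm_num)
      (by norm_num) (by norm_num)

/-- An epoch improves the best point, or halves the gap. -/
def epochProgram : Program :=
  .seq (assigns 30 epochBlock) (.while 13 8 tickProgram)

noncomputable def epochCost (p m : ℝ) : ℕ :=
  assignsCost epochBlock + ((⌊5 * horizon p m⌋₊ + 1) * (tickCost + 1) + 1)

theorem Objective.EpochReach.θ_pos {F : Objective (Fin D.n → ℝ) (Fin D.m₁) (Fin D.m₂)}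
    {V : Submodule ℝ (Fin D.n → ℝ)} {ρ T q : ℝ} {x₀ : Fin D.n → ℝ} {n : ℕ}
    {I : Iterate (Fin D.n → ℝ)} (h : F.EpochReach V ρ T q x₀ n I) (hT : 0 < T) : 0 < I.θ := by
  induction h with
  | start => exact one_div_pos.2 hT
  | tick _ ht ih =>
    obtain ⟨d, -, ⟨-, -, -, h, -⟩ | ⟨-, -, -, -, h, -⟩⟩ := ht
    · rw [h]; exact ih
    · rw [h]; exact stepSize_pos hT

/-- The counter equals the index in `EpochReach`, so on exit at least `5 T` iterations are done and
`progress` applies. The best point is kept between epochs. -/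
theorem reach_epoch (hQ : Q.LinearTermOrthogonal) (hp : 2 ≤ p) (hδ : 0 < δ) (hm : 1 ≤ D.m₂)
    {x₀ xs : Fin D.n → ℝ} (hxs : xs - x₀ ∈ Q.directions)
    (hmin : ∀ y, y - x₀ ∈ Q.directions → Q.objective p xs ≤ Q.objective p y)
    {σ : State D} (hσ : Static Q p ε σ) (h6 : σ.scal 6 = δ) (h0 : σ.pt 0 - x₀ ∈ Q.directions) :
    Reach 30 S Q epochProgram (epochCost p D.m₂) σ fun τ =>
      Static Q p ε τ ∧ τ.scal 6 = δ ∧ τ.scal 17 = Q.objective p (σ.pt 0) ∧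
      τ.scal 18 = σ.scal 18 ∧ τ.pt 0 - x₀ ∈ Q.directions ∧
      (Q.objective p (σ.pt 0) ≤ Q.objective p xs + δ →
        Q.objective p (τ.pt 0) ≤ Q.objective p xs + δ / 2) ∧
      (Q.objective p xs + δ ≤ Q.objective p (σ.pt 0) →
        Q.objective p (τ.pt 0) ≤ Q.objective p (σ.pt 0) - δ / 2) := by
  have hm1 : (1 : ℝ) ≤ D.m₂ := by exact_mod_cast hm
  have hT := horizon_pos hp hm1
  set T := horizon p (D.m₂ : ℝ) with hTdef
  let F := Q.toObjective p
  let I : ℕ → State D → Prop := fun k τ =>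
    (∃ I, F.EpochReach Q.directions (radius p D.m₂ δ) T (4 * p * D.m₂) (σ.pt 0) k I ∧
      Holds Q τ I) ∧ Static Q p ε τ ∧ Level D p δ τ ∧ τ.scal 13 = k ∧
      τ.scal 17 = Q.objective p (σ.pt 0) ∧ τ.scal 18 = σ.scal 18
  refine Reach.seq ((reach_assigns _ rfl (epochBlock_spec (S := S)
    (φ := fun τ => Reach 30 S Q (.while 13 8 tickProgram) _ τ _)
    hp hδ hm hσ h6 fun τ a1 a2 a3 a4 a5 a6 => ?_)).mono le_rfl fun τ h => h)
  refine (reach_while (by norm_num) (by norm_num) I (n := tickCost) (N := ⌊5 * T⌋₊ + 1) ?_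
    ⟨⟨_, Objective.EpochReach.start, a4⟩, a1, a2, by rw [a3]; norm_num, a5, a6⟩).mono le_rfl ?_
  · rintro k υ ⟨⟨J, b1, b2⟩, b3, b4, b5, b6, b7⟩ hlt
    rw [b5, b3.reg_count] at hlt
    -- The test is `k < 5 T`, hence at most `⌊5 T⌋ + 1` iterations.
    refine ⟨Nat.lt_succ_of_le (Nat.le_floor hlt.le), ?_⟩
    refine (reach_tick hQ hp hδ hm b3 b4 b2 (b1.θ_pos hT)).mono le_rfl ?_
    rintro w ⟨⟨J', c1, c2⟩, c3, c4, c5, c6, c7⟩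
    refine ⟨⟨J', Objective.EpochReach.tick b1 c1, c2⟩, c3, c4, ?_, by rw [c6, b6], by rw [c7, b7]⟩
    rw [c5, b5]; push_cast; ring
  · rintro υ ⟨⟨k, ⟨J, b1, b2⟩, b3, b4, b5, b6, b7⟩, hge⟩
    rw [b5, b3.reg_count, not_lt] at hge
    have hxs' : xs - σ.pt 0 ∈ Q.directions := by
      have := Q.directions.sub_mem hxs h0
      rwa [sub_sub_sub_cancel_right] at this
    obtain ⟨hmem, -⟩ := b1.mem
    have hcard : Fintype.card (Fin D.m₂) = D.m₂ := Fintype.card_fin _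
    have hprog := Objective.EpochReach.progress (Q.toObjective p) (V := Q.directions) (δ := δ)
      (x₀ := σ.pt 0) (xs := xs) (n := k) (I := J) hp hδ (by rw [hcard]; omega)
      (by rw [hcard]; exact b1) (by rw [hcard]; exact hge) hxs' (fun y hy => hmin y (by
        have := Q.directions.add_mem hy h0
        rwa [sub_add_sub_cancel] at this))
    refine ⟨b3, b4.reg_δ, b6, b7, ?_, ?_⟩
    · rw [b2.best]
      have := Q.directions.add_mem hmem h0
      rwa [sub_add_sub_cancel] at this
    · rw [b2.best]
      exact hprog

/-! ### The algorithm -/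

/-- Double the target decrease after a success, and halve it and stop after a failure. -/
def upBlock : List Assign :=
  [⟨.scalar, 15, .op .le (valE (vr 0)) (sc 17 - sc 6 / .const 2)⟩,
   ⟨.scalar, 6, sc 15 * (.const 2 * sc 6) + (.const 1 - sc 15) * (sc 6 / .const 2)⟩,
   ⟨.scalar, 18, .const 1 - sc 15⟩]

def downBlock : List Assign := [⟨.scalar, 6, sc 6 / .const 2⟩]

def startBlock : List Assign :=
  [⟨.scalar, 19, (sc 5).pow ((sc 0 - .const 2) / (.const 3 * sc 0 - .const 2))⟩,
   ⟨.scalar, 7, .const 2000 * (sc 0 * sc 19)⟩,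
   ⟨.scalar, 8, .const 5 * sc 7⟩,
   ⟨.scalar, 6, sc 1⟩,
   ⟨.scalar, 18, .const 0⟩,
   ⟨.scalar, 20, .const 1⟩]

/-- The algorithm. -/
def mainProgram : Program :=
  .seq (assigns 30 startBlock)
    (.seq (.while 18 20 (.seq epochProgram (assigns 30 upBlock)))
      (.while 1 6 (.seq epochProgram (assigns 30 downBlock))))

theorem upBlock_spec {σ : State D} (hσ : Static Q p ε σ) {φ : State D → Prop}
    (h : ∀ τ : State D, Static Q p ε τ → τ.pt 0 = σ.pt 0 →
      ((Q.objective p (σ.pt 0) ≤ σ.scal 17 - σ.scal 6 / 2 ∧ τ.scal 6 = 2 * σ.scal 6 ∧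
          τ.scal 18 = 0) ∨
        (¬ Q.objective p (σ.pt 0) ≤ σ.scal 17 - σ.scal 6 / 2 ∧ τ.scal 6 = σ.scal 6 / 2 ∧
          τ.scal 18 = 1)) → φ τ) :
    φ (runAll S Q σ upBlock) := by
  refine runAll_scalar fun τ₁ a1 a2 a3 a4 => ?_
  refine runAll_scalar fun τ₂ b1 b2 b3 b4 => ?_
  refine runAll_scalar fun τ c1 c2 c3 c4 => ?_
  refine h τ (hσ.congr (fun j hj => ?_) ?_) ?_ ?_
  · rw [c2 j (by omega), b2 j (by omega), a2 j (by omega)]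
  · rw [c3, b3, a3, hσ.reg_c]
  · rw [c3, b3, a3]
  · rw [sval_le, sval_valE _ hσ.reg_c, hσ.reg_p] at a1
    simp only [pval_reg, sval_sub, sval_div, sval_two, sval_reg] at a1
    rw [c2 6 (by norm_num), b1, c1]
    simp only [sval_add, sval_mul, sval_sub, sval_div, sval_one, sval_two, sval_reg,
      b2 15 (by norm_num), a2 6 (by norm_num)]
    by_cases hle : Q.objective p (σ.pt 0) ≤ σ.scal 17 - σ.scal 6 / 2
    · rw [if_pos hle] at a1
      left
      rw [a1]
      exact ⟨hle, by ring, by ring⟩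
    · rw [if_neg hle] at a1
      right
      rw [a1]
      exact ⟨hle, by ring, by ring⟩

noncomputable def mainCost (p m : ℝ) (N : ℕ) : ℕ :=
  assignsCost startBlock + ((N * (epochCost p m + assignsCost upBlock + 1) + 1)
    + (N * (epochCost p m + assignsCost downBlock + 1) + 1))

/-- After `k` successes with targets `ε, 2 ε, …` the total decrease is at least `(2 ^ k - 1) ε / 2`,
so the initial gap bounds `k`. A failure with target `δ` shows that the gap was below `δ`, hence is
now at most `δ / 2`. From there on each epoch halves gap and target together, and the number of
halvings is at most that of the doublings. -/
theorem reach_main (hQ : Q.LinearTermOrthogonal) (hp : 2 ≤ p) (hε : 0 < ε) (hm : 1 ≤ D.m₂)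
    {x₀ xs : Fin D.n → ℝ} (hxs : xs - x₀ ∈ Q.directions)
    (hmin : ∀ y, y - x₀ ∈ Q.directions → Q.objective p xs ≤ Q.objective p y) {N : ℕ}
    (hN : ∀ k : ℕ, ((2 : ℝ) ^ k - 1) * (ε / 2) ≤ Q.objective p x₀ - Q.objective p xs → k < N) :
    Reach 30 S Q mainProgram (mainCost p D.m₂ N) (inputState Q p ε x₀) fun τ =>
      τ.pt 0 - x₀ ∈ Q.directions ∧ Q.objective p (τ.pt 0) ≤ Q.objective p xs + ε := by
  suffices H : ∀ ψ : State D → Prop, (∀ τ : State D, τ.pt 0 - x₀ ∈ Q.directions →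
      Q.objective p (τ.pt 0) ≤ Q.objective p xs + ε → ψ τ) →
      Reach 30 S Q mainProgram (mainCost p D.m₂ N) (inputState Q p ε x₀) ψ from
    H _ fun _ h h' => ⟨h, h'⟩
  intro ψ hψ
  let Up : ℕ → State D → Prop := fun k τ => Static Q p ε τ ∧ τ.pt 0 - x₀ ∈ Q.directions ∧
    ((τ.scal 18 = 0 ∧ τ.scal 6 = 2 ^ k * ε ∧
        Q.objective p (τ.pt 0) ≤ Q.objective p x₀ - (2 ^ k - 1) * (ε / 2)) ∨
      (τ.scal 18 = 1 ∧ ∃ j, j < N ∧ τ.scal 6 = 2 ^ j * ε / 2 ∧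
        Q.objective p (τ.pt 0) ≤ Q.objective p xs + τ.scal 6))
  refine Reach.seq ((reach_assigns startBlock rfl ?_).mono le_rfl fun τ h => h)
  set σ : State D := inputState Q p ε x₀ with hσ
  refine runAll_scalar (φ := fun τ => Reach 30 S Q _ _ τ ψ) fun τ₁ a1 a2 a3 a4 => ?_
  refine runAll_scalar (φ := fun τ => Reach 30 S Q _ _ τ ψ) fun τ₂ b1 b2 b3 b4 => ?_
  refine runAll_scalar (φ := fun τ => Reach 30 S Q _ _ τ ψ) fun τ₃ c1 c2 c3 c4 => ?_
  refine runAll_scalar (φ := fun τ => Reach 30 S Q _ _ τ ψ) fun τ₄ d1 d2 d3 d4 => ?_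
  refine runAll_scalar (φ := fun τ => Reach 30 S Q _ _ τ ψ) fun τ₅ e1 e2 e3 e4 => ?_
  refine runAll_scalar (φ := fun τ => Reach 30 S Q _ _ τ ψ) fun τ f1 f2 f3 f4 => ?_
  have s0 : σ.scal 0 = p := rfl
  have s1 : σ.scal 1 = ε := rfl
  have s5 : σ.scal 5 = D.m₂ := rfl
  have hpt : τ.pt = σ.pt := by rw [f3, e3, d3, c3, b3, a3]
  have hx₀ : τ.pt 0 = x₀ := by rw [hpt]; rfl
  have h3 : ∀ υ : State D, sval S Q υ (.const 3) = 3 := fun υ => by rw [sval_const]; norm_num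
  have h5 : ∀ υ : State D, sval S Q υ (.const 5) = 5 := fun υ => by rw [sval_const]; norm_num
  have h2000 : ∀ υ : State D, sval S Q υ (.const 2000) = 2000 := fun υ => by
    rw [sval_const]; norm_num
  have h19 : τ₁.scal 19 = tau p D.m₂ := by
    rw [a1]
    simp only [sval_pow, sval_div, sval_sub, sval_mul, sval_reg, sval_two, h3, s0, s5, tau]
    rw [abs_of_nonneg (Nat.cast_nonneg _)]
  have h7 : τ₂.scal 7 = horizon p D.m₂ := by
    rw [b1]
    simp only [sval_mul, sval_reg, h2000, a2 0 (by norm_num), s0, h19, horizon]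
  have h8 : τ₃.scal 8 = 5 * horizon p D.m₂ := by
    rw [c1]
    simp only [sval_mul, sval_reg, h5, h7]
  have hstat : Static Q p ε τ := by
    refine ⟨?_, ?_, ?_, ?_, ?_, ?_, ?_, ?_⟩
    · rw [f2 0 (by norm_num), e2 0 (by norm_num), d2 0 (by norm_num), c2 0 (by norm_num),
        b2 0 (by norm_num), a2 0 (by norm_num), s0]
    · rw [f2 1 (by norm_num), e2 1 (by norm_num), d2 1 (by norm_num), c2 1 (by norm_num),
        b2 1 (by norm_num), a2 1 (by norm_num), s1]
    · rw [f2 5 (by norm_num), e2 5 (by norm_num), d2 5 (by norm_num), c2 5 (by norm_num),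
        b2 5 (by norm_num), a2 5 (by norm_num), s5]
    · rw [f2 7 (by norm_num), e2 7 (by norm_num), d2 7 (by norm_num), c2 7 (by norm_num), h7]
    · rw [f2 8 (by norm_num), e2 8 (by norm_num), d2 8 (by norm_num), h8]
    · rw [f2 19 (by norm_num), e2 19 (by norm_num), d2 19 (by norm_num), c2 19 (by norm_num),
        b2 19 (by norm_num), h19]
    · rw [f1, sval_one]
    · rw [hpt]; rfl
  have h6 : τ.scal 6 = ε := by
    rw [f2 6 (by norm_num), e2 6 (by norm_num), d1, sval_reg, c2 1 (by norm_num),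
      b2 1 (by norm_num), a2 1 (by norm_num), s1]
  have h18 : τ.scal 18 = 0 := by rw [f2 18 (by norm_num), e1, sval_zero]
  have hUp0 : Up 0 τ := by
    refine ⟨hstat, by rw [hx₀, sub_self]; exact Q.directions.zero_mem, Or.inl ⟨h18, ?_, ?_⟩⟩
    · rw [h6]; norm_num
    · rw [hx₀]; norm_num
  change Reach 30 S Q _ _ τ ψ
  refine Reach.seq ((reach_while (by norm_num) (by norm_num) Up ?_ hUp0).mono le_rfl ?_)
  · rintro k υ ⟨u1, u2, hu⟩ hlt
    rw [u1.reg_one] at hlt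
    obtain ⟨u3, u4, u5⟩ : υ.scal 18 = 0 ∧ υ.scal 6 = 2 ^ k * ε ∧
        Q.objective p (υ.pt 0) ≤ Q.objective p x₀ - (2 ^ k - 1) * (ε / 2) := by
      rcases hu with hu | ⟨hu, -⟩
      · exact hu
      · rw [hu] at hlt; exact absurd hlt (lt_irrefl _)
    have hkN : k < N := hN k (by have := hmin _ u2; linarith)
    refine ⟨hkN, ?_⟩
    refine Reach.seq ((reach_epoch hQ hp (δ := 2 ^ k * ε) (by positivity) hm hxs hmin u1 u4
      u2).mono le_rfl ?_)
    rintro w ⟨w1, w2, w3, w4, w5, w6, w7⟩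
    refine reach_assigns _ rfl (upBlock_spec w1 fun z z1 z2 z3 => ?_)
    rw [w2, w3] at z3
    refine ⟨z1, by rw [z2]; exact w5, ?_⟩
    rcases z3 with ⟨z4, z5, z6⟩ | ⟨z4, z5, z6⟩
    · refine Or.inl ⟨z6, by rw [z5, pow_succ]; ring, ?_⟩
      rw [z2, pow_succ]
      linarith
    · refine Or.inr ⟨z6, k, hkN, z5, ?_⟩
      rw [z2, z5]
      refine w6 ?_
      -- A gap of at least `δ` before the epoch would have led to the decrease `δ / 2`, that is, to
      -- a success.
      by_contra hcon
      exact z4 (w7 (not_le.1 hcon).le)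
  · rintro υ ⟨⟨k, u1, u2, hu⟩, hge⟩
    rw [u1.reg_one, not_lt] at hge
    obtain ⟨-, j, hjN, u6, u7⟩ : υ.scal 18 = 1 ∧ ∃ j, j < N ∧ υ.scal 6 = 2 ^ j * ε / 2 ∧
        Q.objective p (υ.pt 0) ≤ Q.objective p xs + υ.scal 6 := by
      rcases hu with ⟨hu, -⟩ | hu
      · rw [hu] at hge; norm_num at hge
      · exact hu
    let Down : ℕ → State D → Prop := fun k τ => Static Q p ε τ ∧ τ.pt 0 - x₀ ∈ Q.directions ∧
      τ.scal 6 * 2 ^ k = 2 ^ j * ε / 2 ∧ Q.objective p (τ.pt 0) ≤ Q.objective p xs + τ.scal 6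
    have hD0 : Down 0 υ := ⟨u1, u2, by rw [u6]; ring, u7⟩
    refine (reach_while (by norm_num) (by norm_num) Down ?_ hD0).mono le_rfl ?_
    · rintro i w ⟨w1, w2, w3, w4⟩ hlt
      rw [w1.reg_ε] at hlt
      have hi2 : (0 : ℝ) < 2 ^ i := by positivity
      -- The target after `i` halvings is `2 ^ j * ε / 2 / 2 ^ i`; if it still exceeds `ε`, then `i
      -- < j`.
      have hij : i < j := by
        have h9 : (2 : ℝ) ^ i * ε < 2 ^ j * ε := by
          have h10 : ε * 2 ^ i < w.scal 6 * 2 ^ i := by gcongr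
          have h11 : 0 < (2 : ℝ) ^ j * ε := by positivity
          linarith
        exact (pow_lt_pow_iff_right₀ (by norm_num : (1 : ℝ) < 2)).1
          (lt_of_mul_lt_mul_right h9 hε.le)
      refine ⟨hij.trans hjN, ?_⟩
      refine Reach.seq ((reach_epoch hQ hp (δ := w.scal 6) (hε.trans hlt) hm hxs hmin w1 rfl
        w2).mono le_rfl ?_)
      rintro v ⟨v1, v2, v3, v4, v5, v6, v7⟩
      refine reach_assigns downBlock rfl (runAll_scalar (φ := Down (i + 1)) fun z z1 z2 z3 z4 => ?_)
      change Down (i + 1) z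
      have z6 : z.scal 6 = w.scal 6 / 2 := by
        rw [z1, sval_div, sval_two, sval_reg, v2]
      refine ⟨v1.congr (fun j hj => z2 j (by omega)) (by rw [z3, v1.reg_c]), by rw [z3]; exact v5,
        ?_, ?_⟩
      · rw [z6, pow_succ, ← w3]; ring
      · rw [z3, z6]
        exact v6 w4
    · rintro w ⟨⟨i, w1, w2, w3, w4⟩, hge⟩
      rw [w1.reg_ε, not_lt] at hge
      exact hψ w w2 (by linarith)

end LpRegression

namespace LpRegression

/-! ### The number of steps -/

/-- From `2 ^ k ≤ 1 + 2 t ≤ 4 max(1, t)` one gets `(k - 2) log 2 ≤ log⁺ t`, and `log 2 > 1/2`. -/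
theorem le_of_two_pow_sub_one_le {t : ℝ} {k : ℕ} (ht : ((2 : ℝ) ^ k - 1) / 2 ≤ t) :
    (k : ℝ) ≤ 2 * (1 + max 0 (Real.log t)) := by
  have hlog2 := Real.log_two_gt_d9
  have h1 : (2 : ℝ) ^ k ≤ 4 * max 1 t := by
    have := le_max_left 1 t
    have := le_max_right 1 t
    linarith
  have h2 := Real.log_le_log (by positivity) h1
  have h3 : (4 : ℝ) = 2 ^ 2 := by norm_num
  have h4 : Real.log (max 1 t) ≤ max 0 (Real.log t) := by
    rcases le_total 1 t with h | h
    · rw [max_eq_right h]; exact le_max_right _ _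
    · rw [max_eq_left h, Real.log_one]; exact le_max_left _ _
  rw [Real.log_pow, Real.log_mul (by norm_num) (by positivity), h3, Real.log_pow] at h2
  push_cast at h2
  have h5 : ((k : ℝ) - 2) * Real.log 2 ≤ max 0 (Real.log t) := by linarith
  by_contra! h
  have h6 : 0 ≤ max 0 (Real.log t) := le_max_left _ _
  nlinarith

/-- The constant of the running time. -/
noncomputable def costConstant : ℝ :=
  2000 * (assignsCost startBlock + 2 + 3 * (2 * (assignsCost epochBlock + 6 * tickCost + 7)
    + assignsCost upBlock + assignsCost downBlock + 2))

theorem epochCost_le {p m : ℝ} (hT : 1 ≤ horizon p m) :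
    (epochCost p m : ℝ) ≤ (assignsCost epochBlock + 6 * tickCost + 7) * horizon p m := by
  have h := Nat.floor_le (show 0 ≤ 5 * horizon p m by linarith)
  have ha : (0 : ℝ) ≤ assignsCost epochBlock := Nat.cast_nonneg _
  have hb : (0 : ℝ) ≤ tickCost := Nat.cast_nonneg _
  rw [epochCost]
  push_cast
  nlinarith [mul_le_mul_of_nonneg_right h (by linarith : (0 : ℝ) ≤ tickCost + 1),
    mul_le_mul_of_nonneg_left hT ha, mul_le_mul_of_nonneg_left hT hb]

theorem mainCost_le {p m l : ℝ} {N : ℕ} (hp : 2 ≤ p) (hm : 1 ≤ m) (hl : 1 ≤ l)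
    (hN : (N : ℝ) ≤ 3 * l) : (mainCost p m N : ℝ) ≤ costConstant * (p * tau p m * l) := by
  have hτ := one_le_tau hp hm
  have hr : 1 ≤ p * tau p m := by nlinarith
  have hT : 1 ≤ horizon p m := by unfold horizon; linarith
  have he := epochCost_le hT
  have hs : (0 : ℝ) ≤ assignsCost startBlock := Nat.cast_nonneg _
  have ha : (0 : ℝ) ≤ assignsCost epochBlock := Nat.cast_nonneg _
  have hb : (0 : ℝ) ≤ tickCost := Nat.cast_nonneg _
  have hu : (0 : ℝ) ≤ assignsCost upBlock := Nat.cast_nonneg _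
  have hd : (0 : ℝ) ≤ assignsCost downBlock := Nat.cast_nonneg _
  have hC : costConstant * (p * tau p m * l) = (assignsCost startBlock + 2 +
      3 * (2 * (assignsCost epochBlock + 6 * tickCost + 7)
        + assignsCost upBlock + assignsCost downBlock + 2)) * (horizon p m * l) := by
    unfold costConstant horizon
    ring
  rw [hC, mainCost]
  push_cast
  set T := horizon p m
  set a : ℝ := (assignsCost epochBlock + 6 * tickCost + 7 : ℝ)
  set w : ℝ := (assignsCost upBlock + assignsCost downBlock + 2 : ℝ)
  have hw : 0 ≤ w := by positivity
  have ha' : 0 ≤ a := by positivity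
  have h1 : 2 * (epochCost p m : ℝ) + w ≤ (2 * a + w) * T := by
    nlinarith [mul_le_mul_of_nonneg_left hT hw]
  have h2 : (N : ℝ) * (2 * (epochCost p m : ℝ) + w) ≤ 3 * l * ((2 * a + w) * T) :=
    mul_le_mul hN h1 (by positivity) (by positivity)
  have h3 : (assignsCost startBlock + 2 : ℝ) * 1 ≤ (assignsCost startBlock + 2) * (T * l) :=
    mul_le_mul_of_nonneg_left (one_le_mul_of_one_le_of_one_le hT hl) (by positivity)
  calc _ = (assignsCost startBlock + 2 : ℝ) * 1 + N * (2 * (epochCost p m : ℝ) + w) := by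
        simp only [w]; ring
    _ ≤ (assignsCost startBlock + 2 : ℝ) * (T * l) + 3 * l * ((2 * a + w) * T) := add_le_add h3 h2
    _ = _ := by simp only [w]; ring

variable {D : Dims} {Q : Problem D}

theorem Problem.sub_mem_directions_iff {x₀ y : Fin D.n → ℝ} (h : Q.Feasible x₀) :
    y - x₀ ∈ Q.directions ↔ Q.Feasible y := by
  rw [Q.mem_directions, Matrix.mulVec_sub, h, sub_eq_zero, Problem.Feasible]

theorem Problem.exists_isOptimizer (hQ : Q.LinearTermOrthogonal) {p : ℝ} (hp : 2 ≤ p)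
    {x₀ : Fin D.n → ℝ} (h : Q.Feasible x₀) : ∃ xs, Q.IsOptimizer p xs := by
  obtain ⟨xs, h1, h2⟩ := (Q.toObjective p).exists_minimizer hp Q.directions x₀
    fun v hv hM hN => hQ v hM hN (Q.mem_directions.1 hv)
  exact ⟨xs, (Q.sub_mem_directions_iff h).1 h1,
    fun y hy => h2 y ((Q.sub_mem_directions_iff h).2 hy)⟩

end LpRegression

open LpRegression in
theorem mainTheorem1 :
    ∃ (P : LpRegression.Program) (C : ℝ), 0 < C ∧
      ∀ (D : LpRegression.Dims), 0 < D.n → D.d ≤ D.n → D.n ≤ D.m₁ → D.n ≤ D.m₂ →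
      ∀ (Q : LpRegression.Problem D), Q.LinearTermOrthogonal →
      ∀ (p ε : ℝ), 2 ≤ p → 0 < ε →
      ∀ x₀ : Fin D.n → ℝ, Q.Feasible x₀ →
        ∃ xs : Fin D.n → ℝ, Q.IsOptimizer p xs ∧
          ∀ S : LpRegression.LinearSystemSolver,
            ∃ (x : Fin D.n → ℝ) (calls steps : ℕ),
              P.Computes S Q p ε x₀ x calls steps ∧
              Q.Feasible x ∧ Q.objective p x ≤ Q.objective p xs + ε ∧
              (calls : ℝ) ≤ C * LpRegression.rate Q p ε x₀ xs ∧
              (steps : ℝ) ≤ C * LpRegression.rate Q p ε x₀ xs := by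
  have hC : 0 < costConstant := by unfold costConstant; positivity
  refine ⟨mainProgram, costConstant, hC, ?_⟩
  intro D hn _ _ hn2 Q hQ p ε hp hε x₀ hx₀
  obtain ⟨xs, hxs, hmin⟩ := Q.exists_isOptimizer hQ hp hx₀
  refine ⟨xs, ⟨hxs, hmin⟩, fun S => ?_⟩
  have hm : 1 ≤ D.m₂ := by omega
  have hm' : (1 : ℝ) ≤ D.m₂ := by exact_mod_cast hm
  set l : ℝ := 1 + max 0 (Real.log ((Q.objective p x₀ - Q.objective p xs) / ε)) with hl
  have hl1 : 1 ≤ l := by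
    have : 0 ≤ max 0 (Real.log ((Q.objective p x₀ - Q.objective p xs) / ε)) := le_max_left _ _
    linarith
  have hN (k : ℕ) (hk : ((2 : ℝ) ^ k - 1) * (ε / 2) ≤ Q.objective p x₀ - Q.objective p xs) :
      k < ⌊2 * l⌋₊ + 1 := by
    refine Nat.lt_succ_of_le (Nat.le_floor (le_of_two_pow_sub_one_le ?_))
    rw [le_div_iff₀ hε]
    linarith
  obtain ⟨τ', c, k, hexec, hk, τ, hτ, hfeas, hval⟩ := reach_main (S := S) hQ hp hε hm
    ((Q.sub_mem_directions_iff hx₀).2 hxs)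
    (fun y hy => hmin y ((Q.sub_mem_directions_iff hx₀).1 hy)) hN _ (Agree.refl 30 _)
  -- The output register lies below the scratch registers, so the actual final state and the
  -- described one agree on it.
  have hout : τ'.output = τ.pt 0 := hτ .var 0 (by norm_num)
  have hfloor : ((⌊2 * l⌋₊ + 1 : ℕ) : ℝ) ≤ 3 * l := by
    have := Nat.floor_le (show 0 ≤ 2 * l by linarith)
    push_cast
    linarith
  -- The algorithm works with `m₂` alone, and the exponent is nonnegative, so the bound with `m =
  -- max {m₁, m₂}` follows.
  have hτm : tau p D.m₂ ≤ (D.m : ℝ) ^ ((p - 2) / (3 * p - 2)) :=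
    Real.rpow_le_rpow (by positivity) (by exact_mod_cast le_max_right _ _)
      (div_nonneg (by linarith) (by linarith))
  have hsteps : (k : ℝ) ≤ costConstant * rate Q p ε x₀ xs :=
    calc (k : ℝ) ≤ mainCost p D.m₂ (⌊2 * l⌋₊ + 1) := by exact_mod_cast hk
      _ ≤ costConstant * (p * tau p D.m₂ * l) := mainCost_le hp hm' hl1 hfloor
      _ ≤ costConstant * rate Q p ε x₀ xs := by
        unfold rate
        rw [← hl]
        gcongr
  refine ⟨τ'.output, c, k, ⟨τ', hexec, rfl⟩, ?_, ?_, le_trans ?_ hsteps, hsteps⟩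
  · rw [hout]; exact (Q.sub_mem_directions_iff hx₀).1 hfeas
  · rw [hout]; exact hval
  · exact_mod_cast hexec.calls_le
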